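/- **Setting.** Let $k\ge 2$, let $d_1,\dots,d_k\ge 1$ be integers, not all equal to $1$, and put $m=d_1+\dots+d_k$. Let $W_1^*,\dots,W_k^*$ be copies of $\mathbb R^2$ and $V^*=\bigotimes_{i=1}^k (W_i^*)^{\otimes d_i}$; the slots of $V^*$ are labelled by pairs $(i,r)$, $1\le i\le k$, $1\le r\le d_i$. For $T\in (W_i^*)^{\otimes d_i}$ let $ins_i\big(T\otimes(1,0)^{\otimes(m-d_i)}\big)\in V^*$ be the tensor with $T$ in the slots $(i,1),\dots,(i,d_i)$ and $(1,0)$ in every other slot. The product Segre–Veronese factorization structure is the inclusion $\varphi$ into $V^*$ of the $(m+1)$-dimensional space $$\mathfrak h=\sum_{i=1}^k ins_i\big(S^{d_i}W_i^*\otimes\langle(1,0)^{\otimes(m-d_i)}\rangle\big);$$ the assumptions $k\geq 2$ and $(d_i)\ne(1,\dots,1)$ say that it is neither Veronese nor Segre. For $h\in\mathfrak h$ and $x=(x_{ir})\in\mathbb R^m$ put $$\langle\mu,h\rangle=\Big\langle\bigotimes_{i,r}(1,x_{ir}),h\Big\rangle=h_0+\sum_{i=1}^k\sum_{r=1}^{d_i}h_{ir}\,\sigma_r(x_{i1},\dots,x_{id_i}),$$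 where $\sigma_r$ are the elementary symmetric polynomials; this defines the components $h_{ir}$. Let $\beta\in\mathfrak h$, let $U\subset\mathbb R^m$ be open, connected and non-empty, let $I_{ir}$ be the interval of values of $x_{ir}$ on $U$, let $A_{ir}:I_{ir}\to\mathbb R$ be smooth, and put $\Delta_{ir}=\prod_{s\ne r}(x_{ir}-x_{is})$. Assume that $\Delta_{ir}\,A_{ir}(x_{ir})\,\langle\mu,\beta\rangle>0$ on $U$ for all $i,r$. Let $\mathfrak t=\mathfrak h/\langle\beta\rangle$, let $t$ be a $\mathfrak t$-valued coordinate and $\mu_\beta=\mu/\langle\mu,\beta\rangle$. The associated separable Kähler geometry is the Kähler structure on $U\times\mathfrak t$ given by $$g_\beta=\sum_{i,r}\Big(\frac{\Delta_{ir}}{A_{ir}(x_{ir})\langle\mu,\beta\rangle}dx_{ir}^2+\frac{A_{ir}(x_{ir})\langle\mu,\beta\rangle}{\Delta_{ir}}\langle\partial_{x_{ir}}\mu_\beta,dt\rangle^2\Big),\qquad \omega_\beta=\sum_{i,r}dx_{ir}\wedge\langle\partial_{x_{ir}}\mu_\beta,dt\rangle .$$ It is *extremal* if the scalar curvature of $g_\beta$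 is a Killing potential, i.e. its $\omega_\beta$-gradient is a Killing vector field of $g_\beta$. Put $S=\{i\mid \beta_{ir}\neq0\text{ for some }r\}$. All equations between functions of $x_{ir}$ below are meant on $I_{ir}$; $\Upsilon_i(x)=\sum_j\gamma_i^jx^j$ denotes a real polynomial (independent of $r$) with its coefficients, and $\Upsilon(x)=\sum_j\gamma^jx^j$ likewise. The notation $A=\iint f$ means $A''=f$ (the integration constants may depend on $i$ and $r$). **Theorem.** The geometry is extremal if and only if one of the following holds. 1. $\varphi(\beta)=t\,(1,0)^{\otimes m}$ with $t\in\mathbb R\setminus\{0\}$, and there are polynomials $\tilde\Upsilon_p$ with $\deg\tilde\Upsilon_p\le d_p+2$ and numbers $\nu^0_{pq},\nu^1_{pq}\in\mathbb R$ such that $A_{pq}(x_{pq})=\tilde\Upsilon_p(x_{pq})+\nu^0_{pq}+\nu^1_{pq}x_{pq}$ for all $p,q$. 2. $\varphi(\beta)=ins_p\big(t\,(a,b)^{\otimes d_p}\otimes(1,0)^{\otimes(m-d_p)}\big)$ for some $p$, $a\in\mathbb R$, $t\neq0$, $b\ne0$, and there are polynomials $\Upsilon_1,\dots,\Upsilon_k$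 with $\deg\Upsilon_p\le d_p+1$ and $\deg\Upsilon_i\le d_i-1$ for $i\ne p$ such that $$A_{pq}(x_{pq})=(a+bx_{pq})^{m+1}\iint\frac{\Upsilon_p(x_{pq})}{(a+bx_{pq})^{m+3}}\,dx_{pq}dx_{pq}\ \ (1\le q\le d_p),\qquad A_{ir}=\iint\Upsilon_i\ \ (i\ne p,\ 1\le r\le d_i),$$ $$\frac{\gamma_p^{d_p+1}}{b^2}+\sum_{i\neq p}\gamma_i^{d_i-1}=0 .$$ 3. Up to the order of the groups, $k=2$, $d_1=d$, $d_2=1$, i.e. $\mathfrak h=S^dW_1^*\otimes\langle(1,0)\rangle+\langle(1,0)^{\otimes d}\rangle\otimes W_2^*$; there is $q$ such that $\langle\mu,\beta\rangle$ and $\partial_{x_{1q}}\langle\mu,\beta\rangle$ are linearly independent over $\mathbb R[x_{1q}]$; $A_{21}=A_2$ is a polynomial of degree at most $2$; and there is a polynomial $\Upsilon$ of degree at most $m$ such that $A_{1r}(x_{1r})=\Upsilon(x_{1r})$ for $r=1,\dots,d$ and $2\gamma^m+A_2''=0$. 4. The partition $(d_1,\dots,d_k)$ is not, up to order, of the form $(d,1)$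 as in 3; there are $p$ and $q$ such that $\langle\mu,\beta\rangle$ and $\partial_{x_{pq}}\langle\mu,\beta\rangle$ are linearly independent over $\mathbb R[x_{pq}]$; there are polynomials $\Upsilon_1,\dots,\Upsilon_k$ with $$A_{ir}(x_{ir})=\Upsilon_i(x_{ir}),\ \deg\Upsilon_i\le d_i+1\ \ (i\in S,\ 1\le r\le d_i),\qquad A_{ir}=\iint\Upsilon_i,\ \deg\Upsilon_i\le d_i-1\ \ (i\notin S,\ 1\le r\le d_i);$$ and exactly one of the following holds: - (a) $S=\{p\}$ and $(m-d_p)(m+1-d_p)\,\gamma_p^{d_p+1}+\sum_{i\notin S}\gamma_i^{d_i-1}=0$; - (b) $S=\{p,\tilde p\}$ with $\tilde p\ne p$, $m=d_p+d_{\tilde p}$, and $\gamma_p^{d_p+1}+\gamma_{\tilde p}^{d_{\tilde p}+1}=0$; - (c) $|S|\ge2$, $k\ge3$, $\deg\Upsilon_j\le d_j$ for all $j\in S$, and $\sum_{i\notin S}\gamma_i^{d_i-1}=0$. -/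

import Mathlib

open scoped TensorProduct ContDiff Polynomial

noncomputable section

/-! ### Riemannian geometry in a coordinate chart

Tensors on an open subset of `ι → ℝ` are given by their components. -/

namespace ChartGeometry

variable {ι : Type*} [Fintype ι] [DecidableEq ι]

/-- The partial derivative `∂f/∂p_i`. -/
def pd (i : ι) (f : (ι → ℝ) → ℝ) (p : ι → ℝ) : ℝ :=
  fderiv ℝ f p (Pi.single i 1)

/-- The Christoffel symbols `Γ^i_{jk}` of the Levi-Civita connection of `g`. -/
def christoffel (g : (ι → ℝ) → Matrix ι ι ℝ) (i j k : ι) (p : ι → ℝ) : ℝ :=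
  (1 / 2) * ∑ l, (g p)⁻¹ i l *
    (pd j (fun y => g y k l) p + pd k (fun y => g y j l) p - pd l (fun y => g y j k) p)

/-- The Ricci tensor
`Ric_{jk} = ∂_i Γ^i_{jk} - ∂_j Γ^i_{ik} + Γ^i_{il} Γ^l_{jk} - Γ^i_{jl} Γ^l_{ik}`. -/
def ricci (g : (ι → ℝ) → Matrix ι ι ℝ) (j k : ι) (p : ι → ℝ) : ℝ :=
  ∑ i, (pd i (christoffel g i j k) p - pd j (christoffel g i i k) p) +
    ∑ i, ∑ l, (christoffel g i i l p * christoffel g l j k p -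
      christoffel g i j l p * christoffel g l i k p)

/-- The scalar curvature `g^{jk} Ric_{jk}`. -/
def scalarCurvature (g : (ι → ℝ) → Matrix ι ι ℝ) (p : ι → ℝ) : ℝ :=
  ∑ j, ∑ k, (g p)⁻¹ j k * ricci g j k p

/-- The components of the Lie derivative of the symmetric tensor `g` along the vector field with
components `K l`. -/
def lieDerivMetric (g : (ι → ℝ) → Matrix ι ι ℝ) (K : ι → (ι → ℝ) → ℝ) (i j : ι)
    (p : ι → ℝ) : ℝ :=
  ∑ l, (K l p * pd l (fun y => g y i j) p + g p l j * pd i (K l) p + g p i l * pd j (K l) p)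

/-- On a Kähler manifold with metric `g` and Kähler form `Ω` in a chart `M`, the function `f` is a
Killing potential if its symplectic gradient, i.e. the vector field `K` with `Ω(K, ·) = - df`, is a
Killing vector field. (Since `Ω` and `g` determine the complex structure `J`, this vector field is
`J grad f` up to the sign convention.) -/
def IsKillingPotential (g Ω : (ι → ℝ) → Matrix ι ι ℝ) (M : Set (ι → ℝ)) (f : (ι → ℝ) → ℝ) : Prop :=
  ∃ K : ι → (ι → ℝ) → ℝ, (∀ l, ContDiffOn ℝ ∞ (K l) M) ∧
    (∀ p ∈ M, ∀ j, ∑ i, K i p * Ω p i j = - pd j f p) ∧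
    ∀ p ∈ M, ∀ i j, lieDerivMetric g K i j p = 0

end ChartGeometry

/-! ### The product Segre-Veronese factorization structure -/

namespace SegreVeronese

open ChartGeometry

/-- The two-dimensional spaces `W_j^*`, in the basis whose first vector `(1,0)` spans the
line `a^j`. -/
abbrev W : Type := Fin 2 → ℝ

variable {k : ℕ}

/-- The slots of the tensor product, `d i` of them in the `i`-th group. -/
abbrev Slot (d : Fin k → ℕ) : Type := Σ i : Fin k, Fin (d i)

/-- `V^* = ⨂_j (W_j^*)^{⊗ d_j}`. -/
abbrev Tensors (d : Fin k → ℕ) : Type := ⨂[ℝ] _ : Slot d, W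

/-- `S^n W^*`, the symmetric tensors in `(W^*)^{⊗ n}`. -/
def symTensors (n : ℕ) : Submodule ℝ (⨂[ℝ] _ : Fin n, W) where
  carrier := {T | ∀ σ : Equiv.Perm (Fin n), PiTensorProduct.reindex ℝ (fun _ => W) σ T = T}
  add_mem' := by
    intro S T hS hT σ
    rw [map_add, hS σ, hT σ]
  zero_mem' := by
    intro σ
    rw [map_zero]
  smul_mem' := by
    intro c T hT σ
    rw [map_smul, hT σ]

/-- Place `w` in the slots of the `i`-th group and `(1,0)` in all other slots. -/
def fill (d : Fin k → ℕ) (i : Fin k) (w : Fin (d i) → W) : Slot d → W :=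
  fun s => if h : s.1 = i then w (Fin.cast (congrArg d h) s.2) else ![1, 0]

lemma fill_update (d : Fin k → ℕ) (i : Fin k) [DecidableEq (Fin (d i))] (w : Fin (d i) → W)
    (r : Fin (d i)) (v : W) :
    fill d i (Function.update w r v) = Function.update (fill d i w) ⟨i, r⟩ v := by
  funext s
  obtain ⟨j, q⟩ := s
  by_cases h : j = i
  · subst h
    by_cases hq : q = r
    · subst hq
      simp [fill]
    · have hne : (⟨j, q⟩ : Slot d) ≠ ⟨j, r⟩ := by
        intro hh
        exact hq (eq_of_heq (Sigma.mk.inj hh).2)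
      rw [Function.update_of_ne hne]
      simp [fill, Function.update_of_ne hq]
  · have hne : (⟨j, q⟩ : Slot d) ≠ ⟨i, r⟩ := by
      intro hh
      exact h (Sigma.mk.inj hh).1
    rw [Function.update_of_ne hne]
    simp [fill, h]

/-- `ins_i (T ⊗ (1,0)^{⊗ (m - d_i)})`: the tensor `T` is placed in the `i`-th group of slots. -/
def ins (d : Fin k → ℕ) (i : Fin k) : (⨂[ℝ] _ : Fin (d i), W) →ₗ[ℝ] Tensors d :=
  PiTensorProduct.lift
    { toFun := fun w => PiTensorProduct.tprod ℝ (fill d i w)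
      map_update_add' := by
        intro _ w r u v
        simp only [fill_update, MultilinearMap.map_update_add]
      map_update_smul' := by
        intro _ w r c v
        simp only [fill_update, MultilinearMap.map_update_smul] }

/-- The product Segre-Veronese factorization structure
`𝔥 = ∑_i ins_i (S^{d_i} W_i^* ⊗ ⟨(1,0)^{⊗ (m - d_i)}⟩) ⊆ V^*`. -/
def productStructure (d : Fin k → ℕ) : Submodule ℝ (Tensors d) :=
  ⨆ i, (symTensors (d i)).map (ins d i)

/-- The contraction of a tensor in `V^*` with the decomposable tensor `⨂_s w_s` in `V`. -/
def contract (d : Fin k → ℕ) (w : Slot d → W) : Tensors d →ₗ[ℝ] ℝ :=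
  PiTensorProduct.lift
    ((MultilinearMap.mkPiAlgebra ℝ (Slot d) ℝ).compLinearMap
      (fun s => w s 0 • LinearMap.proj (R := ℝ) (φ := fun _ : Fin 2 => ℝ) 0 +
        w s 1 • LinearMap.proj (R := ℝ) (φ := fun _ : Fin 2 => ℝ) 1))

/-- The momentum section at the point with separable coordinates `x`:
`⟨μ, h⟩ = ⟨⨂_s (1, x_s), h⟩`. -/
def momentum (d : Fin k → ℕ) (x : Slot d → ℝ) : Tensors d →ₗ[ℝ] ℝ :=
  contract d (fun s => ![1, x s])

/-- The component `h_{i,r+1}` of `h ∈ 𝔥`: the coefficient of the `(r+1)`-st elementary symmetric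
polynomial in the variables `x_{i1}, …, x_{i d_i}` in
`⟨μ, h⟩ = h_0 + ∑_i ∑_{r=1}^{d_i} h_{ir} σ_r(x_{i1}, …, x_{i d_i})`. It is the coefficient of `h` at
the tensor with `(0,1)` in the first `r+1` slots of the `i`-th group and `(1,0)` elsewhere. -/
def component (d : Fin k → ℕ) (h : Tensors d) (i : Fin k) (r : Fin (d i)) : ℝ :=
  contract d (fun s => if s.1 = i ∧ s.2.val ≤ r.val then ![0, 1] else ![1, 0]) h

/-- `Δ_{ir} = ∏_{q ≠ r} (x_{ir} - x_{iq})`. -/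
def Delta (d : Fin k → ℕ) (x : Slot d → ℝ) (s : Slot d) : ℝ :=
  ∏ q ∈ Finset.univ.erase s.2, (x s - x ⟨s.1, q⟩)

/-- The data of a separable Kähler geometry associated with the product Segre-Veronese
factorization structure. -/
structure SeparableKahler (d : Fin k → ℕ) where
  /-- the element `β` of `𝔥` -/
  β : productStructure d
  /-- the range of the separable coordinates `x_{ir}` -/
  U : Set (Slot d → ℝ)
  isOpen_U : IsOpen U
  isConnected_U : IsConnected U
  /-- the functions of one variable `A_{ir}` -/
  A : Slot d → ℝ → ℝ
  /-- `A_{ir}` is smooth on the open interval of values of `x_{ir}` -/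
  smooth_A : ∀ s, ContDiffOn ℝ ∞ (A s) ((fun x => x s) '' U)
  /-- positive definiteness of the metric -/
  pos : ∀ x ∈ U, ∀ s, 0 < Delta d x s * A s (x s) * momentum d x (β : Tensors d)
  /-- representatives in `𝔥` of a basis of the torus algebra `𝔱 = 𝔥 / ⟨β⟩`, with respect to which
  the angular coordinates `t : M → 𝔱` are written -/
  frame : Slot d → productStructure d
  /-- `β` and the `m` representatives form a basis of the `(m+1)`-dimensional space `𝔥` -/
  frame_basis : LinearIndependent ℝ (fun o : Option (Slot d) => o.elim β frame)

namespace SeparableKahler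

variable {d : Fin k → ℕ} (G : SeparableKahler d)

/-- The function `⟨μ, β⟩` of the separable coordinates. -/
def twist (x : Slot d → ℝ) : ℝ := momentum d x (G.β : Tensors d)

/-- The interval of values of the coordinate `x_s`. -/
def interval (s : Slot d) : Set ℝ := (fun x => x s) '' G.U

/-- The components of the 1-forms `θ_s = ⟨∂_{x_s} μ_β, dt⟩ = ∑_a θ_{s,a} dt_a`, where
`μ_β = μ / ⟨μ, β⟩`. -/
def theta (x : Slot d → ℝ) (s a : Slot d) : ℝ :=
  pd s (fun y => momentum d y (G.frame a : Tensors d) / G.twist y) x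

/-- The separable coordinates of a point with coordinates `(x, t)`. -/
def xCoord (p : Slot d ⊕ Slot d → ℝ) : Slot d → ℝ := fun s => p (Sum.inl s)

/-- The chart domain, with coordinates `x ∈ U` and angular coordinates `t`. -/
def domain : Set (Slot d ⊕ Slot d → ℝ) := {p | xCoord p ∈ G.U}

/-- The metric
`g_β = ∑_s (Δ_s / (A_s(x_s) ⟨μ,β⟩)) dx_s² + (A_s(x_s) ⟨μ,β⟩ / Δ_s) θ_s²`. -/
def metric (p : Slot d ⊕ Slot d → ℝ) : Matrix (Slot d ⊕ Slot d) (Slot d ⊕ Slot d) ℝ :=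
  let x := xCoord p
  Matrix.fromBlocks
    (Matrix.diagonal fun s => Delta d x s / (G.A s (x s) * G.twist x)) 0
    0 (Matrix.of fun a b =>
      ∑ s, G.A s (x s) * G.twist x / Delta d x s * (G.theta x s a * G.theta x s b))

/-- The Kähler form `ω_β = ∑_s dx_s ∧ θ_s`. Together with `g_β` it determines the complex structure,
which acts by `J_β dx_s = (A_s(x_s) ⟨μ,β⟩ / Δ_s) θ_s`. -/
def kahlerForm (p : Slot d ⊕ Slot d → ℝ) : Matrix (Slot d ⊕ Slot d) (Slot d ⊕ Slot d) ℝ :=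
  let x := xCoord p
  Matrix.fromBlocks 0 (Matrix.of fun s a => G.theta x s a)
    (-(Matrix.of fun s a => G.theta x s a).transpose) 0

/-- The geometry is extremal: its scalar curvature is a Killing potential. -/
def IsExtremal : Prop :=
  IsKillingPotential G.metric G.kahlerForm G.domain (scalarCurvature G.metric)

/-- `S = {i | ∃ r, β_{ir} ≠ 0}`. -/
def support : Finset (Fin k) :=
  Finset.univ.filter fun i => ∃ r : Fin (d i), component d (G.β : Tensors d) i r ≠ 0

/-- `⟨μ, β⟩` and `∂_{x_s} ⟨μ, β⟩` are linearly independent over the polynomials `ℝ[x_s]`. -/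
def IndependentAt (s : Slot d) : Prop :=
  ∀ u v : ℝ[X],
    (∀ x : Slot d → ℝ, u.eval (x s) * G.twist x + v.eval (x s) * pd s G.twist x = 0) →
      u = 0 ∧ v = 0

end SeparableKahler

/-- `F` is a double primitive `∬ f` of `f` on the open interval `I`. -/
def IsDoublePrimitive (I : Set ℝ) (f F : ℝ → ℝ) : Prop :=
  ∃ F' : ℝ → ℝ, ∀ x ∈ I, HasDerivAt F (F' x) x ∧ HasDerivAt F' (f x) x

/-- Up to the order of the groups the factorization structure is
`S^{d} W_1^* ⊗ ⟨(1,0)⟩ + ⟨(1,0)^{⊗ d}⟩ ⊗ W_2^*`: there are two groups of slots, `i` and `j`, and the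
group `j` consists of a single slot. -/
def IsVeroneseTimesLine (d : Fin k → ℕ) (i j : Fin k) : Prop :=
  i ≠ j ∧ (∀ l, l = i ∨ l = j) ∧ d j = 1

end SegreVeronese

end

/-!
Write `L = ⟨μ, β⟩`, `A_s` and `Δ_s` for the data at the slot `s = (i, r)`, and `m` for the number of
slots.

*The extremality equation.* In the frame given by `∂_s` and the dual frame of the `1`-forms
`⟨∂_s μ_β, dt⟩`, a separable metric is diagonal and its Ricci tensor can be computed explicitly
(`SeparableFrame.scalarCurvature_eq`). The scalar curvature is a function on the base, and such a
function is a Killing potential if and only if it is of the form `⟨μ, h⟩ / L`. Together this says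
that the geometry is extremal if and only if

  `∑ s, D_s / Δ_s = ⟨μ, h⟩` for some `h`, where `D_s = L ^ (m + 3) * ∂_s² (A_s / L ^ (m + 1))`

(`isExtremal_iff`). What remains is to solve this equation for the functions `A_s`.

*The functions are polynomials.* Fix all coordinates outside the group `i`. As `Δ_s` is a product
over one group only, multiplication by the product of the differences of one coordinate with the
others of its group shows that, along that coordinate, the equation expresses a second order
operator in `A_s` by a polynomial (`exists_slice_polynomial`). The form of this operator depends on
`β`:

* if `L` does not depend on the group, `A_s''` is a polynomial, of degree at most `d_i - 1` unless
  `L` is constant;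
* if `L` vanishes on a hyperplane `x_s = c`, it is a constant multiple of `∏ r, (x_ir - c)`, because
  it is symmetric and multi-affine in each group (`affineFun_eq_prod`); then the operator is
  `(x - c) ^ (m + 3) * (A_s / (x - c) ^ (m + 1))''`;
* otherwise the root of `L` as a function of `x_s` moves with the other coordinates, and the
  equation for several positions of this root determines `A_s`, which is a polynomial of degree at
  most `d_i + 1`. Comparing two slots of one group, the polynomial is the same for both
  (`GroupEquation.exists_common_polynomial`).

*The coefficients.* Once the functions of each group are given by one polynomial, the sums over the
groups are evaluated by Lagrange interpolation at the points `x_i1, …, x_id_i`. If `L` vanishes on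
no such hyperplane and is not constant, then, modulo functions `⟨μ, h⟩`, the whole left hand side is
a quadratic form in the parts of `L` belonging to the groups, whose coefficients are leading
coefficients of the polynomials (`exists_sum_density_eq_quadForm`). It is itself of the form
`⟨μ, h⟩`, a multi-affine sum of functions of the separate groups, precisely when the cross terms and
the squares cancel; these are the relations (a), (b), (c) between the leading coefficients
(`ExtremalityEquation.leadingCoeff_relations`, and `exists_quadForm_eq` for the converse). For the
partition `(d, 1)` the alternatives (a) and (b) merge into the relation `2 γ^m + A_2'' = 0`
(`ExtremalityEquation.of_isVeroneseTimesLine`).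
-/


noncomputable section

set_option linter.unusedSectionVars false

namespace ChartGeometry

/-! ### Calculus of partial derivatives -/

section PartialDerivatives

variable {ι : Type*} [Fintype ι] [DecidableEq ι] {f g : (ι → ℝ) → ℝ} {x : ι → ℝ}

lemma pd_congr {V : Set (ι → ℝ)} (hV : IsOpen V) (h : ∀ y ∈ V, f y = g y) (hx : x ∈ V) (i : ι) :
    pd i f x = pd i g x := by
  have : f =ᶠ[nhds x] g := by
    filter_upwards [hV.mem_nhds hx] with y hy using h y hy
  simp only [pd, this.fderiv_eq]

@[simp] lemma pd_const (i : ι) (c : ℝ) : pd i (fun _ => c) x = 0 := by simp [pd]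

lemma pd_add (i : ι) (hf : DifferentiableAt ℝ f x) (hg : DifferentiableAt ℝ g x) :
    pd i (fun y => f y + g y) x = pd i f x + pd i g x := by
  simp [pd, fderiv_fun_add hf hg]

lemma pd_sub (i : ι) (hf : DifferentiableAt ℝ f x) (hg : DifferentiableAt ℝ g x) :
    pd i (fun y => f y - g y) x = pd i f x - pd i g x := by
  simp [pd, fderiv_fun_sub hf hg]

lemma pd_neg (i : ι) : pd i (fun y => - f y) x = - pd i f x := by
  simp [pd, fderiv_fun_neg]

lemma pd_mul (i : ι) (hf : DifferentiableAt ℝ f x) (hg : DifferentiableAt ℝ g x) :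
    pd i (fun y => f y * g y) x = pd i f x * g x + f x * pd i g x := by
  simp [pd, fderiv_fun_mul hf hg]; ring

lemma pd_const_mul (i : ι) (c : ℝ) (hf : DifferentiableAt ℝ f x) :
    pd i (fun y => c * f y) x = c * pd i f x := by
  rw [pd_mul i (differentiableAt_const c) hf]; simp

lemma pd_inv (i : ι) (hf : DifferentiableAt ℝ f x) (h0 : f x ≠ 0) :
    pd i (fun y => (f y)⁻¹) x = - pd i f x / f x ^ 2 := by
  have h := ((hasDerivAt_inv h0).comp_hasFDerivAt x hf.hasFDerivAt).fderiv
  have h' : (fun y => (f y)⁻¹) = (fun z : ℝ => z⁻¹) ∘ f := rfl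
  simp only [pd, h', h]
  simp; ring

lemma pd_div (i : ι) (hf : DifferentiableAt ℝ f x) (hg : DifferentiableAt ℝ g x) (h0 : g x ≠ 0) :
    pd i (fun y => f y / g y) x = (pd i f x * g x - f x * pd i g x) / g x ^ 2 := by
  simp only [div_eq_mul_inv (f _)]
  rw [pd_mul i hf (hg.fun_inv h0), pd_inv i hg h0]
  field_simp
  ring

lemma pd_sum {κ : Type*} (s : Finset κ) (i : ι) {F : κ → (ι → ℝ) → ℝ}
    (h : ∀ j ∈ s, DifferentiableAt ℝ (F j) x) :
    pd i (fun y => ∑ j ∈ s, F j y) x = ∑ j ∈ s, pd i (F j) x := by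
  simp only [pd]
  rw [fderiv_fun_sum h]
  simp

/-- The partial derivative is the derivative along the coordinate line. -/
lemma hasDerivAt_update (hf : DifferentiableAt ℝ f x) (i : ι) :
    HasDerivAt (fun z => f (Function.update x i z)) (pd i f x) (x i) := by
  have h1 := _root_.hasDerivAt_update x i (x i)
  have h2 : HasFDerivAt f (fderiv ℝ f x) (Function.update x i (x i)) := by
    rw [Function.update_eq_self]; exact hf.hasFDerivAt
  exact h2.comp_hasDerivAt (x i) h1

lemma fderiv_eq_zero_of_pd (h : ∀ i, pd i f x = 0) : fderiv ℝ f x = 0 := by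
  ext v
  have : v = ∑ i, v i • (Pi.single i 1 : ι → ℝ) := by
    ext j
    simp [Finset.sum_apply, Pi.single_apply]
  rw [this, map_sum]
  simp only [pd] at h
  simp [h]

/-- The coordinates of the base point in a chart `ι ⊕ ι`. -/
def base (p : ι ⊕ ι → ℝ) : ι → ℝ := fun s => p (Sum.inl s)

lemma hasFDerivAt_base (p : ι ⊕ ι → ℝ) :
    HasFDerivAt (base : (ι ⊕ ι → ℝ) → ι → ℝ)
      (ContinuousLinearMap.pi fun s => ContinuousLinearMap.proj (R := ℝ)
        (φ := fun _ : ι ⊕ ι => ℝ) (Sum.inl s)) p := by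
  rw [hasFDerivAt_pi']
  intro s
  exact (ContinuousLinearMap.proj (R := ℝ) (φ := fun _ : ι ⊕ ι => ℝ) (Sum.inl s)).hasFDerivAt

lemma pd_inl_base {p : ι ⊕ ι → ℝ} (hf : DifferentiableAt ℝ f (base p)) (s : ι) :
    pd (Sum.inl s) (fun y => f (base y)) p = pd s f (base p) := by
  have h : HasFDerivAt (fun y => f (base y)) _ p :=
    HasFDerivAt.comp p hf.hasFDerivAt (hasFDerivAt_base p)
  simp only [pd, h.fderiv]
  simp only [ContinuousLinearMap.comp_apply]
  congr 1
  ext t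
  simp [Pi.single_apply]

lemma pd_inr_base {p : ι ⊕ ι → ℝ} (hf : DifferentiableAt ℝ f (base p)) (s : ι) :
    pd (Sum.inr s) (fun y => f (base y)) p = 0 := by
  have h : HasFDerivAt (fun y => f (base y)) _ p :=
    HasFDerivAt.comp p hf.hasFDerivAt (hasFDerivAt_base p)
  simp only [pd, h.fderiv]
  simp only [ContinuousLinearMap.comp_apply]
  have : (ContinuousLinearMap.pi fun s => ContinuousLinearMap.proj (R := ℝ)
      (φ := fun _ : ι ⊕ ι => ℝ) (Sum.inl s)) (Pi.single (Sum.inr s) 1) = (0 : ι → ℝ) := by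
    ext t
    simp
  rw [this, map_zero]

lemma continuous_base : Continuous (base : (ι ⊕ ι → ℝ) → ι → ℝ) :=
  continuous_pi fun s => continuous_apply (Sum.inl s)

end PartialDerivatives

lemma differentiableAt_det {E ι : Type*} [NormedAddCommGroup E] [NormedSpace ℝ E] [Fintype ι]
    [DecidableEq ι] {A : E → Matrix ι ι ℝ} {x : E}
    (h : ∀ i j, DifferentiableAt ℝ (fun y => A y i j) x) :
    DifferentiableAt ℝ (fun y => (A y).det) x := by
  simp only [Matrix.det_apply']
  refine DifferentiableAt.fun_sum fun σ _ => (differentiableAt_const _).mul ?_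
  exact (HasFDerivAt.finsetProd fun i _ => (h _ _).hasFDerivAt).differentiableAt

lemma differentiableAt_inv {E ι : Type*} [NormedAddCommGroup E] [NormedSpace ℝ E] [Fintype ι]
    [DecidableEq ι] {A : E → Matrix ι ι ℝ} {x : E}
    (h : ∀ i j, DifferentiableAt ℝ (fun y => A y i j) x) (hdet : (A x).det ≠ 0) (i j : ι) :
    DifferentiableAt ℝ (fun y => (A y)⁻¹ i j) x := by
  simp only [Matrix.inv_def, Matrix.smul_apply, smul_eq_mul, Ring.inverse_eq_inv',
    Matrix.adjugate_apply]
  refine ((differentiableAt_det h).fun_inv hdet).mul (differentiableAt_det fun r c => ?_)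
  by_cases hr : r = j
  · subst hr; simp
  · simpa [Matrix.updateRow_ne hr] using h r c

end ChartGeometry

namespace ChartGeometry

/-! ### Separable Kähler metrics -/

/-- A metric `∑_s (dx_s² / P_s + P_s θ_s²)` with `θ_s = ∑_b θ_{s,b} dt_b`, all coefficients being
functions of `x ∈ V`. The
equations for the derivatives of `θ` express that the 1-forms `P_s θ_s` and `dx_s` are exchanged by
an integrable complex structure, and `pd_a` is a consequence of their compatibility. -/
structure SeparableFrame (ι : Type*) [Fintype ι] [DecidableEq ι] where
  V : Set (ι → ℝ)
  isOpen_V : IsOpen V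
  P : ι → (ι → ℝ) → ℝ
  /-- the components `θ_{s,b}` -/
  θ : ι → ι → (ι → ℝ) → ℝ
  /-- the logarithmic derivatives `a u s = ∂_u log P_s` -/
  a : ι → ι → (ι → ℝ) → ℝ
  /-- the functions `l s` with `∂_s θ_s = -2 l_s θ_s`; for the geometries below,
  `l s = ∂_s log ⟨μ, β⟩` -/
  l : ι → (ι → ℝ) → ℝ
  P_ne : ∀ x ∈ V, ∀ s, P s x ≠ 0
  diff_P : ∀ x ∈ V, ∀ s, DifferentiableAt ℝ (P s) x
  diff_θ : ∀ x ∈ V, ∀ s b, DifferentiableAt ℝ (θ s b) x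
  diff_a : ∀ x ∈ V, ∀ u s, DifferentiableAt ℝ (a u s) x
  diff_l : ∀ x ∈ V, ∀ s, DifferentiableAt ℝ (l s) x
  pd_P : ∀ x ∈ V, ∀ u s, pd u (P s) x = a u s x * P s x
  pd_θ_self : ∀ x ∈ V, ∀ s b, pd s (θ s b) x = -2 * l s x * θ s b x
  pd_θ : ∀ x ∈ V, ∀ u s b, u ≠ s →
    pd u (θ s b) x = -(a u s x) * θ s b x - a s u x * θ u b x
  pd_a : ∀ x ∈ V, ∀ u s, u ≠ s → pd u (a u s) x = a u s x ^ 2 - 2 * l u x * a u s x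
  det_ne : ∀ x ∈ V, (Matrix.of fun s b => θ s b x).det ≠ 0

namespace SeparableFrame

variable {ι : Type*} [Fintype ι] [DecidableEq ι] (F : SeparableFrame ι)

/-- The matrix of the 1-forms `θ_s`. -/
def Θ (x : ι → ℝ) : Matrix ι ι ℝ := Matrix.of fun s b => F.θ s b x

/-- The Gram matrix of the coordinate vector fields `∂/∂t_b`. -/
def H (x : ι → ℝ) : Matrix ι ι ℝ :=
  Matrix.of fun b c => ∑ s, F.P s x * (F.θ s b x * F.θ s c x)

/-- The derivative `∂H/∂x_s`. -/
def dH (s : ι) (x : ι → ℝ) : Matrix ι ι ℝ :=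
  Matrix.of fun b c => F.P s x * (F.a s s x - 4 * F.l s x) * (F.θ s b x * F.θ s c x) -
    ∑ u ∈ Finset.univ.erase s, F.P u x * (F.a s u x * (F.θ u b x * F.θ u c x) +
      F.a u s x * (F.θ s b x * F.θ u c x + F.θ u b x * F.θ s c x))

/-- The endomorphism `H⁻¹ (∂H/∂x_s) / 2`, written in the frame dual to `θ`. -/
def N (s : ι) (x : ι → ℝ) : Matrix ι ι ℝ :=
  Matrix.of fun u v =>
    if u = v then (if u = s then (1 / 2) * (F.a s s x - 4 * F.l s x) else -(1 / 2) * F.a s u x)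
    else if v = s then -(1 / 2) * F.a u s x
    else if u = s then -(1 / 2) * (F.a v s x * F.P v x / F.P s x) else 0

/-- The endomorphism `H⁻¹ (∂H/∂x_s) / 2`; its entries are the Christoffel symbols `Γ^b_{sc}`. -/
def M (s : ι) (x : ι → ℝ) : Matrix ι ι ℝ :=
  (1 / 2 : ℝ) • ((F.H x)⁻¹ * F.dH s x)

/-- Twice the trace of `M s`, the logarithmic derivative of `det H`. -/
def h (s : ι) (x : ι → ℝ) : ℝ :=
  F.a s s x - 4 * F.l s x - ∑ u ∈ Finset.univ.erase s, F.a s u x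

/-- The logarithmic derivative of the volume density. -/
def j (s : ι) (x : ι → ℝ) : ℝ :=
  -(∑ u ∈ Finset.univ.erase s, F.a s u x) - 2 * F.l s x

variable {F} {x : ι → ℝ}

lemma H_eq : F.H x = (F.Θ x).transpose * Matrix.diagonal (fun s => F.P s x) * F.Θ x := by
  ext b c
  rw [Matrix.mul_apply]
  simp only [Matrix.mul_diagonal]
  exact Finset.sum_congr rfl fun s _ => by simp only [Θ, Matrix.transpose_apply, Matrix.of_apply]; ring

lemma isUnit_Θ (hx : x ∈ F.V) : IsUnit (F.Θ x).det := (F.det_ne x hx).isUnit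

lemma det_H_ne (hx : x ∈ F.V) : (F.H x).det ≠ 0 := by
  rw [H_eq, Matrix.det_mul, Matrix.det_mul, Matrix.det_transpose, Matrix.det_diagonal]
  have h1 := F.det_ne x hx
  have h2 : ∏ s, F.P s x ≠ 0 := Finset.prod_ne_zero_iff.2 fun s _ => F.P_ne x hx s
  exact mul_ne_zero (mul_ne_zero h1 h2) h1

lemma diff_H (hx : x ∈ F.V) (b c : ι) : DifferentiableAt ℝ (fun y => F.H y b c) x := by
  simp only [H, Matrix.of_apply]
  have := F.diff_P x hx
  have := F.diff_θ x hx
  fun_prop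

lemma diff_dH (hx : x ∈ F.V) (s b c : ι) : DifferentiableAt ℝ (fun y => F.dH s y b c) x := by
  simp only [dH, Matrix.of_apply]
  have := F.diff_P x hx
  have := F.diff_θ x hx
  have := F.diff_a x hx
  have := F.diff_l x hx
  fun_prop

lemma pd_H (hx : x ∈ F.V) (s b c : ι) : pd s (fun y => F.H y b c) x = F.dH s x b c := by
  simp only [H, dH, Matrix.of_apply]
  have hP := F.diff_P x hx
  have hθ := F.diff_θ x hx
  rw [pd_sum _ _ fun u _ => (hP u).fun_mul ((hθ u b).fun_mul (hθ u c)),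
    ← Finset.add_sum_erase _ _ (Finset.mem_univ s), sub_eq_add_neg, ← Finset.sum_neg_distrib]
  congr 1
  · rw [pd_mul s (hP s) ((hθ s b).fun_mul (hθ s c)), pd_mul s (hθ s b) (hθ s c),
      F.pd_P x hx, F.pd_θ_self x hx, F.pd_θ_self x hx]
    ring
  · refine Finset.sum_congr rfl fun u hu => ?_
    have hu' : s ≠ u := (Finset.ne_of_mem_erase hu).symm
    rw [pd_mul s (hP u) ((hθ u b).fun_mul (hθ u c)), pd_mul s (hθ u b) (hθ u c),
      F.pd_P x hx, F.pd_θ x hx _ _ _ hu', F.pd_θ x hx _ _ _ hu']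
    ring

/-- The derivative of the Gram matrix `H = Θᵀ P Θ`, in the frame `θ`. -/
lemma dH_eq (hx : x ∈ F.V) (s : ι) : F.dH s x =
    (2 : ℝ) • ((F.Θ x).transpose * Matrix.diagonal (fun s => F.P s x) * F.N s x * F.Θ x) := by
  ext b c
  have hrow : ∀ u, (F.N s x * F.Θ x) u c =
      if u = s then (1 / 2) * (F.a s s x - 4 * F.l s x) * F.θ s c x -
        ∑ v ∈ Finset.univ.erase s, (1 / 2) * (F.a v s x * F.P v x / F.P s x) * F.θ v c x
      else -(1 / 2) * F.a s u x * F.θ u c x - (1 / 2) * F.a u s x * F.θ s c x := by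
    intro u
    simp only [Matrix.mul_apply, Θ, Matrix.of_apply]
    rw [← Finset.add_sum_erase _ _ (Finset.mem_univ s)]
    split_ifs with hu
    · subst hu
      simp only [N, Matrix.of_apply, if_true]
      rw [eq_sub_iff_add_eq, add_assoc, ← Finset.sum_add_distrib]
      refine add_eq_left.2 (Finset.sum_eq_zero fun v hv => ?_)
      have hv' := Finset.ne_of_mem_erase hv
      rw [if_neg hv'.symm, if_neg hv']
      ring
    · rw [Finset.sum_eq_single u]
      · simp [N, hu]; ring
      · intro v hv hvu
        have hv' := Finset.ne_of_mem_erase hv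
        simp [N, hvu.symm, hv', hu]
      · intro h
        simp [hu] at h
  rw [Matrix.smul_apply, Matrix.mul_assoc, Matrix.mul_apply, smul_eq_mul, dH, Matrix.of_apply,
    ← Finset.add_sum_erase _ _ (Finset.mem_univ s), hrow s]
  simp only [Matrix.mul_diagonal, Matrix.transpose_apply, Θ, Matrix.of_apply, if_true]
  have hsum : ∑ u ∈ Finset.univ.erase s, F.θ u b x * F.P u x * (F.N s x * F.Θ x) u c =
      ∑ u ∈ Finset.univ.erase s, F.θ u b x * F.P u x *
        (-(1 / 2) * F.a s u x * F.θ u c x - (1 / 2) * F.a u s x * F.θ s c x) := by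
    refine Finset.sum_congr rfl fun u hu => ?_
    rw [hrow, if_neg (Finset.ne_of_mem_erase hu)]
  change _ = 2 * (_ + ∑ u ∈ Finset.univ.erase s, F.θ u b x * F.P u x * (F.N s x * F.Θ x) u c)
  have hP := F.P_ne x hx s
  have key : ∑ u ∈ Finset.univ.erase s, F.P u x * (F.a s u x * (F.θ u b x * F.θ u c x) +
      F.a u s x * (F.θ s b x * F.θ u c x + F.θ u b x * F.θ s c x)) =
      2 * (F.θ s b x * F.P s x * ∑ v ∈ Finset.univ.erase s,
        (1 / 2) * (F.a v s x * F.P v x / F.P s x) * F.θ v c x) -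
      2 * ∑ u ∈ Finset.univ.erase s, F.θ u b x * F.P u x *
        (-(1 / 2) * F.a s u x * F.θ u c x - (1 / 2) * F.a u s x * F.θ s c x) := by
    simp only [Finset.mul_sum]
    rw [← Finset.sum_sub_distrib]
    refine Finset.sum_congr rfl fun u _ => ?_
    field_simp
    ring
  rw [hsum, key]
  ring

lemma M_eq (hx : x ∈ F.V) (s : ι) : F.M s x = (F.Θ x)⁻¹ * F.N s x * F.Θ x := by
  have h1 := isUnit_Θ hx
  have h2 : IsUnit (Matrix.diagonal fun s => F.P s x).det := by
    rw [Matrix.det_diagonal, isUnit_iff_ne_zero]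
    exact Finset.prod_ne_zero_iff.2 fun s _ => F.P_ne x hx s
  have h3 : IsUnit (F.Θ x).transpose.det := by rwa [Matrix.det_transpose]
  rw [M, dH_eq hx, H_eq, Matrix.mul_inv_rev, Matrix.mul_inv_rev, Matrix.mul_smul, smul_smul]
  norm_num
  simp only [Matrix.mul_assoc]
  rw [Matrix.nonsing_inv_mul_cancel_left _ _ h3, Matrix.nonsing_inv_mul_cancel_left _ _ h2]

lemma trace_M (hx : x ∈ F.V) (s : ι) : (F.M s x).trace = (1 / 2) * F.h s x := by
  rw [M_eq hx, Matrix.trace_mul_comm, Matrix.mul_nonsing_inv_cancel_left _ _ (isUnit_Θ hx),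
    Matrix.trace, ← Finset.add_sum_erase _ _ (Finset.mem_univ s), h, mul_sub, sub_eq_add_neg,
    Finset.mul_sum, ← Finset.sum_neg_distrib]
  congr 1
  · simp [N]
  · refine Finset.sum_congr rfl fun u hu => ?_
    simp [N, Finset.ne_of_mem_erase hu]

/-- The trace of the square of `M s`, a term of the Ricci tensor. -/
lemma trace_M_sq (hx : x ∈ F.V) (s : ι) : ∑ b, ∑ c, F.M s x b c * F.M s x c b =
    (1 / 4) * (F.a s s x - 4 * F.l s x) ^ 2 + ∑ u ∈ Finset.univ.erase s,
      ((1 / 2) * F.a u s x ^ 2 * F.P u x / F.P s x + (1 / 4) * F.a s u x ^ 2) := by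
  have h1 : ∑ b, ∑ c, F.M s x b c * F.M s x c b = (F.N s x * F.N s x).trace := by
    have : ∑ b, ∑ c, F.M s x b c * F.M s x c b = (F.M s x * F.M s x).trace := by
      simp [Matrix.trace, Matrix.mul_apply]
    rw [this, M_eq hx]
    have h2 := isUnit_Θ hx
    have : (F.Θ x)⁻¹ * F.N s x * F.Θ x * ((F.Θ x)⁻¹ * F.N s x * F.Θ x) =
        (F.Θ x)⁻¹ * (F.N s x * F.N s x * F.Θ x) := by
      simp only [Matrix.mul_assoc]
      rw [Matrix.mul_nonsing_inv_cancel_left _ _ h2]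
    rw [this, Matrix.trace_mul_comm, Matrix.mul_assoc _ (F.Θ x), Matrix.mul_nonsing_inv _ h2,
      Matrix.mul_one]
  have hdiag : ∀ u ∈ Finset.univ.erase s, (F.N s x * F.N s x) u u =
      (1 / 4) * F.a u s x ^ 2 * F.P u x / F.P s x + (1 / 4) * F.a s u x ^ 2 := by
    intro u hu
    have hu' := Finset.ne_of_mem_erase hu
    rw [Matrix.mul_apply, ← Finset.add_sum_erase _ _ (Finset.mem_univ s), Finset.sum_eq_single u]
    · simp [N, hu', hu'.symm]; ring
    · intro v hv hvu
      have hv' := Finset.ne_of_mem_erase hv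
      simp [N, hvu.symm, hv', hu']
    · intro h
      exact absurd hu h
  have hs : (F.N s x * F.N s x) s s = (1 / 4) * (F.a s s x - 4 * F.l s x) ^ 2 +
      ∑ u ∈ Finset.univ.erase s, (1 / 4) * F.a u s x ^ 2 * F.P u x / F.P s x := by
    rw [Matrix.mul_apply, ← Finset.add_sum_erase _ _ (Finset.mem_univ s)]
    congr 1
    · simp [N]; ring
    · refine Finset.sum_congr rfl fun u hu => ?_
      have hu' := Finset.ne_of_mem_erase hu
      simp [N, hu', hu'.symm]; ring
  rw [h1, Matrix.trace, ← Finset.add_sum_erase _ _ (Finset.mem_univ s), Matrix.diag_apply, hs,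
    add_assoc, ← Finset.sum_add_distrib]
  congr 1
  refine Finset.sum_congr rfl fun u hu => ?_
  rw [Matrix.diag_apply, hdiag u hu]
  ring

lemma diff_M (hx : x ∈ F.V) (s b c : ι) : DifferentiableAt ℝ (fun y => F.M s y b c) x := by
  simp only [M, Matrix.smul_apply, Matrix.mul_apply, smul_eq_mul]
  refine (differentiableAt_const _).mul (DifferentiableAt.fun_sum fun e _ => ?_)
  exact (differentiableAt_inv (diff_H hx) (det_H_ne hx) b e).mul (diff_dH hx s e c)

lemma H_mul_M (hx : x ∈ F.V) (s : ι) : F.dH s x = (2 : ℝ) • (F.H x * F.M s x) := by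
  rw [M, Matrix.mul_smul, Matrix.mul_nonsing_inv_cancel_left _ _ (det_H_ne hx).isUnit, smul_smul]
  norm_num

end SeparableFrame

end ChartGeometry

namespace ChartGeometry

namespace SeparableFrame

/-! ### Christoffel symbols and Ricci tensor of a separable Kähler metric -/

variable {ι : Type*} [Fintype ι] [DecidableEq ι] (F : SeparableFrame ι)

/-- The metric of the frame in the coordinates `(x, t)`. -/
def metric (p : ι ⊕ ι → ℝ) : Matrix (ι ⊕ ι) (ι ⊕ ι) ℝ :=
  Matrix.fromBlocks (Matrix.diagonal fun s => (F.P s (base p))⁻¹) 0 0 (F.H (base p))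

/-- The Christoffel symbols with three indices in the base. -/
def chrBase (u s v : ι) (x : ι → ℝ) : ℝ :=
  if s = v then
    (if u = s then -(1 / 2) * F.a s s x else (1 / 2) * (F.P u x * F.a u s x / F.P s x))
  else if u = s then -(1 / 2) * F.a v s x else if u = v then -(1 / 2) * F.a s u x else 0

/-- The Christoffel symbols as functions on the base. -/
def chr : ι ⊕ ι → ι ⊕ ι → ι ⊕ ι → (ι → ℝ) → ℝ
  | .inl u, .inl s, .inl v => F.chrBase u s v
  | .inl u, .inr b, .inr c => fun x => -(1 / 2) * (F.P u x * F.dH u x b c)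
  | .inr b, .inl s, .inr c => fun x => F.M s x b c
  | .inr b, .inr c, .inl s => fun x => F.M s x b c
  | _, _, _ => fun _ => 0

variable {F} {x : ι → ℝ} {p : ι ⊕ ι → ℝ}

lemma isOpen_domain : IsOpen {p : ι ⊕ ι → ℝ | base p ∈ F.V} :=
  F.isOpen_V.preimage continuous_base

lemma metric_inv (hp : base p ∈ F.V) : (F.metric p)⁻¹ =
    Matrix.fromBlocks (Matrix.diagonal fun s => F.P s (base p)) 0 0 (F.H (base p))⁻¹ := by
  refine Matrix.inv_eq_left_inv ?_
  rw [metric, Matrix.fromBlocks_multiply]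
  simp only [Matrix.mul_zero, Matrix.zero_mul, add_zero, zero_add, Matrix.diagonal_mul_diagonal]
  rw [Matrix.nonsing_inv_mul _ (det_H_ne hp).isUnit]
  have : (fun s => F.P s (base p) * (F.P s (base p))⁻¹) = fun _ => 1 := by
    funext s
    exact mul_inv_cancel₀ (F.P_ne _ hp s)
  rw [this, Matrix.diagonal_one, Matrix.fromBlocks_one]

lemma dH_symm (s : ι) (x : ι → ℝ) (b c : ι) : F.dH s x b c = F.dH s x c b := by
  simp only [dH, Matrix.of_apply]
  congr 1
  · ring
  · exact Finset.sum_congr rfl fun u _ => by ring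

lemma pd_metric_base (hp : base p ∈ F.V) (s u v : ι) :
    pd (.inl s) (fun y => F.metric y (.inl u) (.inl v)) p =
      if u = v then -(F.a s u (base p)) / F.P u (base p) else 0 := by
  split_ifs with h
  · subst h
    have := F.P_ne _ hp u
    have hd := F.diff_P _ hp u
    simp only [metric, Matrix.fromBlocks_apply₁₁, Matrix.diagonal_apply_eq]
    rw [pd_inl_base (f := fun x => (F.P u x)⁻¹) (hd.fun_inv this), pd_inv _ hd this,
      F.pd_P _ hp]
    field_simp
  · simp [metric, h]

lemma pd_metric_base_inr (hp : base p ∈ F.V) (s u v : ι) :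
    pd (.inr s) (fun y => F.metric y (.inl u) (.inl v)) p = 0 := by
  by_cases h : u = v
  · subst h
    simp only [metric, Matrix.fromBlocks_apply₁₁, Matrix.diagonal_apply_eq]
    exact pd_inr_base (f := fun x => (F.P u x)⁻¹) ((F.diff_P _ hp u).fun_inv (F.P_ne _ hp u)) s
  · simp [metric, h]

lemma pd_metric_fibre (hp : base p ∈ F.V) (s b c : ι) :
    pd (.inl s) (fun y => F.metric y (.inr b) (.inr c)) p = F.dH s (base p) b c := by
  simp only [metric, Matrix.fromBlocks_apply₂₂]
  rw [pd_inl_base (f := fun x => F.H x b c) (diff_H hp b c), pd_H hp]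

lemma pd_metric_fibre_inr (hp : base p ∈ F.V) (s b c : ι) :
    pd (.inr s) (fun y => F.metric y (.inr b) (.inr c)) p = 0 := by
  simp only [metric, Matrix.fromBlocks_apply₂₂]
  exact pd_inr_base (f := fun x => F.H x b c) (diff_H hp b c) s

lemma christoffel_eq (hp : base p ∈ F.V) (i j k : ι ⊕ ι) :
    christoffel F.metric i j k p = F.chr i j k (base p) := by
  have h12 : ∀ (i : ι ⊕ ι) (u b : ι), pd i (fun y => F.metric y (.inl u) (.inr b)) p = 0 := by
    intro i u b; simp [metric]
  have h21 : ∀ (i : ι ⊕ ι) (u b : ι), pd i (fun y => F.metric y (.inr b) (.inl u)) p = 0 := by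
    intro i u b; simp [metric]
  have hM : ∀ s b c, F.M s (base p) b c =
      (1 / 2) * ∑ e, (F.H (base p))⁻¹ b e * F.dH s (base p) c e := by
    intro s b c
    simp only [M, Matrix.smul_apply, Matrix.mul_apply, smul_eq_mul]
    congr 1
    exact Finset.sum_congr rfl fun e _ => by rw [dH_symm]
  rw [christoffel, metric_inv hp, Fintype.sum_sum_type]
  have hP := F.P_ne _ hp
  rcases i with u | b <;> rcases j with s | c <;> rcases k with v | e <;>
    simp only [Matrix.fromBlocks_apply₁₁, Matrix.fromBlocks_apply₁₂, Matrix.fromBlocks_apply₂₁,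
      Matrix.fromBlocks_apply₂₂, Matrix.zero_apply, zero_mul, Finset.sum_const_zero, add_zero,
      zero_add, sub_zero, mul_zero, h12, h21, pd_metric_base hp, pd_metric_base_inr hp,
      pd_metric_fibre hp, pd_metric_fibre_inr hp, chr, hM]
  · rw [Finset.sum_eq_single u (fun w _ hw => by simp [hw.symm]) (by simp)]
    simp only [Matrix.diagonal_apply_eq, chrBase]
    have hu := hP u
    by_cases h1 : s = v
    · subst h1
      have hs := hP s
      by_cases h2 : u = s
      · subst h2; simp; field_simp
      · simp [h2, Ne.symm h2]; field_simp
    · by_cases h2 : u = s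
      · subst h2
        simp [h1, Ne.symm h1]; field_simp
      · by_cases h3 : u = v
        · subst h3
          simp [h1, h2]; field_simp
        · simp [h1, h2, h3, Ne.symm h2, Ne.symm h3]
  · rw [Finset.sum_eq_single u (fun w _ hw => by simp [hw.symm]) (by simp)]
    simp only [Matrix.diagonal_apply_eq]
    ring

lemma diff_chrBase (hx : x ∈ F.V) (u s v : ι) : DifferentiableAt ℝ (F.chrBase u s v) x := by
  have h1 := F.diff_P x hx
  have h2 := F.diff_a x hx
  have h3 := F.P_ne x hx
  unfold chrBase
  split_ifs
  · fun_prop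
  · simp only [div_eq_mul_inv]
    exact (differentiableAt_const _).mul (((h1 u).fun_mul (h2 u s)).mul ((h1 s).fun_inv (h3 s)))
  · fun_prop
  · fun_prop
  · fun_prop

lemma diff_chr (hx : x ∈ F.V) (i j k : ι ⊕ ι) : DifferentiableAt ℝ (F.chr i j k) x := by
  have h1 := F.diff_P x hx
  rcases i with u | b <;> rcases j with s | c <;> rcases k with v | e <;>
    simp only [chr] <;>
    first
    | exact diff_chrBase hx _ _ _
    | exact diff_M hx _ _ _
    | exact differentiableAt_const _
    | exact (differentiableAt_const _).mul ((h1 _).mul (diff_dH hx _ _ _))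

lemma pd_christoffel_inl (hp : base p ∈ F.V) (s : ι) (i j k : ι ⊕ ι) :
    pd (.inl s) (christoffel F.metric i j k) p = pd s (F.chr i j k) (base p) := by
  rw [pd_congr isOpen_domain (g := fun y => F.chr i j k (base y))
    (fun y hy => christoffel_eq hy i j k) hp, pd_inl_base (diff_chr hp i j k)]

lemma pd_christoffel_inr (hp : base p ∈ F.V) (s : ι) (i j k : ι ⊕ ι) :
    pd (.inr s) (christoffel F.metric i j k) p = 0 := by
  rw [pd_congr isOpen_domain (g := fun y => F.chr i j k (base y))
    (fun y hy => christoffel_eq hy i j k) hp, pd_inr_base (diff_chr hp i j k)]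

/-- The contracted Christoffel symbols `Γ^i_{is}` are the logarithmic derivatives of the volume
density. -/
lemma sum_chr_trace (hx : x ∈ F.V) (s : ι) :
    ∑ u, F.chrBase u u s x + ∑ b, F.M s x b b = F.j s x := by
  have h1 : ∑ b, F.M s x b b = (1 / 2) * F.h s x := trace_M hx s
  rw [h1, ← Finset.add_sum_erase _ _ (Finset.mem_univ s)]
  have h2 : ∑ u ∈ Finset.univ.erase s, F.chrBase u u s x =
      -(1 / 2) * ∑ u ∈ Finset.univ.erase s, F.a s u x := by
    rw [Finset.mul_sum]
    refine Finset.sum_congr rfl fun u hu => ?_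
    simp [chrBase, Finset.ne_of_mem_erase hu]
  rw [h2, h, j]
  simp [chrBase]
  ring

lemma H_transpose : (F.H x).transpose = F.H x := by
  ext b c
  simp only [H, Matrix.transpose_apply, Matrix.of_apply]
  exact Finset.sum_congr rfl fun u _ => by ring

/-- Contraction of the fibre part of the Ricci tensor. -/
lemma contract_fibre (hx : x ∈ F.V) (X : Matrix ι ι ℝ) :
    ∑ b, ∑ c, (F.H x)⁻¹ b c * (F.H x * X) b c = X.trace := by
  have hs : ((F.H x)⁻¹).transpose = (F.H x)⁻¹ := by
    rw [Matrix.transpose_nonsing_inv, H_transpose]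
  have h1 : ∑ b, ∑ c, (F.H x)⁻¹ b c * (F.H x * X) b c =
      (((F.H x)⁻¹).transpose * (F.H x * X)).trace := by
    simp only [Matrix.trace, Matrix.diag_apply, Matrix.mul_apply (M := ((F.H x)⁻¹).transpose),
      Matrix.transpose_apply]
    exact Finset.sum_comm
  rw [h1, hs, Matrix.nonsing_inv_mul_cancel_left _ _ (det_H_ne hx).isUnit]

/-- The Ricci tensor in the directions of the fibre coordinates `t`, on which nothing depends. -/
lemma ricci_fibre (hp : base p ∈ F.V) (b c : ι) :
    ricci F.metric (.inr b) (.inr c) p =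
      ∑ s, (pd s (fun x => -(1 / 2) * (F.P s x * F.dH s x b c)) (base p) +
        F.j s (base p) * (-(1 / 2) * (F.P s (base p) * F.dH s (base p) b c)) -
        ∑ e, (-(1 / 2) * (F.P s (base p) * F.dH s (base p) b e) * F.M s (base p) e c +
          F.M s (base p) e b * (-(1 / 2) * (F.P s (base p) * F.dH s (base p) e c)))) := by
  rw [ricci]
  simp only [Fintype.sum_sum_type, pd_christoffel_inl hp, pd_christoffel_inr hp,
    christoffel_eq hp]
  simp only [chr, mul_zero, sub_zero, Finset.sum_const_zero, add_zero]
  have e1 : ∑ u, ((∑ s, F.chrBase u u s (base p) *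
        (-(1 / 2) * (F.P s (base p) * F.dH s (base p) b c))) +
      ∑ e, (0 - -(1 / 2) * (F.P u (base p) * F.dH u (base p) b e) * F.M u (base p) e c)) +
      ∑ e, ∑ s, (F.M s (base p) e e * (-(1 / 2) * (F.P s (base p) * F.dH s (base p) b c)) -
        F.M s (base p) e b * (-(1 / 2) * (F.P s (base p) * F.dH s (base p) e c))) =
      ∑ s, (F.j s (base p) * (-(1 / 2) * (F.P s (base p) * F.dH s (base p) b c)) -
        ∑ e, (-(1 / 2) * (F.P s (base p) * F.dH s (base p) b e) * F.M s (base p) e c +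
          F.M s (base p) e b * (-(1 / 2) * (F.P s (base p) * F.dH s (base p) e c)))) := by
    rw [Finset.sum_add_distrib, Finset.sum_comm,
      Finset.sum_comm (f := fun e s => F.M s (base p) e e * _ - _), ← Finset.sum_add_distrib,
      ← Finset.sum_add_distrib]
    refine Finset.sum_congr rfl fun s _ => ?_
    rw [← sum_chr_trace hp s, add_mul, Finset.sum_mul, Finset.sum_mul, Finset.sum_add_distrib,
      Finset.sum_sub_distrib, Finset.sum_sub_distrib]
    simp
    ring
  rw [e1, ← Finset.sum_add_distrib]
  exact Finset.sum_congr rfl fun s _ => by ring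

lemma diff_h (hx : x ∈ F.V) (s : ι) : DifferentiableAt ℝ (F.h s) x := by
  have := F.diff_a x hx
  have := F.diff_l x hx
  unfold h
  fun_prop

/-- The trace of the fibre part of the Ricci tensor. Since `∂_s H = 2 H M_s`, the terms quadratic in
`M_s` cancel. -/
lemma trace_ricci_fibre (hp : base p ∈ F.V) :
    ∑ b, ∑ c, (F.H (base p))⁻¹ b c * ricci F.metric (.inr b) (.inr c) p =
      ∑ s, -(1 / 2) * F.P s (base p) * (pd s (F.h s) (base p) +
        (F.a s s (base p) + F.j s (base p)) * F.h s (base p)) := by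
  set x := base p with hx
  let M' : ι → Matrix ι ι ℝ := fun s => Matrix.of fun b c => pd s (fun y => F.M s y b c) x
  have hHM : ∀ y ∈ F.V, ∀ s b c, F.dH s y b c = 2 * ∑ e, F.H y b e * F.M s y e c := by
    intro y hy s b c
    rw [H_mul_M hy, Matrix.smul_apply, Matrix.mul_apply, smul_eq_mul]
  have hder : ∀ s b c, pd s (fun y => -(1 / 2) * (F.P s y * F.dH s y b c)) x =
      -(F.a s s x * F.P s x * (F.H x * F.M s x) b c + F.P s x *
        (2 * (F.H x * (F.M s x * F.M s x)) b c + (F.H x * M' s) b c)) := by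
    intro s b c
    have hdS : ∀ e, DifferentiableAt ℝ (fun y => F.H y b e * F.M s y e c) x :=
      fun e => (diff_H hp b e).fun_mul (diff_M hp s e c)
    rw [pd_congr F.isOpen_V (g := fun y => -(F.P s y * ∑ e, F.H y b e * F.M s y e c))
      (fun y hy => by rw [hHM y hy]; ring) hp, pd_neg,
      pd_mul s (F.diff_P x hp s) (DifferentiableAt.fun_sum fun e _ => hdS e),
      pd_sum _ _ fun e _ => hdS e, F.pd_P x hp, ← Matrix.mul_apply]
    have : ∑ e, pd s (fun y => F.H y b e * F.M s y e c) x =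
        2 * (F.H x * (F.M s x * F.M s x)) b c + (F.H x * M' s) b c := by
      rw [← Matrix.mul_assoc, Matrix.mul_apply, Matrix.mul_apply, Finset.mul_sum,
        ← Finset.sum_add_distrib]
      refine Finset.sum_congr rfl fun e _ => ?_
      rw [pd_mul s (diff_H hp b e) (diff_M hp s e c), pd_H hp, hHM x hp, ← Matrix.mul_apply]
      simp only [M', Matrix.of_apply]
      ring
    rw [this]
  have hsymm : ∀ s b c, (F.H x * F.M s x) b c = (F.H x * F.M s x) c b := by
    intro s b c
    have h1 := hHM x hp s b c
    have h2 := hHM x hp s c b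
    rw [dH_symm, h2, ← Matrix.mul_apply, ← Matrix.mul_apply] at h1
    linarith
  have hric : ∀ b c, ricci F.metric (.inr b) (.inr c) p = ∑ s, (F.H x *
      (-((F.a s s x + F.j s x) * F.P s x) • F.M s x - F.P s x • M' s)) b c := by
    intro b c
    rw [ricci_fibre hp]
    refine Finset.sum_congr rfl fun s _ => ?_
    rw [hder, hHM x hp, ← Matrix.mul_apply]
    have e1 : ∑ e, (-(1 / 2) * (F.P s x * F.dH s x b e) * F.M s x e c +
        F.M s x e b * (-(1 / 2) * (F.P s x * F.dH s x e c))) =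
        -2 * F.P s x * (F.H x * (F.M s x * F.M s x)) b c := by
      have e2 : (F.H x * (F.M s x * F.M s x)) b c = (F.H x * (F.M s x * F.M s x)) c b := by
        have h1 : (F.M s x).transpose * F.H x = F.H x * F.M s x := by
          rw [← H_transpose, ← Matrix.transpose_mul, H_transpose]
          exact Matrix.ext fun b c => hsymm s c b
        have h2 : (F.H x * (F.M s x * F.M s x)).transpose = F.H x * (F.M s x * F.M s x) := by
          rw [Matrix.transpose_mul, Matrix.transpose_mul, H_transpose, Matrix.mul_assoc, h1,
            ← Matrix.mul_assoc, h1, Matrix.mul_assoc]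
        exact congrFun (congrFun h2 c) b
      have e3 : ∑ e, -(1 / 2) * (F.P s x * F.dH s x b e) * F.M s x e c =
          - F.P s x * (F.H x * (F.M s x * F.M s x)) b c := by
        rw [← Matrix.mul_assoc, Matrix.mul_apply, Finset.mul_sum]
        refine Finset.sum_congr rfl fun e _ => ?_
        rw [hHM x hp, ← Matrix.mul_apply]; ring
      have e4 : ∑ e, F.M s x e b * (-(1 / 2) * (F.P s x * F.dH s x e c)) =
          - F.P s x * (F.H x * (F.M s x * F.M s x)) b c := by
        rw [e2, ← Matrix.mul_assoc, Matrix.mul_apply, Finset.mul_sum]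
        refine Finset.sum_congr rfl fun e _ => ?_
        rw [hHM x hp, ← Matrix.mul_apply, hsymm s e c]; ring
      rw [Finset.sum_add_distrib, e3, e4]; ring
    rw [e1, Matrix.mul_sub, Matrix.mul_smul, Matrix.mul_smul, Matrix.sub_apply, Matrix.smul_apply,
      Matrix.smul_apply]
    simp only [smul_eq_mul]
    ring
  have htr : ∀ s, (M' s).trace = (1 / 2) * pd s (F.h s) x := by
    intro s
    rw [← pd_const_mul _ _ (diff_h hp s), ← pd_congr F.isOpen_V (fun y hy => trace_M hy s) hp s]
    exact (pd_sum _ _ fun b _ => diff_M hp s b b).symm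
  simp only [hric, Finset.mul_sum]
  have hswap : ∀ b, ∑ c, ∑ s, (F.H x)⁻¹ b c * (F.H x *
      (-((F.a s s x + F.j s x) * F.P s x) • F.M s x - F.P s x • M' s)) b c =
      ∑ s, ∑ c, (F.H x)⁻¹ b c * (F.H x *
      (-((F.a s s x + F.j s x) * F.P s x) • F.M s x - F.P s x • M' s)) b c :=
    fun b => Finset.sum_comm
  simp only [hswap]
  rw [Finset.sum_comm]
  refine Finset.sum_congr rfl fun s _ => ?_
  rw [contract_fibre hp, Matrix.trace_sub, Matrix.trace_smul, Matrix.trace_smul, trace_M hp, htr]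
  simp only [smul_eq_mul]
  ring

/-- The diagonal entries of the base part of the Ricci tensor. -/
lemma ricci_base (hp : base p ∈ F.V) (s : ι) :
    ricci F.metric (.inl s) (.inl s) p =
      ∑ u, pd u (F.chrBase u s s) (base p) - pd s (F.j s) (base p) +
        ∑ u, F.j u (base p) * F.chrBase u s s (base p) -
        ∑ u, ∑ v, F.chrBase u s v (base p) * F.chrBase v u s (base p) -
        ∑ b, ∑ c, F.M s (base p) b c * F.M s (base p) c b := by
  have hj : pd s (F.j s) (base p) = ∑ u, pd s (F.chrBase u u s) (base p) +
      ∑ b, pd s (fun y => F.M s y b b) (base p) := by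
    rw [← pd_sum _ _ fun u _ => diff_chrBase hp u u s, ← pd_sum _ _ fun b _ => diff_M hp s b b,
      ← pd_add _ (DifferentiableAt.fun_sum fun u _ => diff_chrBase hp u u s)
        (DifferentiableAt.fun_sum fun b _ => diff_M hp s b b)]
    exact (pd_congr F.isOpen_V (fun y hy => sum_chr_trace hy s) hp s).symm
  rw [ricci, hj]
  simp only [Fintype.sum_sum_type, pd_christoffel_inl hp, pd_christoffel_inr hp,
    christoffel_eq hp]
  simp only [chr, mul_zero, sub_zero, zero_sub, Finset.sum_const_zero, add_zero]
  have e1 : ∑ u, F.j u (base p) * F.chrBase u s s (base p) =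
      ∑ v, ∑ u, F.chrBase u u v (base p) * F.chrBase v s s (base p) +
      ∑ v, ∑ b, F.M v (base p) b b * F.chrBase v s s (base p) := by
    rw [← Finset.sum_add_distrib]
    refine Finset.sum_congr rfl fun v _ => ?_
    rw [← sum_chr_trace hp, add_mul, Finset.sum_mul, Finset.sum_mul]
  rw [e1]
  simp only [Finset.sum_add_distrib, Finset.sum_sub_distrib, Finset.sum_neg_distrib]
  rw [Finset.sum_comm (f := fun v u => F.chrBase u u v (base p) * F.chrBase v s s (base p)),
    Finset.sum_comm (f := fun v b => F.M v (base p) b b * F.chrBase v s s (base p))]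
  ring

lemma sum_sum_erase_comm (f : ι → ι → ℝ) :
    ∑ s, ∑ u ∈ Finset.univ.erase s, f s u = ∑ s, ∑ u ∈ Finset.univ.erase s, f u s := by
  refine Finset.sum_comm' fun s u => ?_
  simp [eq_comm]

/-- The base part of the Ricci tensor, up to terms which cancel after exchanging the indices in the
double sum over `s` and `u`. -/
lemma P_mul_ricci_base (hp : base p ∈ F.V) (s : ι) :
    F.P s (base p) * ricci F.metric (.inl s) (.inl s) p =
      -(1 / 2) * F.P s (base p) * (pd s (F.h s) (base p) +
        (F.a s s (base p) + F.j s (base p)) * F.h s (base p)) +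
      ∑ u ∈ Finset.univ.erase s,
        ((1 / 2) * F.P u (base p) * F.a u s (base p) *
          (F.a u u (base p) - 2 * F.l u (base p) + F.j u (base p)) -
        (1 / 2) * F.P s (base p) * F.a s u (base p) *
          (F.a s s (base p) - 2 * F.l s (base p) + F.j s (base p))) := by
  rw [ricci_base hp, trace_M_sq hp]
  set x := base p with hx
  have hP := F.P_ne x hp
  have dP := F.diff_P x hp
  have da := F.diff_a x hp
  have dl := F.diff_l x hp
  set α := ∑ u ∈ Finset.univ.erase s, F.a s u x with hα
  set A2 := ∑ u ∈ Finset.univ.erase s, F.a s u x ^ 2 with hA2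
  have e0 : pd s (fun y => ∑ u ∈ Finset.univ.erase s, F.a s u y) x = A2 - 2 * F.l s x * α := by
    rw [pd_sum _ _ fun u _ => da s u, hA2, hα, Finset.mul_sum, ← Finset.sum_sub_distrib]
    exact Finset.sum_congr rfl fun u hu => F.pd_a x hp s u (Finset.ne_of_mem_erase hu).symm
  have dα : DifferentiableAt ℝ (fun y => ∑ u ∈ Finset.univ.erase s, F.a s u y) x := by fun_prop
  have eh : pd s (F.h s) x = pd s (F.a s s) x - 4 * pd s (F.l s) x - (A2 - 2 * F.l s x * α) := by
    rw [← e0, ← pd_const_mul s 4 (dl s), ← pd_sub s (da s s) (by fun_prop), ← pd_sub s (by fun_prop) dα]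
    rfl
  have ej : pd s (F.j s) x = -(A2 - 2 * F.l s x * α) - 2 * pd s (F.l s) x := by
    rw [← e0, ← pd_const_mul s 2 (dl s), ← pd_neg, ← pd_sub s (by fun_prop) (by fun_prop)]
    rfl
  have e1 : ∑ u, pd u (F.chrBase u s s) x = -(1 / 2) * pd s (F.a s s) x +
      ∑ u ∈ Finset.univ.erase s,
        (1 / 2) * (F.P u x * F.a u s x * (F.a u u x - 2 * F.l u x) / F.P s x) := by
    rw [← Finset.add_sum_erase _ _ (Finset.mem_univ s)]
    congr 1
    · rw [← pd_const_mul _ _ (da s s)]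
      congr 1
      funext y
      simp [chrBase]
    · refine Finset.sum_congr rfl fun u hu => ?_
      have hu' := Finset.ne_of_mem_erase hu
      have : F.chrBase u s s = fun y => (1 / 2) * (F.P u y * F.a u s y / F.P s y) := by
        funext y
        simp [chrBase, hu']
      rw [this, pd_const_mul, pd_div u ((dP u).fun_mul (da u s)) (dP s) (hP s),
        pd_mul u (dP u) (da u s), F.pd_P x hp, F.pd_P x hp, F.pd_a x hp u s hu']
      · have := hP s
        field_simp
        ring
      · simp only [div_eq_mul_inv]
        exact ((dP u).fun_mul (da u s)).mul ((dP s).fun_inv (hP s))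
  have e2 : ∑ u, F.j u x * F.chrBase u s s x = -(1 / 2) * F.j s x * F.a s s x +
      ∑ u ∈ Finset.univ.erase s, (1 / 2) * (F.j u x * F.P u x * F.a u s x / F.P s x) := by
    rw [← Finset.add_sum_erase _ _ (Finset.mem_univ s)]
    congr 1
    · simp [chrBase]; ring
    · refine Finset.sum_congr rfl fun u hu => ?_
      simp [chrBase, Finset.ne_of_mem_erase hu]
      ring
  have e3 : ∑ u, ∑ v, F.chrBase u s v x * F.chrBase v u s x = (1 / 4) * F.a s s x ^ 2 +
      (1 / 4) * A2 - ∑ u ∈ Finset.univ.erase s, (1 / 2) * (F.P u x * F.a u s x ^ 2 / F.P s x) := by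
    have hs : ∑ v, F.chrBase s s v x * F.chrBase v s s x = (1 / 4) * F.a s s x ^ 2 -
        ∑ u ∈ Finset.univ.erase s, (1 / 4) * (F.P u x * F.a u s x ^ 2 / F.P s x) := by
      rw [← Finset.add_sum_erase _ _ (Finset.mem_univ s), sub_eq_add_neg,
        ← Finset.sum_neg_distrib]
      congr 1
      · simp [chrBase]; ring
      · refine Finset.sum_congr rfl fun v hv => ?_
        have hv' := Finset.ne_of_mem_erase hv
        simp [chrBase, hv', hv'.symm]
        ring
    have hu : ∀ u ∈ Finset.univ.erase s, ∑ v, F.chrBase u s v x * F.chrBase v u s x =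
        (1 / 4) * F.a s u x ^ 2 - (1 / 4) * (F.P u x * F.a u s x ^ 2 / F.P s x) := by
      intro u hu
      have hu' := Finset.ne_of_mem_erase hu
      rw [← Finset.add_sum_erase _ _ (Finset.mem_univ s), Finset.sum_eq_single u]
      · simp [chrBase, hu', hu'.symm]; ring
      · intro v hv hvu
        have hv' := Finset.ne_of_mem_erase hv
        simp [chrBase, hu', hv'.symm, hvu.symm]
      · intro h; exact absurd hu h
    rw [← Finset.add_sum_erase _ _ (Finset.mem_univ s), hs, Finset.sum_congr rfl hu,
      Finset.sum_sub_distrib, hA2, Finset.mul_sum]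
    have : ∀ u, (1 / 2 : ℝ) * (F.P u x * F.a u s x ^ 2 / F.P s x) =
        2 * ((1 / 4) * (F.P u x * F.a u s x ^ 2 / F.P s x)) := fun u => by ring
    simp only [this, ← Finset.mul_sum]
    ring
  have e4 : ∑ u ∈ Finset.univ.erase s,
      ((1 / 2) * F.a u s x ^ 2 * F.P u x / F.P s x + (1 / 4) * F.a s u x ^ 2) =
      ∑ u ∈ Finset.univ.erase s, (1 / 2) * (F.P u x * F.a u s x ^ 2 / F.P s x) +
        (1 / 4) * A2 := by
    rw [Finset.sum_add_distrib, hA2, Finset.mul_sum]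
    congr 1
    exact Finset.sum_congr rfl fun u _ => by ring
  have e5 : ∑ u ∈ Finset.univ.erase s,
        ((1 / 2) * F.P u x * F.a u s x * (F.a u u x - 2 * F.l u x + F.j u x) -
        (1 / 2) * F.P s x * F.a s u x * (F.a s s x - 2 * F.l s x + F.j s x)) =
      F.P s x * ∑ u ∈ Finset.univ.erase s,
        (1 / 2) * (F.P u x * F.a u s x * (F.a u u x - 2 * F.l u x) / F.P s x) +
      F.P s x * ∑ u ∈ Finset.univ.erase s, (1 / 2) * (F.j u x * F.P u x * F.a u s x / F.P s x) -
      (1 / 2) * F.P s x * α * (F.a s s x - 2 * F.l s x + F.j s x) := by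
    rw [hα, Finset.mul_sum, Finset.mul_sum, Finset.mul_sum, Finset.sum_mul,
      ← Finset.sum_add_distrib, ← Finset.sum_sub_distrib]
    refine Finset.sum_congr rfl fun u _ => ?_
    have := hP s
    field_simp
  rw [e1, e2, e3, e4, e5, eh, ej]
  have hh : F.h s x = F.a s s x - 4 * F.l s x - α := rfl
  have hj : F.j s x = -α - 2 * F.l s x := rfl
  rw [hh, hj]
  ring

/-- The scalar curvature of a separable Kähler metric. -/
theorem scalarCurvature_eq (hp : base p ∈ F.V) :
    scalarCurvature F.metric p = -∑ s, F.P s (base p) * (pd s (F.h s) (base p) +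
        (F.a s s (base p) + F.j s (base p)) * F.h s (base p)) := by
  rw [scalarCurvature, metric_inv hp]
  simp only [Fintype.sum_sum_type, Matrix.fromBlocks_apply₁₁, Matrix.fromBlocks_apply₁₂,
    Matrix.fromBlocks_apply₂₁, Matrix.fromBlocks_apply₂₂, Matrix.zero_apply, zero_mul,
    Finset.sum_const_zero, add_zero, zero_add]
  rw [trace_ricci_fibre hp]
  have h1 : ∀ s, ∑ u, Matrix.diagonal (fun s => F.P s (base p)) s u *
      ricci F.metric (.inl s) (.inl u) p =
      F.P s (base p) * ricci F.metric (.inl s) (.inl s) p := by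
    intro s
    rw [Finset.sum_eq_single s (fun u _ hu => by simp [hu.symm]) (by simp)]
    simp
  simp only [h1, P_mul_ricci_base hp]
  rw [Finset.sum_add_distrib]
  simp only [Finset.sum_sub_distrib]
  rw [sum_sum_erase_comm fun s u => (1 / 2) * F.P u (base p) * F.a u s (base p) *
          (F.a u u (base p) - 2 * F.l u (base p) + F.j u (base p)), sub_self, add_zero,
    ← Finset.sum_add_distrib, ← Finset.sum_neg_distrib]
  exact Finset.sum_congr rfl fun s _ => by ring

end SeparableFrame

end ChartGeometry

namespace ChartGeometry

namespace SeparableFrame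

/-! ### Killing potentials which are functions on the base -/

variable {ι : Type*} [Fintype ι] [DecidableEq ι] (F : SeparableFrame ι)

/-- The Kähler form `∑_s dx_s ∧ θ_s`. -/
def form (p : ι ⊕ ι → ℝ) : Matrix (ι ⊕ ι) (ι ⊕ ι) ℝ :=
  Matrix.fromBlocks 0 (F.Θ (base p)) (-(F.Θ (base p)).transpose) 0

variable {F}

lemma hasFDerivAt_section (x : ι → ℝ) :
    HasFDerivAt (fun x : ι → ℝ => (Sum.elim x 0 : ι ⊕ ι → ℝ))
      (ContinuousLinearMap.pi (Sum.elim (fun s => ContinuousLinearMap.proj (R := ℝ)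
        (φ := fun _ : ι => ℝ) s) 0)) x := by
  rw [hasFDerivAt_pi']
  rintro (s | s)
  · exact (ContinuousLinearMap.proj (R := ℝ) (φ := fun _ : ι => ℝ) s).hasFDerivAt
  · simpa using! hasFDerivAt_const (0 : ℝ) x

lemma pd_section {f : (ι ⊕ ι → ℝ) → ℝ} {x : ι → ℝ}
    (hf : DifferentiableAt ℝ f (Sum.elim x 0)) (s : ι) :
    pd s (fun y => f (Sum.elim y 0)) x = pd (.inl s) f (Sum.elim x 0) := by
  have h : HasFDerivAt (fun y => f (Sum.elim y 0)) _ x :=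
    HasFDerivAt.comp x hf.hasFDerivAt (hasFDerivAt_section x)
  simp only [pd, h.fderiv, ContinuousLinearMap.comp_apply]
  congr 1
  ext t
  rcases t with t | t <;> simp [Pi.single_apply]

/-- A function on the base is a Killing potential if and only if its differential is a combination
of the 1-forms `θ_{·,b}` with constant coefficients. -/
theorem isKillingPotential_iff (hV : IsConnected F.V) {S : (ι → ℝ) → ℝ} {f : (ι ⊕ ι → ℝ) → ℝ}
    (hS : ∀ x ∈ F.V, DifferentiableAt ℝ S x) (hf : ∀ p, base p ∈ F.V → f p = S (base p)) :
    IsKillingPotential F.metric F.form {p | base p ∈ F.V} f ↔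
      ∃ c : ι → ℝ, ∀ x ∈ F.V, ∀ s, pd s S x = ∑ b, F.θ s b x * c b := by
  have hfl : ∀ p, base p ∈ F.V → ∀ s, pd (.inl s) f p = pd s S (base p) := by
    intro p hp s
    rw [pd_congr isOpen_domain (g := fun y => S (base y)) hf hp, pd_inl_base (hS _ hp)]
  have hfr : ∀ p, base p ∈ F.V → ∀ s, pd (.inr s) f p = 0 := by
    intro p hp s
    rw [pd_congr isOpen_domain (g := fun y => S (base y)) hf hp, pd_inr_base (hS _ hp)]
  constructor
  · rintro ⟨K, hK, hΩ, hL⟩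
    -- the base components of `K` vanish, because `f` does not depend on the fibre coordinates
    have hK0 : ∀ p, base p ∈ F.V → ∀ s, K (.inl s) p = 0 := by
      intro p hp
      have h1 : Matrix.vecMul (fun s => K (.inl s) p) (F.Θ (base p)) = 0 := by
        funext b
        have := hΩ p hp (.inr b)
        rw [hfr p hp, Fintype.sum_sum_type] at this
        simp only [form, Matrix.fromBlocks_apply₁₂, Matrix.fromBlocks_apply₂₂, Matrix.zero_apply,
          mul_zero, Finset.sum_const_zero, add_zero, neg_zero] at this
        exact this
      exact congrFun (Matrix.eq_zero_of_vecMul_eq_zero (F.det_ne _ hp) h1)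
    have hdiff : ∀ p, base p ∈ F.V → ∀ l, DifferentiableAt ℝ (K l) p := fun p hp l =>
      ((hK l).contDiffAt (isOpen_domain.mem_nhds hp)).differentiableAt (by simp)
    -- the mixed Killing equations make the fibre components constant along the base
    have hK1 : ∀ p, base p ∈ F.V → ∀ s b, pd (.inl s) (K (.inr b)) p = 0 := by
      intro p hp s
      have h1 : Matrix.vecMul (fun b => pd (.inl s) (K (.inr b)) p) (F.H (base p)) = 0 := by
        funext b
        have h2 := hL p hp (.inl s) (.inr b)
        have h3 : ∀ u, pd (.inr b) (K (.inl u)) p = 0 := by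
          intro u
          rw [pd_congr isOpen_domain (g := fun _ => 0) (fun y hy => hK0 y hy u) hp, pd_const]
        simp only [lieDerivMetric, Fintype.sum_sum_type, h3, metric, Matrix.fromBlocks_apply₁₂,
          Matrix.fromBlocks_apply₂₂, Matrix.zero_apply, pd_const, mul_zero, zero_mul,
          Finset.sum_const_zero, add_zero, zero_add] at h2
        refine Eq.trans ?_ h2
        exact Finset.sum_congr rfl fun c _ => mul_comm _ _
      exact congrFun (Matrix.eq_zero_of_vecMul_eq_zero (det_H_ne hp) h1)
    have hconst : ∀ b, ∃ c, ∀ x ∈ F.V, K (.inr b) (Sum.elim x 0) = c := by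
      intro b
      have hd : ∀ x ∈ F.V, DifferentiableAt ℝ (fun y => K (.inr b) (Sum.elim y 0)) x := by
        intro x hx
        have h1 : HasFDerivAt (fun y => K (.inr b) (Sum.elim y 0)) _ x :=
          HasFDerivAt.comp x (hdiff (Sum.elim x 0) hx (.inr b)).hasFDerivAt (hasFDerivAt_section x)
        exact h1.differentiableAt
      refine F.isOpen_V.exists_is_const_of_fderiv_eq_zero hV.isPreconnected
        (fun x hx => (hd x hx).differentiableWithinAt) fun x hx => fderiv_eq_zero_of_pd fun s => ?_
      rw [pd_section (hdiff (Sum.elim x 0) hx (.inr b))]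
      exact hK1 (Sum.elim x 0) hx s b
    choose c hc using hconst
    refine ⟨c, fun x hx s => ?_⟩
    have h1 := hΩ (Sum.elim x 0) hx (.inl s)
    rw [hfl (Sum.elim x 0) hx, Fintype.sum_sum_type] at h1
    simp only [form, Matrix.fromBlocks_apply₁₁, Matrix.fromBlocks_apply₂₁, Matrix.zero_apply,
      mul_zero, Finset.sum_const_zero, zero_add, Matrix.neg_apply, Matrix.transpose_apply,
      mul_neg, Finset.sum_neg_distrib, neg_inj] at h1
    change _ = pd s S x at h1
    rw [← h1]
    refine Finset.sum_congr rfl fun b _ => ?_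
    rw [hc b x hx, mul_comm]
    rfl
  · rintro ⟨c, hc⟩
    refine ⟨Sum.elim (fun _ _ => 0) (fun b _ => c b), ?_, ?_, ?_⟩
    · rintro (s | b)
      · exact contDiffOn_const
      · exact contDiffOn_const
    · rintro p hp (s | b)
      · rw [hfl p hp, hc _ hp, Fintype.sum_sum_type]
        simp only [form, Sum.elim_inl, Sum.elim_inr, Matrix.fromBlocks_apply₂₁, zero_mul,
          Finset.sum_const_zero, zero_add, Matrix.neg_apply, Matrix.transpose_apply, mul_neg,
          Finset.sum_neg_distrib, neg_inj]
        exact Finset.sum_congr rfl fun b _ => mul_comm _ _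
      · rw [hfr p hp, Fintype.sum_sum_type]
        simp [form]
    · intro p hp i j
      rw [lieDerivMetric]
      refine Finset.sum_eq_zero fun l _ => ?_
      rcases l with u | e
      · simp
      · have : pd (.inr e) (fun y => F.metric y i j) p = 0 := by
          rcases i with s | b <;> rcases j with t | b'
          · exact pd_metric_base_inr hp _ _ _
          · simp [metric]
          · simp [metric]
          · exact pd_metric_fibre_inr hp _ _ _
        simp [this]

end SeparableFrame

end ChartGeometry

namespace SegreVeronese

open ChartGeometry

/-! ### Contractions of tensors -/

section Pairing

variable {ι : Type*} [Fintype ι] [DecidableEq ι]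

/-- The contraction of a tensor in `W^{⊗ ι}` with the decomposable tensor `⨂_s w_s`. -/
def pairing (w : ι → W) : (⨂[ℝ] _ : ι, W) →ₗ[ℝ] ℝ :=
  PiTensorProduct.lift
    ((MultilinearMap.mkPiAlgebra ℝ ι ℝ).compLinearMap
      (fun s => w s 0 • LinearMap.proj (R := ℝ) (φ := fun _ : Fin 2 => ℝ) 0 +
        w s 1 • LinearMap.proj (R := ℝ) (φ := fun _ : Fin 2 => ℝ) 1))

@[simp] lemma pairing_tprod (w f : ι → W) :
    pairing w (PiTensorProduct.tprod ℝ f) = ∏ s, (w s 0 * f s 0 + w s 1 * f s 1) := by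
  simp [pairing]

/-- The decomposable tensor with `(0,1)` in the slots of `Q` and `(1,0)` elsewhere. -/
def slotVec (Q : Finset ι) (s : ι) : W := if s ∈ Q then ![0, 1] else ![1, 0]

lemma pairing_slotVec_tprod (Q : Finset ι) (f : ι → W) :
    pairing (slotVec Q) (PiTensorProduct.tprod ℝ f) =
      (∏ s ∈ Q, f s 1) * ∏ s ∈ Finset.univ \ Q, f s 0 := by
  rw [pairing_tprod, ← Finset.prod_sdiff (Finset.subset_univ Q), mul_comm]
  congr 1
  · exact Finset.prod_congr rfl fun s hs => by simp [slotVec, hs]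
  · refine Finset.prod_congr rfl fun s hs => ?_
    have : s ∉ Q := (Finset.mem_sdiff.1 hs).2
    simp [slotVec, this]

lemma pairing_affine (x : ι → ℝ) (h : ⨂[ℝ] _ : ι, W) :
    pairing (fun s => ![1, x s]) h = ∑ Q : Finset ι, (∏ s ∈ Q, x s) * pairing (slotVec Q) h := by
  have : pairing (fun s => ![1, x s]) =
      ∑ Q : Finset ι, (∏ s ∈ Q, x s) • pairing (slotVec Q) := by
    refine PiTensorProduct.ext (MultilinearMap.ext fun f => ?_)
    simp only [LinearMap.compMultilinearMap_apply, LinearMap.sum_apply, LinearMap.smul_apply,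
      pairing_slotVec_tprod, smul_eq_mul]
    rw [pairing_tprod]
    have := Finset.prod_add (fun s => x s * f s 1) (fun s => f s 0) Finset.univ
    rw [Finset.powerset_univ] at this
    simp only [Matrix.cons_val_zero, Matrix.cons_val_one, one_mul]
    rw [Finset.prod_congr rfl fun s _ => add_comm (f s 0) (x s * f s 1), this]
    refine Finset.sum_congr rfl fun Q _ => ?_
    rw [Finset.prod_mul_distrib, mul_assoc]
  rw [this]
  simp

/-- A tensor is determined by its components. -/
lemma eq_zero_of_pairing_slotVec {h : ⨂[ℝ] _ : ι, W}
    (H : ∀ Q : Finset ι, pairing (slotVec Q) h = 0) : h = 0 := by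
  let B := Basis.piTensorProduct (R := ℝ) (fun _ : ι => Pi.basisFun ℝ (Fin 2))
  refine B.ext_elem fun ε => ?_
  have : (Finsupp.lapply ε ∘ₗ B.repr.toLinearMap) =
      pairing (slotVec (Finset.univ.filter fun s => ε s = 1)) := by
    refine PiTensorProduct.ext (MultilinearMap.ext fun f => ?_)
    simp only [LinearMap.compMultilinearMap_apply, LinearMap.comp_apply, Finsupp.lapply_apply,
      pairing_tprod, LinearEquiv.coe_coe]
    rw [Basis.piTensorProduct_repr_tprod_apply]
    refine Finset.prod_congr rfl fun s _ => ?_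
    have h01 : ε s = 0 ∨ ε s = 1 := by omega
    rcases h01 with h | h <;> simp [slotVec, h]
  have h2 := LinearMap.congr_fun this h
  rw [H] at h2
  simpa using h2

/-- A tensor is determined by its contractions with the tensors `⨂_s (1, x_s)`. -/
lemma eq_zero_of_pairing_affine {h : ⨂[ℝ] _ : ι, W}
    (H : ∀ x : ι → ℝ, pairing (fun s => ![1, x s]) h = 0) : h = 0 := by
  refine eq_zero_of_pairing_slotVec fun Q => ?_
  induction Q using Finset.strongInduction with
  | H Q ih =>
    have h1 := H fun s => if s ∈ Q then 1 else 0
    rw [pairing_affine, Finset.sum_eq_single Q] at h1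
    · rw [Finset.prod_congr rfl fun s hs => if_pos hs] at h1
      simpa using h1
    · intro R _ hR
      by_cases hRQ : R ⊆ Q
      · rw [ih R (hRQ.ssubset_of_ne hR), mul_zero]
      · obtain ⟨s, hs, hsQ⟩ := Finset.not_subset.1 hRQ
        rw [Finset.prod_eq_zero hs (if_neg hsQ), zero_mul]
    · simp

lemma pairing_reindex (w : ι → W) (σ : Equiv.Perm ι) (h : ⨂[ℝ] _ : ι, W) :
    pairing w (PiTensorProduct.reindex ℝ (fun _ => W) σ h) = pairing (w ∘ σ) h := by
  have : pairing w ∘ₗ (PiTensorProduct.reindex ℝ (fun _ => W) σ).toLinearMap =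
      pairing (w ∘ σ) := by
    refine PiTensorProduct.ext (MultilinearMap.ext fun f => ?_)
    simp only [LinearMap.compMultilinearMap_apply, LinearMap.comp_apply, LinearEquiv.coe_coe]
    rw [PiTensorProduct.reindex_tprod, pairing_tprod, pairing_tprod]
    exact (Equiv.prod_comp σ _).symm.trans (by simp)
  exact LinearMap.congr_fun this h

end Pairing

/-- A component of a symmetric tensor depends only on the number of slots containing `(0,1)`. -/
lemma pairing_slotVec_of_card_eq {n : ℕ} {T : ⨂[ℝ] _ : Fin n, W} (hT : T ∈ symTensors n)
    {P Q : Finset (Fin n)} (hPQ : P.card = Q.card) :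
    pairing (slotVec P) T = pairing (slotVec Q) T := by
  let e : {x // x ∈ P} ≃ {x // x ∈ Q} := Finset.equivOfCardEq hPQ
  have hσ : slotVec Q ∘ e.extendSubtype = slotVec P := by
    funext s
    by_cases hs : s ∈ P
    · have := e.extendSubtype_mem s hs
      simp [slotVec, hs, this]
    · have := e.extendSubtype_not_mem s hs
      simp [slotVec, hs, this]
  rw [← hσ, ← pairing_reindex, hT]

/-! ### Symmetric multi-affine functions -/

/-- The function `∑_{T ⊆ R} b_{|T|} ∏_{r ∈ T} y_r = ∑_j b_j σ_j` of the variables `y_r`, `r ∈ R`. -/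
def symAffine {κ : Type*} (b : ℕ → ℝ) (R : Finset κ) (y : κ → ℝ) : ℝ :=
  ∑ T ∈ R.powerset, b T.card * ∏ r ∈ T, y r

/-- The shifted sequence of coefficients: the coefficients of a partial derivative. -/
def shift (b : ℕ → ℝ) (j : ℕ) : ℝ := b (j + 1)

section SymAffine

variable {κ : Type*} [DecidableEq κ]

lemma symAffine_erase (b : ℕ → ℝ) {R : Finset κ} {r : κ} (hr : r ∈ R) (y : κ → ℝ) :
    symAffine b R y = symAffine b (R.erase r) y + y r * symAffine (shift b) (R.erase r) y := by
  have h := Finset.notMem_erase r R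
  conv_lhs => rw [← Finset.insert_erase hr]
  rw [symAffine, Finset.sum_powerset_insert h]
  congr 1
  rw [symAffine, Finset.mul_sum]
  refine Finset.sum_congr rfl fun T hT => ?_
  have hrT : r ∉ T := fun h' => h (Finset.mem_powerset.1 hT h')
  rw [Finset.card_insert_of_notMem hrT, Finset.prod_insert hrT, shift]
  ring

lemma symAffine_congr {b b' : ℕ → ℝ} {R : Finset κ} {y y' : κ → ℝ}
    (hb : ∀ j ≤ R.card, b j = b' j) (h : ∀ r ∈ R, y r = y' r) :
    symAffine b R y = symAffine b' R y' := by
  refine Finset.sum_congr rfl fun T hT => ?_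
  rw [hb _ (Finset.card_le_card (Finset.mem_powerset.1 hT))]
  congr 1
  exact Finset.prod_congr rfl fun r hr => h r (Finset.mem_powerset.1 hT hr)

lemma symAffine_add (b b' : ℕ → ℝ) (R : Finset κ) (y : κ → ℝ) :
    symAffine (b + b') R y = symAffine b R y + symAffine b' R y := by
  simp [symAffine, add_mul, Finset.sum_add_distrib]

lemma symAffine_smul (c : ℝ) (b : ℕ → ℝ) (R : Finset κ) (y : κ → ℝ) :
    symAffine (c • b) R y = c * symAffine b R y := by
  simp [symAffine, Finset.mul_sum, mul_assoc]

@[simp] lemma symAffine_zero (R : Finset κ) (y : κ → ℝ) : symAffine 0 R y = 0 := by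
  simp [symAffine]

lemma symAffine_sum {α : Type*} (s : Finset α) (b : α → ℕ → ℝ) (R : Finset κ) (y : κ → ℝ) :
    symAffine (fun j => ∑ a ∈ s, b a j) R y = ∑ a ∈ s, symAffine (b a) R y := by
  simp only [symAffine, Finset.sum_mul]
  exact Finset.sum_comm

lemma symAffine_eq_of_tail_zero {b : ℕ → ℝ} {R : Finset κ}
    (hb : ∀ j, 1 ≤ j → j ≤ R.card → b j = 0) (y : κ → ℝ) : symAffine b R y = b 0 := by
  rw [symAffine, Finset.sum_eq_single ∅]
  · simp
  · intro T hT hT0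
    rw [hb _ (Finset.card_pos.2 (Finset.nonempty_iff_ne_empty.2 hT0))
      (Finset.card_le_card (Finset.mem_powerset.1 hT)), zero_mul]
  · simp

/-- The coefficients of `∏_r (y_r - w)`. -/
def rootCoeff (n : ℕ) (w : ℝ) (j : ℕ) : ℝ := (-w) ^ (n - j)

lemma symAffine_rootCoeff (w : ℝ) (R : Finset κ) (y : κ → ℝ) :
    symAffine (rootCoeff R.card w) R y = ∏ r ∈ R, (y r - w) := by
  simp only [sub_eq_add_neg]
  rw [Finset.prod_add]
  refine Finset.sum_congr rfl fun T hT => ?_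
  rw [Finset.prod_const, Finset.card_sdiff_of_subset (Finset.mem_powerset.1 hT), mul_comm,
    rootCoeff]

lemma shift_rootCoeff (n : ℕ) (w : ℝ) : shift (rootCoeff (n + 1) w) = rootCoeff n w := by
  funext j
  simp [shift, rootCoeff]

/-- Every symmetric multi-affine function in `n` variables is a combination of the products
`∏_r (y_r - w_l)` for `n + 1` given distinct numbers `w_l`. -/
lemma exists_rootCoeff_combination (n : ℕ) (b : ℕ → ℝ) {w : Fin (n + 1) → ℝ}
    (hw : Function.Injective w) :
    ∃ c : Fin (n + 1) → ℝ, ∀ j ≤ n, b j = ∑ l, c l * rootCoeff n (w l) j := by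
  have hdet : (Matrix.vandermonde fun l => -w l).det ≠ 0 :=
    Matrix.det_vandermonde_ne_zero_iff.2 fun a b h => hw (neg_injective h)
  refine ⟨Matrix.vecMul (fun j : Fin (n + 1) => b (n - j)) (Matrix.vandermonde fun l => -w l)⁻¹, ?_⟩
  intro j hj
  have h1 : Matrix.vecMul (Matrix.vecMul (fun j : Fin (n + 1) => b (n - j))
      (Matrix.vandermonde fun l => -w l)⁻¹) (Matrix.vandermonde fun l => -w l) =
      fun j : Fin (n + 1) => b (n - j) := by
    rw [Matrix.vecMul_vecMul, Matrix.nonsing_inv_mul _ hdet.isUnit, Matrix.vecMul_one]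
  have h2 := congrFun h1 ⟨n - j, by omega⟩
  have h3 : n - (n - j) = j := by omega
  simp only [h3] at h2
  rw [← h2]
  rfl

end SymAffine

/-! ### The functions `⟨μ, h⟩` -/

variable {k : ℕ} {d : Fin k → ℕ}

/-- The function `∑_i ∑_j b_{ij} σ_j(x_{i1}, …, x_{i d_i})`. -/
def affineFun (d : Fin k → ℕ) (b : Fin k → ℕ → ℝ) (x : Slot d → ℝ) : ℝ :=
  ∑ i, symAffine (b i) Finset.univ fun r => x ⟨i, r⟩

/-- Outside the `i`-th group, contraction with `(1,0)` gives the first components of the `w_s`. -/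
lemma contract_ins (i : Fin k) (w : Slot d → W) (T : ⨂[ℝ] _ : Fin (d i), W) :
    contract d w (ins d i T) =
      (∏ j ∈ Finset.univ.erase i, ∏ r, w ⟨j, r⟩ 0) * pairing (fun r => w ⟨i, r⟩) T := by
  have : contract d w ∘ₗ ins d i =
      (∏ j ∈ Finset.univ.erase i, ∏ r, w ⟨j, r⟩ 0) • pairing (fun r => w ⟨i, r⟩) := by
    refine PiTensorProduct.ext (MultilinearMap.ext fun f => ?_)
    simp only [LinearMap.compMultilinearMap_apply, LinearMap.comp_apply, LinearMap.smul_apply,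
      smul_eq_mul, pairing_tprod]
    have h1 : ins d i (PiTensorProduct.tprod ℝ f) = PiTensorProduct.tprod ℝ (fill d i f) := by
      simp [ins]
    rw [h1]
    change pairing w _ = _
    rw [pairing_tprod, Fintype.prod_sigma, ← Finset.mul_prod_erase _ _ (Finset.mem_univ i),
      mul_comm]
    congr 1
    · refine Finset.prod_congr rfl fun j hj => Finset.prod_congr rfl fun r _ => ?_
      simp [fill, Finset.ne_of_mem_erase hj]
    · refine Finset.prod_congr rfl fun r _ => ?_
      simp [fill]
  exact LinearMap.congr_fun this T

lemma momentum_ins (i : Fin k) (x : Slot d → ℝ) (T : ⨂[ℝ] _ : Fin (d i), W) :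
    momentum d x (ins d i T) = pairing (fun r => ![1, x ⟨i, r⟩]) T := by
  rw [momentum, contract_ins]
  simp

lemma eq_of_momentum_eq {h h' : Tensors d} (H : ∀ x, momentum d x h = momentum d x h') :
    h = h' := by
  rw [← sub_eq_zero]
  refine eq_zero_of_pairing_affine fun x => ?_
  change momentum d x (h - h') = 0
  rw [map_sub, H, sub_self]

/-- For a symmetric tensor `T`, the function `⟨μ, ins_i T⟩` is symmetric multi-affine in the
coordinates of the `i`-th group, with the components of the tensor as coefficients. -/
lemma momentum_ins_of_mem (i : Fin k) {T : ⨂[ℝ] _ : Fin (d i), W} (hT : T ∈ symTensors (d i)) :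
    ∃ b : ℕ → ℝ, (∀ x, momentum d x (ins d i T) =
      symAffine b Finset.univ fun r => x ⟨i, r⟩) ∧
      ∀ r : Fin (d i), b (r + 1) = component d (ins d i T) i r := by
  refine ⟨fun j => pairing (slotVec (Finset.univ.filter fun r : Fin (d i) => r.val < j)) T,
    fun x => ?_, fun r => ?_⟩
  · rw [momentum_ins, pairing_affine, symAffine, Finset.powerset_univ]
    refine Finset.sum_congr rfl fun Q _ => ?_
    rw [mul_comm, pairing_slotVec_of_card_eq hT (Q := Finset.univ.filter fun r : Fin (d i) =>
      r.val < Q.card)]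
    have hQ : Q.card ≤ d i := by simpa using Finset.card_le_univ Q
    rw [Fin.card_filter_val_lt, min_eq_right hQ]
  · have hw : (fun q : Fin (d i) => (if (⟨i, q⟩ : Slot d).1 = i ∧ (⟨i, q⟩ : Slot d).2.val ≤ r.val
        then ![0, 1] else ![1, 0] : W)) =
        slotVec (Finset.univ.filter fun q : Fin (d i) => q.val < r.val + 1) := by
      funext q
      simp [slotVec]
    rw [component, contract_ins, hw, Finset.prod_eq_one, one_mul]
    · intro j hj
      refine Finset.prod_eq_one fun q _ => ?_
      simp [Finset.ne_of_mem_erase hj]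

lemma component_ins_of_ne {i j : Fin k} (hij : j ≠ i) (T : ⨂[ℝ] _ : Fin (d j), W)
    (r : Fin (d i)) : component d (ins d j T) i r = 0 := by
  rw [component, contract_ins]
  refine mul_eq_zero_of_left (Finset.prod_eq_zero (Finset.mem_erase.2 ⟨hij.symm, Finset.mem_univ i⟩)
    (Finset.prod_eq_zero (Finset.mem_univ r) ?_)) _
  simp

/-- The functions `⟨μ, h⟩`, `h ∈ 𝔥`, are sums of symmetric multi-affine functions of the groups. -/
lemma exists_affineFun {h : Tensors d} (hh : h ∈ productStructure d) :
    ∃ b : Fin k → ℕ → ℝ, (∀ x, momentum d x h = affineFun d b x) ∧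
      ∀ i (r : Fin (d i)), b i (r + 1) = component d h i r := by
  refine Submodule.iSup_induction _ (motive := fun h => ∃ b : Fin k → ℕ → ℝ,
    (∀ x, momentum d x h = affineFun d b x) ∧
      ∀ i (r : Fin (d i)), b i (r + 1) = component d h i r) hh ?_ ?_ ?_
  · rintro i _ ⟨T, hT, rfl⟩
    obtain ⟨b, hb1, hb2⟩ := momentum_ins_of_mem i hT
    refine ⟨Pi.single i b, fun x => ?_, fun j r => ?_⟩
    · rw [hb1, affineFun, Finset.sum_eq_single i (fun j _ hj => by simp [hj]) (by simp),
        Pi.single_eq_same]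
    · by_cases hj : j = i
      · subst hj; rw [Pi.single_eq_same, hb2]
      · rw [Pi.single_eq_of_ne hj, component_ins_of_ne (Ne.symm hj)]; rfl
  · exact ⟨0, fun x => by simp [affineFun], fun i r => by simp [component]⟩
  · rintro h h' ⟨b, hb1, hb2⟩ ⟨b', hb1', hb2'⟩
    refine ⟨b + b', fun x => ?_, fun i r => ?_⟩
    · rw [map_add, hb1, hb1', affineFun, affineFun, affineFun, ← Finset.sum_add_distrib]
      exact Finset.sum_congr rfl fun i _ => (symAffine_add _ _ _ _).symm
    · rw [component, map_add, ← component, ← component, ← hb2, ← hb2']; rfl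

lemma tprod_const_mem_symTensors (n : ℕ) (v : W) :
    PiTensorProduct.tprod ℝ (fun _ : Fin n => v) ∈ symTensors n := by
  intro σ
  rw [PiTensorProduct.reindex_tprod]

lemma ins_mem_productStructure (i : Fin k) {T : ⨂[ℝ] _ : Fin (d i), W}
    (hT : T ∈ symTensors (d i)) : ins d i T ∈ productStructure d :=
  Submodule.mem_iSup_of_mem i (Submodule.mem_map_of_mem hT)

/-- Every sum of symmetric multi-affine functions of the groups is of the form `⟨μ, h⟩`: the tensors
`ins_i (-w, 1)^{⊗ d_i}` with `⟨μ, h⟩ = ∏_r (x_{ir} - w)` are in `𝔥`, and these products span. -/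
lemma exists_momentum_eq (b : Fin k → ℕ → ℝ) :
    ∃ h ∈ productStructure d, ∀ x, momentum d x h = affineFun d b x := by
  have hinj : ∀ n, Function.Injective (fun l : Fin (n + 1) => (l.val : ℝ)) := fun n a b h =>
    Fin.ext (Nat.cast_injective h)
  choose c hc using fun i => exists_rootCoeff_combination (d i) (b i) (hinj (d i))
  refine ⟨∑ i, ∑ l, c i l • ins d i (PiTensorProduct.tprod ℝ fun _ => ![-(l.val : ℝ), 1]),
    Submodule.sum_mem _ fun i _ => Submodule.sum_mem _ fun l _ => Submodule.smul_mem _ _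
      (ins_mem_productStructure i (tprod_const_mem_symTensors _ _)), fun x => ?_⟩
  rw [map_sum, affineFun]
  refine Finset.sum_congr rfl fun i _ => ?_
  rw [map_sum, symAffine_congr (b' := fun j => ∑ l, (c i l • rootCoeff (d i) l.val) j)
    (fun j hj => hc i j (by simpa using hj)) (fun _ _ => rfl), symAffine_sum]
  refine Finset.sum_congr rfl fun l _ => ?_
  have := symAffine_rootCoeff (l.val : ℝ) Finset.univ fun r : Fin (d i) => x ⟨i, r⟩
  rw [Finset.card_univ, Fintype.card_fin] at this
  rw [symAffine_smul, this, map_smul, momentum_ins, pairing_tprod, smul_eq_mul]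
  congr 1
  refine Finset.prod_congr rfl fun r _ => ?_
  simp
  ring

/-- The space `𝔥` embeds into a space of dimension `m + 1`. -/
lemma exists_injective_productStructure :
    ∃ f : productStructure d →ₗ[ℝ] (Option (Slot d) → ℝ), Function.Injective f := by
  let f : productStructure d →ₗ[ℝ] (Option (Slot d) → ℝ) :=
    LinearMap.pi fun o => (o.elim (momentum d 0) fun s => contract d (fun q =>
      if q.1 = s.1 ∧ q.2.val ≤ s.2.val then ![0, 1] else ![1, 0])) ∘ₗ Submodule.subtype _
  have hf : Function.Injective f := by
    rintro ⟨h₁, hh₁⟩ ⟨h₂, hh₂⟩ h12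
    set h := h₁ + (-1 : ℝ) • h₂ with hdef
    obtain ⟨b, hb1, hb2⟩ := exists_affineFun
      (Submodule.add_mem _ hh₁ (Submodule.smul_mem _ (-1 : ℝ) hh₂))
    have hcomp : ∀ i (r : Fin (d i)), component d h i r = 0 := by
      intro i r
      have h3 : component d h₁ i r = component d h₂ i r := congrFun h12 (some ⟨i, r⟩)
      rw [component] at h3
      rw [component, hdef, map_add, map_smul, h3, ← component]
      simp
    have hconst : ∀ x, momentum d x h = ∑ i, b i 0 := by
      intro x
      rw [hb1, affineFun]
      refine Finset.sum_congr rfl fun i _ => symAffine_eq_of_tail_zero (fun j hj hj' => ?_) _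
      rw [Finset.card_univ, Fintype.card_fin] at hj'
      obtain ⟨j, rfl⟩ : ∃ j', j = j' + 1 := ⟨j - 1, by omega⟩
      have := hb2 i ⟨j, by omega⟩
      rw [hcomp] at this
      exact this
    have h00 : momentum d 0 h = 0 := by
      have h3 : momentum d 0 h₁ = momentum d 0 h₂ := congrFun h12 none
      rw [hdef, map_add, map_smul, h3]
      simp
    refine Subtype.ext (eq_of_momentum_eq fun x => ?_)
    have h4 := hconst x
    rw [← hconst 0, h00, hdef, map_add, map_smul, smul_eq_mul] at h4
    change momentum d x h₁ = momentum d x h₂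
    linarith
  exact ⟨f, hf⟩

/-- `m + 1` linearly independent elements span `𝔥`. -/
lemma exists_eq_sum_of_linearIndependent {v : Option (Slot d) → productStructure d}
    (hv : LinearIndependent ℝ v) {h : Tensors d} (hh : h ∈ productStructure d) :
    ∃ c : Option (Slot d) → ℝ, h = ∑ o, c o • (v o : Tensors d) := by
  obtain ⟨f, hf⟩ := exists_injective_productStructure (d := d)
  have hfv : LinearIndependent ℝ (f ∘ v) := hv.map_injOn f hf.injOn
  have htop : Submodule.span ℝ (Set.range (f ∘ v)) = ⊤ :=
    hfv.span_eq_top_of_card_eq_finrank' (by simp)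
  have hmem : f ⟨h, hh⟩ ∈ Submodule.span ℝ (Set.range (f ∘ v)) := htop ▸ Submodule.mem_top
  obtain ⟨c, hc⟩ := (Submodule.mem_span_range_iff_exists_fun ℝ).1 hmem
  refine ⟨c, ?_⟩
  have : f (∑ o, c o • v o) = f ⟨h, hh⟩ := by
    rw [map_sum, ← hc]
    exact Finset.sum_congr rfl fun o _ => map_smul _ _ _
  have h2 := congrArg (Submodule.subtype _) (hf this)
  rw [map_sum] at h2
  simpa using h2.symm

end SegreVeronese

namespace ChartGeometry

/-! ### Partial derivatives along coordinate lines -/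

variable {ι : Type*} [Fintype ι] [DecidableEq ι] {f : (ι → ℝ) → ℝ} {x : ι → ℝ}

lemma pd_eq_of_update {i : ι} {c : ℝ} (hf : DifferentiableAt ℝ f x)
    (h : ∀ z, f (Function.update x i z) = f x + (z - x i) * c) : pd i f x = c := by
  have h1 := hasDerivAt_update hf i
  have h2 : HasDerivAt (fun z => f (Function.update x i z)) c (x i) := by
    simp only [h]
    simpa using (((hasDerivAt_id (x i)).sub_const (x i)).mul_const c).const_add (f x)
  exact h1.unique h2

lemma pd_coord (i j : ι) : pd i (fun y : ι → ℝ => y j) x = if i = j then 1 else 0 := by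
  refine pd_eq_of_update (by fun_prop) fun z => ?_
  split_ifs with h
  · subst h; simp
  · simp [Function.update_of_ne (Ne.symm h)]

lemma pd_comp_coord {g : ℝ → ℝ} (i j : ι) (hg : DifferentiableAt ℝ g (x j)) :
    pd i (fun y : ι → ℝ => g (y j)) x = if i = j then deriv g (x j) else 0 := by
  have hp : HasFDerivAt (fun y : ι → ℝ => y j) (ContinuousLinearMap.proj (R := ℝ)
      (φ := fun _ : ι => ℝ) j) x :=
    (ContinuousLinearMap.proj (R := ℝ) (φ := fun _ : ι => ℝ) j).hasFDerivAt
  have h1 := (hg.hasDerivAt.comp_hasFDerivAt x hp).fderiv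
  have h2 : (fun y : ι → ℝ => g (y j)) = g ∘ fun y : ι → ℝ => y j := rfl
  rw [pd, h2, h1]
  simp [Pi.single_apply, eq_comm]

lemma pd_prod {κ : Type*} (s : Finset κ) (i : ι) {F : κ → (ι → ℝ) → ℝ}
    (h : ∀ j ∈ s, DifferentiableAt ℝ (F j) x) (h0 : ∀ j ∈ s, F j x ≠ 0) :
    pd i (fun y => ∏ j ∈ s, F j y) x = (∏ j ∈ s, F j x) * ∑ j ∈ s, pd i (F j) x / F j x := by
  classical
  induction s using Finset.induction_on with
  | empty => simp
  | insert a s ha ih =>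
    have h1 : DifferentiableAt ℝ (fun y => ∏ j ∈ s, F j y) x :=
      (HasFDerivAt.finsetProd fun j hj =>
        (h j (Finset.mem_insert_of_mem hj)).hasFDerivAt).differentiableAt
    simp only [Finset.prod_insert ha, Finset.sum_insert ha]
    rw [pd_mul i (h a (Finset.mem_insert_self a s)) h1,
      ih (fun j hj => h j (Finset.mem_insert_of_mem hj))
        fun j hj => h0 j (Finset.mem_insert_of_mem hj)]
    have := h0 a (Finset.mem_insert_self a s)
    field_simp

end ChartGeometry

namespace SegreVeronese

open ChartGeometry

/-! ### Partial derivatives of the functions `⟨μ, h⟩` -/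

variable {k : ℕ} {d : Fin k → ℕ} (b : Fin k → ℕ → ℝ)

/-- The partial derivative of `affineFun d b` with respect to `x_s`. -/
def slope (s : Slot d) (x : Slot d → ℝ) : ℝ :=
  symAffine (shift (b s.1)) (Finset.univ.erase s.2) fun r => x ⟨s.1, r⟩

/-- The second partial derivative of `affineFun d b` with respect to two variables of a group. -/
def slope₂ (i : Fin k) (r q : Fin (d i)) (x : Slot d → ℝ) : ℝ :=
  symAffine (shift (shift (b i))) ((Finset.univ.erase r).erase q) fun r => x ⟨i, r⟩

lemma update_mk_of_ne {i j : Fin k} (hij : j ≠ i) (x : Slot d → ℝ) (r : Fin (d i)) (z : ℝ)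
    (q : Fin (d j)) : Function.update x ⟨i, r⟩ z ⟨j, q⟩ = x ⟨j, q⟩ :=
  Function.update_of_ne (fun h => hij (congrArg Sigma.fst h)) _ _

lemma update_mk_same {i : Fin k} (x : Slot d → ℝ) {r q : Fin (d i)} (z : ℝ) (h : q ≠ r) :
    Function.update x ⟨i, r⟩ z ⟨i, q⟩ = x ⟨i, q⟩ :=
  Function.update_of_ne (show (⟨i, q⟩ : Slot d) ≠ ⟨i, r⟩ by simpa using h) _ _

lemma symAffine_update {i : Fin k} (c : ℕ → ℝ) {R : Finset (Fin (d i))} {r : Fin (d i)}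
    (hr : r ∈ R) (x : Slot d → ℝ) (z : ℝ) :
    symAffine c R (fun q => Function.update x ⟨i, r⟩ z ⟨i, q⟩) =
      symAffine c R (fun q => x ⟨i, q⟩) +
        (z - x ⟨i, r⟩) * symAffine (shift c) (R.erase r) (fun q => x ⟨i, q⟩) := by
  rw [symAffine_erase c hr, symAffine_erase c hr (fun q => x ⟨i, q⟩)]
  have h1 : ∀ c : ℕ → ℝ, symAffine c (R.erase r) (fun q => Function.update x ⟨i, r⟩ z ⟨i, q⟩) =
      symAffine c (R.erase r) (fun q => x ⟨i, q⟩) := fun c =>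
    symAffine_congr (fun _ _ => rfl) fun q hq => update_mk_same x z (Finset.ne_of_mem_erase hq)
  rw [h1, h1, Function.update_self]
  ring

lemma affineFun_update (s : Slot d) (x : Slot d → ℝ) (z : ℝ) :
    affineFun d b (Function.update x s z) = affineFun d b x + (z - x s) * slope b s x := by
  obtain ⟨i, r⟩ := s
  rw [affineFun, affineFun, ← Finset.add_sum_erase _ _ (Finset.mem_univ i),
    ← Finset.add_sum_erase _ (fun i => symAffine (b i) Finset.univ fun r => x ⟨i, r⟩)
      (Finset.mem_univ i), symAffine_update _ (Finset.mem_univ r)]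
  have : ∀ j ∈ Finset.univ.erase i, (symAffine (b j) Finset.univ fun q =>
      Function.update x ⟨i, r⟩ z ⟨j, q⟩) = symAffine (b j) Finset.univ fun q => x ⟨j, q⟩ :=
    fun j hj => symAffine_congr (fun _ _ => rfl) fun q _ =>
      update_mk_of_ne (Finset.ne_of_mem_erase hj) x r z q
  rw [Finset.sum_congr rfl this]
  simp only [slope]
  ring

lemma slope_update_self (s : Slot d) (x : Slot d → ℝ) (z : ℝ) :
    slope b s (Function.update x s z) = slope b s x := by
  obtain ⟨i, r⟩ := s
  exact symAffine_congr (fun _ _ => rfl) fun q hq =>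
    update_mk_same x z (Finset.ne_of_mem_erase hq)

lemma slope_update_of_ne {s u : Slot d} (h : s.1 ≠ u.1) (x : Slot d → ℝ) (z : ℝ) :
    slope b s (Function.update x u z) = slope b s x := by
  obtain ⟨i, r⟩ := s
  obtain ⟨j, q⟩ := u
  exact symAffine_congr (fun _ _ => rfl) fun q' _ => update_mk_of_ne h x q z q'

lemma slope_update_same {i : Fin k} {r q : Fin (d i)} (h : q ≠ r) (x : Slot d → ℝ) (z : ℝ) :
    slope b ⟨i, r⟩ (Function.update x ⟨i, q⟩ z) =
      slope b ⟨i, r⟩ x + (z - x ⟨i, q⟩) * slope₂ b i r q x :=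
  symAffine_update _ (Finset.mem_erase.2 ⟨h, Finset.mem_univ q⟩) x z

lemma slope_sub_slope {i : Fin k} {r q : Fin (d i)} (h : q ≠ r) (x : Slot d → ℝ) :
    slope b ⟨i, r⟩ x - slope b ⟨i, q⟩ x = (x ⟨i, q⟩ - x ⟨i, r⟩) * slope₂ b i r q x := by
  simp only [slope, slope₂]
  rw [symAffine_erase (shift (b i)) (Finset.mem_erase.2 ⟨h, Finset.mem_univ q⟩),
    symAffine_erase (shift (b i)) (Finset.mem_erase.2 ⟨h.symm, Finset.mem_univ r⟩),
    Finset.erase_right_comm]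
  ring

lemma analyticAt_coord {ι : Type*} [Fintype ι] (s : ι) (x : ι → ℝ) :
    AnalyticAt ℝ (fun x : ι → ℝ => x s) x :=
  (ContinuousLinearMap.proj (R := ℝ) (φ := fun _ : ι => ℝ) s).analyticAt x

lemma analyticAt_symAffine {κ ι : Type*} [Fintype ι] (c : ℕ → ℝ) (R : Finset κ) (e : κ → ι)
    (x : ι → ℝ) : AnalyticAt ℝ (fun x : ι → ℝ => symAffine c R fun r => x (e r)) x := by
  unfold symAffine
  have hc := fun s => analyticAt_coord s x
  exact Finset.analyticAt_fun_sum _ fun T _ => analyticAt_const.mul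
    (Finset.analyticAt_fun_prod _ fun r _ => hc (e r))

lemma analyticAt_affineFun (x : Slot d → ℝ) : AnalyticAt ℝ (affineFun d b) x :=
  Finset.analyticAt_fun_sum _ fun i _ => analyticAt_symAffine _ _ (fun r => (⟨i, r⟩ : Slot d)) x

lemma analyticAt_slope (s : Slot d) (x : Slot d → ℝ) : AnalyticAt ℝ (slope b s) x :=
  analyticAt_symAffine _ _ (fun r => (⟨s.1, r⟩ : Slot d)) x

lemma pd_affineFun (s : Slot d) (x : Slot d → ℝ) : pd s (affineFun d b) x = slope b s x :=
  pd_eq_of_update (analyticAt_affineFun b x).differentiableAt fun z => affineFun_update b s x z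

lemma pd_slope_self (s : Slot d) (x : Slot d → ℝ) : pd s (slope b s) x = 0 :=
  pd_eq_of_update (analyticAt_slope b s x).differentiableAt fun z => by
    rw [slope_update_self]; ring

lemma pd_slope_of_ne {s u : Slot d} (h : s.1 ≠ u.1) (x : Slot d → ℝ) :
    pd u (slope b s) x = 0 :=
  pd_eq_of_update (analyticAt_slope b s x).differentiableAt fun z => by
    rw [slope_update_of_ne b h]; ring

lemma pd_slope_same {i : Fin k} {r q : Fin (d i)} (h : q ≠ r) (x : Slot d → ℝ) :
    pd ⟨i, q⟩ (slope b ⟨i, r⟩) x = slope₂ b i r q x :=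
  pd_eq_of_update (analyticAt_slope b _ x).differentiableAt fun z => slope_update_same b h x z

end SegreVeronese

namespace SegreVeronese

open ChartGeometry

variable {k : ℕ} {d : Fin k → ℕ}

/-! ### The scalar curvature of a separable geometry -/

/-- The logarithmic derivative of `Δ_s` with respect to `x_u`. -/
def dlogDelta (u s : Slot d) (x : Slot d → ℝ) : ℝ :=
  ∑ q ∈ Finset.univ.erase s.2,
    ((if u = s then 1 else 0) - (if u = ⟨s.1, q⟩ then 1 else 0)) / (x s - x ⟨s.1, q⟩)

lemma sub_ne_of_Delta_ne {x : Slot d → ℝ} {s : Slot d} (h : Delta d x s ≠ 0) {q : Fin (d s.1)}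
    (hq : q ≠ s.2) : x s - x ⟨s.1, q⟩ ≠ 0 :=
  Finset.prod_ne_zero_iff.1 h q (Finset.mem_erase.2 ⟨hq, Finset.mem_univ q⟩)

lemma differentiable_Delta (s : Slot d) (x : Slot d → ℝ) :
    DifferentiableAt ℝ (fun x => Delta d x s) x :=
  (HasFDerivAt.finsetProd (u := Finset.univ.erase s.2)
    (g := fun q (x : Slot d → ℝ) => x s - x ⟨s.1, q⟩) fun q _ =>
      (show DifferentiableAt ℝ (fun x : Slot d → ℝ => x s - x ⟨s.1, q⟩) x by
        fun_prop).hasFDerivAt).differentiableAt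

lemma pd_Delta {x : Slot d → ℝ} {s : Slot d} (h : Delta d x s ≠ 0) (u : Slot d) :
    pd u (fun x => Delta d x s) x = Delta d x s * dlogDelta u s x := by
  have h1 := pd_prod (x := x) (Finset.univ.erase s.2) u
    (F := fun q (x : Slot d → ℝ) => x s - x ⟨s.1, q⟩) (fun q _ => by fun_prop)
    fun q hq => sub_ne_of_Delta_ne h (Finset.ne_of_mem_erase hq)
  refine h1.trans ?_
  simp only [dlogDelta, Delta]
  congr 1
  refine Finset.sum_congr rfl fun q _ => ?_
  rw [pd_sub u (by fun_prop) (by fun_prop), pd_coord, pd_coord]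

lemma dlogDelta_same {i : Fin k} {r q : Fin (d i)} (h : q ≠ r) (x : Slot d → ℝ) :
    dlogDelta ⟨i, q⟩ ⟨i, r⟩ x = -1 / (x ⟨i, r⟩ - x ⟨i, q⟩) := by
  rw [dlogDelta, Finset.sum_eq_single q]
  · simp [h]
  · intro q' _ hq'
    simp [h, hq'.symm]
  · simp [h]

lemma dlogDelta_of_ne {s u : Slot d} (h : s.1 ≠ u.1) (x : Slot d → ℝ) :
    dlogDelta u s x = 0 := by
  have h1 : u ≠ s := fun h' => h (by rw [h'])
  refine Finset.sum_eq_zero fun q _ => ?_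
  have h2 : u ≠ ⟨s.1, q⟩ := fun h' => h (by rw [h'])
  simp [h1, h2]

lemma dlogDelta_self (s : Slot d) (x : Slot d → ℝ) :
    dlogDelta s s x = ∑ q ∈ Finset.univ.erase s.2, 1 / (x s - x ⟨s.1, q⟩) := by
  obtain ⟨i, r⟩ := s
  refine Finset.sum_congr rfl fun q hq => ?_
  simp [(Finset.ne_of_mem_erase hq).symm]

lemma differentiableAt_dlogDelta {x : Slot d → ℝ} {s : Slot d} (h : Delta d x s ≠ 0)
    (u : Slot d) : DifferentiableAt ℝ (dlogDelta u s) x := by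
  refine DifferentiableAt.fun_sum fun q hq => ?_
  have h1 := sub_ne_of_Delta_ne h (Finset.ne_of_mem_erase hq)
  simp only [div_eq_mul_inv]
  exact (differentiableAt_const _).mul
    ((show DifferentiableAt ℝ (fun x : Slot d → ℝ => x s - x ⟨s.1, q⟩) x by fun_prop).fun_inv h1)

namespace SeparableKahler

variable (G : SeparableKahler d)

/-- The coefficients of `⟨μ, β⟩`. -/
def twistCoeff : Fin k → ℕ → ℝ := (exists_affineFun G.β.2).choose

lemma twist_eq (x : Slot d → ℝ) : G.twist x = affineFun d G.twistCoeff x :=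
  (exists_affineFun G.β.2).choose_spec.1 x

lemma twistCoeff_succ (i : Fin k) (r : Fin (d i)) :
    G.twistCoeff i (r + 1) = component d (G.β : Tensors d) i r :=
  (exists_affineFun G.β.2).choose_spec.2 i r

lemma isOpen_interval (s : Slot d) : IsOpen (G.interval s) :=
  isOpenMap_eval s _ G.isOpen_U

lemma isPreconnected_interval (s : Slot d) : IsPreconnected (G.interval s) :=
  (G.isConnected_U.isPreconnected).image _ (continuous_apply s).continuousOn

variable {G} {x : Slot d → ℝ}

lemma mem_interval (hx : x ∈ G.U) (s : Slot d) : x s ∈ G.interval s := ⟨x, hx, rfl⟩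

lemma Delta_ne (hx : x ∈ G.U) (s : Slot d) : Delta d x s ≠ 0 := by
  intro h; have := G.pos x hx s; simp [h] at this

lemma A_ne (hx : x ∈ G.U) (s : Slot d) : G.A s (x s) ≠ 0 := by
  intro h; have := G.pos x hx s; simp [h] at this

lemma twist_ne [Nonempty (Slot d)] (hx : x ∈ G.U) : G.twist x ≠ 0 := by
  intro h
  have := G.pos x hx (Classical.arbitrary _)
  rw [twist] at h
  simp [h] at this

lemma contDiffOn_A (s : Slot d) : ContDiffOn ℝ ∞ (G.A s) (G.interval s) := G.smooth_A s

lemma contDiffOn_deriv_A (s : Slot d) : ContDiffOn ℝ ∞ (deriv (G.A s)) (G.interval s) :=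
  (contDiffOn_A s).deriv_of_isOpen (G.isOpen_interval s) (by simp)

lemma differentiableAt_A {s : Slot d} {z : ℝ} (hz : z ∈ G.interval s) :
    DifferentiableAt ℝ (G.A s) z :=
  ((contDiffOn_A s).contDiffAt ((G.isOpen_interval s).mem_nhds hz)).differentiableAt (by simp)

lemma differentiableAt_deriv_A {s : Slot d} {z : ℝ} (hz : z ∈ G.interval s) :
    DifferentiableAt ℝ (deriv (G.A s)) z :=
  ((contDiffOn_deriv_A s).contDiffAt
    ((G.isOpen_interval s).mem_nhds hz)).differentiableAt (by simp)

variable (G) in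
lemma differentiableAt_twist (x : Slot d → ℝ) : DifferentiableAt ℝ G.twist x := by
  rw [show G.twist = affineFun d G.twistCoeff from funext G.twist_eq]
  exact (analyticAt_affineFun _ x).differentiableAt

variable (G) in
lemma pd_twist (s : Slot d) (x : Slot d → ℝ) : pd s G.twist x = slope G.twistCoeff s x := by
  rw [show G.twist = affineFun d G.twistCoeff from funext G.twist_eq, pd_affineFun]

variable (G) in
/-- The coefficients of `⟨μ, h⟩` for the element `h` of the frame with index `a`. -/
def frameCoeff (a : Slot d) : Fin k → ℕ → ℝ := (exists_affineFun (G.frame a).2).choose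

variable (G) in
lemma frame_eq (a : Slot d) (x : Slot d → ℝ) :
    momentum d x (G.frame a : Tensors d) = affineFun d (G.frameCoeff a) x :=
  (exists_affineFun (G.frame a).2).choose_spec.1 x

/-- The derivative of `⟨μ, h⟩ / ⟨μ, β⟩` for a function `⟨μ, h⟩` with given coefficients. -/
lemma pd_affineFun_div [Nonempty (Slot d)] (b : Fin k → ℕ → ℝ) (hx : x ∈ G.U) (s : Slot d) :
    pd s (fun y => affineFun d b y / G.twist y) x =
      (slope b s x * G.twist x - affineFun d b x * slope G.twistCoeff s x) / G.twist x ^ 2 := by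
  rw [pd_div s (analyticAt_affineFun b x).differentiableAt (G.differentiableAt_twist x)
    (twist_ne hx), pd_affineFun, pd_twist]

lemma theta_eq [Nonempty (Slot d)] (hx : x ∈ G.U) (s a : Slot d) :
    G.theta x s a = (slope (G.frameCoeff a) s x * G.twist x -
      affineFun d (G.frameCoeff a) x * slope G.twistCoeff s x) / G.twist x ^ 2 := by
  rw [← pd_affineFun_div _ hx, theta]
  simp only [frame_eq]

lemma differentiableAt_momentum (h : productStructure d) (x : Slot d → ℝ) :
    DifferentiableAt ℝ (fun y => momentum d y (h : Tensors d)) x := by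
  obtain ⟨b, hb, -⟩ := exists_affineFun h.2
  rw [show (fun y => momentum d y (h : Tensors d)) = affineFun d b from funext hb]
  exact (analyticAt_affineFun _ x).differentiableAt

lemma slope_single_rootCoeff {i : Fin k} (q : Fin (d i)) (w : ℝ) (x : Slot d → ℝ) :
    slope (Pi.single i (rootCoeff (d i) w)) ⟨i, q⟩ x =
      ∏ r ∈ Finset.univ.erase q, (x ⟨i, r⟩ - w) := by
  have h1 : d i = (Finset.univ.erase q).card + 1 := by
    rw [Finset.card_erase_add_one (Finset.mem_univ q), Finset.card_univ, Fintype.card_fin]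
  have h2 : shift (rootCoeff (d i) w) = rootCoeff (Finset.univ.erase q).card w := by
    conv_lhs => rw [h1]
    rw [shift_rootCoeff]
  rw [slope, Pi.single_eq_same, h2, symAffine_rootCoeff]

lemma slope_single_of_ne {i : Fin k} (c : ℕ → ℝ) {s : Slot d} (h : s.1 ≠ i) (x : Slot d → ℝ) :
    slope (Pi.single i c) s x = 0 := by
  rw [slope, Pi.single_eq_of_ne h]
  exact symAffine_zero _ _

lemma affineFun_single_rootCoeff (i : Fin k) (w : ℝ) (x : Slot d → ℝ) :
    affineFun d (Pi.single i (rootCoeff (d i) w)) x = ∏ r, (x ⟨i, r⟩ - w) := by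
  rw [affineFun, Finset.sum_eq_single i (fun j _ hj => by simp [hj]) (by simp), Pi.single_eq_same]
  have := symAffine_rootCoeff w Finset.univ fun r : Fin (d i) => x ⟨i, r⟩
  rwa [Finset.card_univ, Fintype.card_fin] at this

/-- The 1-forms `θ_s` are linearly independent: the differentials of the functions `⟨μ, h⟩` at `x`
separate the coordinates, as `∏_r (y_{ir} - x_{iq})` shows. -/
lemma det_theta_ne [Nonempty (Slot d)] (hx : x ∈ G.U) :
    (Matrix.of fun s a => G.theta x s a).det ≠ 0 := by
  intro h0
  obtain ⟨v, hv, hv0⟩ := Matrix.exists_vecMul_eq_zero_iff.2 h0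
  refine hv (funext fun s₀ => ?_)
  have hL := twist_ne hx
  let F : Tensors d → (Slot d → ℝ) → ℝ := fun h y => momentum d y h
  -- `v` applied to the differential of `f / ⟨μ, β⟩`, up to the factor `⟨μ, β⟩²`
  let ζ : ((Slot d → ℝ) → ℝ) → ℝ := fun f =>
    ∑ s, v s * (pd s f x * G.twist x - f x * slope G.twistCoeff s x)
  have hβ : ζ (F G.β) = 0 := by
    refine Finset.sum_eq_zero fun s _ => ?_
    have : pd s (F G.β) x = slope G.twistCoeff s x := G.pd_twist s x
    rw [this]
    change v s * (_ - G.twist x * _) = 0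
    ring
  have hframe : ∀ a, ζ (F (G.frame a)) = 0 := by
    intro a
    have h1 : ∑ s, v s * G.theta x s a = 0 := congrFun hv0 a
    have h2 : ζ (F (G.frame a)) = (∑ s, v s * G.theta x s a) * G.twist x ^ 2 := by
      rw [Finset.sum_mul]
      refine Finset.sum_congr rfl fun s _ => ?_
      have h3 : F (G.frame a) = affineFun d (G.frameCoeff a) := funext (G.frame_eq a)
      rw [theta_eq hx, h3, pd_affineFun]
      field_simp
    rw [h2, h1, zero_mul]
  have hall : ∀ h ∈ productStructure d, ζ (F h) = 0 := by
    intro h hh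
    obtain ⟨c, hc⟩ := exists_eq_sum_of_linearIndependent G.frame_basis hh
    have h1 : F h = fun y => ∑ o : Option (Slot d),
        c o * F (o.elim G.β G.frame : productStructure d) y := by
      funext y
      simp only [F]
      rw [hc, map_sum]
      exact Finset.sum_congr rfl fun o _ => by rw [map_smul, smul_eq_mul]
    have h2 : ζ (F h) = ∑ o : Option (Slot d),
        c o * ζ (F (o.elim G.β G.frame : productStructure d)) := by
      have h3 : ∀ s, pd s (F h) x = ∑ o : Option (Slot d),
          c o * pd s (F (o.elim G.β G.frame : productStructure d)) x := by
        intro s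
        rw [h1, pd_sum _ _ fun o _ => (differentiableAt_momentum _ x).const_mul (c o)]
        exact Finset.sum_congr rfl fun o _ => pd_const_mul s _ (differentiableAt_momentum _ x)
      have h4 : F h x = ∑ o : Option (Slot d),
          c o * F (o.elim G.β G.frame : productStructure d) x := congrFun h1 x
      simp only [ζ, h3, h4, Finset.sum_mul, ← Finset.sum_sub_distrib, Finset.mul_sum]
      rw [Finset.sum_comm]
      exact Finset.sum_congr rfl fun o _ => Finset.sum_congr rfl fun s _ => by ring
    rw [h2]
    refine Finset.sum_eq_zero fun o _ => ?_
    rcases o with _ | a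
    · exact mul_eq_zero_of_right _ hβ
    · exact mul_eq_zero_of_right _ (hframe a)
  obtain ⟨i, q⟩ := s₀
  -- the product vanishes at `x`, and only its derivative with respect to `x_{iq}` does not
  obtain ⟨h, hh, hh'⟩ := exists_momentum_eq (d := d)
    (Pi.single i (rootCoeff (d i) (x ⟨i, q⟩)))
  have h1 := hall h hh
  have h2 : F h = affineFun d (Pi.single i (rootCoeff (d i) (x ⟨i, q⟩))) := funext hh'
  have h3 : affineFun d (Pi.single i (rootCoeff (d i) (x ⟨i, q⟩))) x = 0 := by
    rw [affineFun_single_rootCoeff]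
    exact Finset.prod_eq_zero (Finset.mem_univ q) (sub_self _)
  simp only [ζ, h2, h3, pd_affineFun, zero_mul, sub_zero] at h1
  rw [Finset.sum_eq_single ⟨i, q⟩] at h1
  · have h4 : slope (Pi.single i (rootCoeff (d i) (x ⟨i, q⟩))) ⟨i, q⟩ x ≠ 0 := by
      rw [slope_single_rootCoeff]
      refine Finset.prod_ne_zero_iff.2 fun r hr => ?_
      have := sub_ne_of_Delta_ne (Delta_ne hx ⟨i, q⟩) (Finset.ne_of_mem_erase hr)
      rw [← neg_sub]
      exact neg_ne_zero.2 this
    simpa [h4, hL] using h1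
  · rintro ⟨j, r⟩ _ hne
    by_cases hj : j = i
    · subst hj
      have hr : r ≠ q := fun h => hne (by rw [h])
      rw [slope_single_rootCoeff, Finset.prod_eq_zero
        (Finset.mem_erase.2 ⟨hr.symm, Finset.mem_univ q⟩) (sub_self _)]
      ring
    · rw [slope_single_of_ne _ hj]
      ring
  · simp

variable (G) in
/-- The logarithmic derivatives of the coefficients `A_s ⟨μ, β⟩ / Δ_s` of the metric. -/
def logDeriv (u s : Slot d) (x : Slot d → ℝ) : ℝ :=
  (if u = s then deriv (G.A s) (x s) / G.A s (x s) else 0) +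
    slope G.twistCoeff u x / G.twist x - dlogDelta u s x

lemma logDeriv_of_ne {u s : Slot d} (h : u ≠ s) :
    G.logDeriv u s = fun x => slope G.twistCoeff u x / G.twist x - dlogDelta u s x := by
  funext x
  simp [logDeriv, h]

lemma differentiableAt_coord_comp (hx : x ∈ G.U) (s : Slot d) :
    DifferentiableAt ℝ (fun y : Slot d → ℝ => G.A s (y s)) x :=
  DifferentiableAt.comp x (differentiableAt_A (mem_interval hx s)) (differentiableAt_apply s x)

lemma differentiableAt_coord_comp_deriv (hx : x ∈ G.U) (s : Slot d) :
    DifferentiableAt ℝ (fun y : Slot d → ℝ => deriv (G.A s) (y s)) x :=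
  DifferentiableAt.comp x (differentiableAt_deriv_A (mem_interval hx s))
    (differentiableAt_apply s x)

lemma differentiableAt_slope_div [Nonempty (Slot d)] (hx : x ∈ G.U) (s : Slot d) :
    DifferentiableAt ℝ (fun y => slope G.twistCoeff s y / G.twist y) x := by
  simp only [div_eq_mul_inv]
  exact (analyticAt_slope _ s x).differentiableAt.mul
    ((G.differentiableAt_twist x).fun_inv (twist_ne hx))

lemma pd_slope_div_of_ne [Nonempty (Slot d)] (hx : x ∈ G.U) (s : Slot d) :
    pd s (fun y => slope G.twistCoeff s y / G.twist y) x =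
      - (slope G.twistCoeff s x / G.twist x) ^ 2 := by
  rw [pd_div s (analyticAt_slope _ s x).differentiableAt (G.differentiableAt_twist x)
    (twist_ne hx), pd_slope_self, pd_twist]
  have := twist_ne hx
  field_simp
  ring

lemma pd_theta_self [Nonempty (Slot d)] (hx : x ∈ G.U) (s a : Slot d) :
    pd s (fun y => G.theta y s a) x =
      -2 * (slope G.twistCoeff s x / G.twist x) * G.theta x s a := by
  have hL := twist_ne hx
  have d1 := (analyticAt_affineFun (d := d) (G.frameCoeff a) x).differentiableAt
  have d2 := (analyticAt_slope (d := d) (G.frameCoeff a) s x).differentiableAt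
  have d3 := (analyticAt_slope (d := d) G.twistCoeff s x).differentiableAt
  have d4 := G.differentiableAt_twist x
  rw [theta_eq hx, pd_congr G.isOpen_U (fun y hy => theta_eq hy s a) hx s,
    pd_div s ((d2.fun_mul d4).fun_sub (d1.fun_mul d3)) (d4.fun_pow 2) (pow_ne_zero 2 hL),
    pd_sub s (d2.fun_mul d4) (d1.fun_mul d3), pd_mul s d2 d4, pd_mul s d1 d3, pd_affineFun,
    pd_slope_self, pd_slope_self, pd_twist]
  simp only [pow_two]
  rw [pd_mul s d4 d4, pd_twist]
  field_simp
  ring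

/-- The equation for the derivatives of `θ` required of a `SeparableFrame`. -/
lemma pd_theta_of_ne [Nonempty (Slot d)] (hx : x ∈ G.U) {u s : Slot d} (hus : u ≠ s)
    (a : Slot d) : pd u (fun y => G.theta y s a) x =
      -(G.logDeriv u s x) * G.theta x s a - G.logDeriv s u x * G.theta x u a := by
  have hL := twist_ne hx
  have d1 := (analyticAt_affineFun (d := d) (G.frameCoeff a) x).differentiableAt
  have d2 := (analyticAt_slope (d := d) (G.frameCoeff a) s x).differentiableAt
  have d3 := (analyticAt_slope (d := d) G.twistCoeff s x).differentiableAt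
  have d4 := G.differentiableAt_twist x
  rw [theta_eq hx, theta_eq hx, pd_congr G.isOpen_U (fun y hy => theta_eq hy s a) hx u,
    pd_div u ((d2.fun_mul d4).fun_sub (d1.fun_mul d3)) (d4.fun_pow 2) (pow_ne_zero 2 hL),
    pd_sub u (d2.fun_mul d4) (d1.fun_mul d3), pd_mul u d2 d4, pd_mul u d1 d3, pd_affineFun,
    pd_twist, logDeriv_of_ne hus, logDeriv_of_ne hus.symm]
  simp only [pow_two]
  rw [pd_mul u d4 d4, pd_twist]
  by_cases h : s.1 = u.1
  · obtain ⟨i, r⟩ := s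
    obtain ⟨j, q⟩ := u
    obtain rfl : i = j := h
    have hqr : q ≠ r := fun h => hus (by rw [h])
    have h1 := sub_ne_of_Delta_ne (Delta_ne hx ⟨i, r⟩) hqr
    have h2 : x ⟨i, q⟩ - x ⟨i, r⟩ ≠ 0 := by rw [← neg_sub]; exact neg_ne_zero.2 h1
    rw [pd_slope_same _ hqr, pd_slope_same _ hqr, dlogDelta_same hqr, dlogDelta_same hqr.symm]
    have e1 := slope_sub_slope (G.frameCoeff a) hqr x
    have e2 := slope_sub_slope G.twistCoeff hqr x
    have e3 : slope₂ (G.frameCoeff a) i r q x = (slope (G.frameCoeff a) ⟨i, r⟩ x -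
        slope (G.frameCoeff a) ⟨i, q⟩ x) / (x ⟨i, q⟩ - x ⟨i, r⟩) := by rw [e1]; field_simp
    have e4 : slope₂ G.twistCoeff i r q x = (slope G.twistCoeff ⟨i, r⟩ x -
        slope G.twistCoeff ⟨i, q⟩ x) / (x ⟨i, q⟩ - x ⟨i, r⟩) := by rw [e2]; field_simp
    have e5 : x ⟨i, r⟩ - x ⟨i, q⟩ = - (x ⟨i, q⟩ - x ⟨i, r⟩) := by ring
    rw [e3, e4, e5]
    generalize x ⟨i, q⟩ - x ⟨i, r⟩ = δ at h2 ⊢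
    field_simp
    ring
  · rw [pd_slope_of_ne _ h, pd_slope_of_ne _ h, dlogDelta_of_ne h, dlogDelta_of_ne (Ne.symm h)]
    field_simp
    ring

lemma differentiableAt_theta [Nonempty (Slot d)] (hx : x ∈ G.U) (s a : Slot d) :
    DifferentiableAt ℝ (fun y => G.theta y s a) x := by
  have h1 : DifferentiableAt ℝ (fun x => (slope (G.frameCoeff a) s x * G.twist x -
      affineFun d (G.frameCoeff a) x * slope G.twistCoeff s x) / G.twist x ^ 2) x := by
    have d1 := (analyticAt_affineFun (d := d) (G.frameCoeff a) x).differentiableAt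
    have d2 := (analyticAt_slope (d := d) (G.frameCoeff a) s x).differentiableAt
    have d3 := (analyticAt_slope (d := d) G.twistCoeff s x).differentiableAt
    have d4 := G.differentiableAt_twist x
    simp only [div_eq_mul_inv]
    exact ((d2.fun_mul d4).fun_sub (d1.fun_mul d3)).mul
      ((d4.fun_pow 2).fun_inv (pow_ne_zero 2 (twist_ne hx)))
  refine h1.congr_of_eventuallyEq ?_
  filter_upwards [G.isOpen_U.mem_nhds hx] with y hy using theta_eq hy s a

variable (G) in
/-- The separable Kähler geometry as a frame. -/
def toFrame [Nonempty (Slot d)] : SeparableFrame (Slot d) where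
  V := G.U
  isOpen_V := G.isOpen_U
  P s x := G.A s (x s) * G.twist x / Delta d x s
  θ s a x := G.theta x s a
  a := G.logDeriv
  l s x := slope G.twistCoeff s x / G.twist x
  P_ne x hx s := div_ne_zero (mul_ne_zero (A_ne hx s) (twist_ne hx)) (Delta_ne hx s)
  diff_P x hx s := by
    simp only [div_eq_mul_inv]
    exact ((differentiableAt_coord_comp hx s).fun_mul (G.differentiableAt_twist x)).mul
      ((differentiable_Delta s x).fun_inv (Delta_ne hx s))
  diff_θ x hx s a := differentiableAt_theta hx s a
  diff_a x hx u s := by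
    refine DifferentiableAt.fun_sub (DifferentiableAt.fun_add ?_ (differentiableAt_slope_div hx u))
      (differentiableAt_dlogDelta (Delta_ne hx s) u)
    split_ifs with h
    · simp only [div_eq_mul_inv]
      exact (differentiableAt_coord_comp_deriv hx s).mul
        ((differentiableAt_coord_comp hx s).fun_inv (A_ne hx s))
    · exact differentiableAt_const _
  diff_l x hx s := differentiableAt_slope_div hx s
  pd_P x hx u s := by
    have hA := A_ne hx s
    have hL := twist_ne hx
    have hΔ := Delta_ne hx s
    rw [pd_div u ((differentiableAt_coord_comp hx s).fun_mul (G.differentiableAt_twist x))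
      (differentiable_Delta s x) hΔ, pd_mul u (differentiableAt_coord_comp hx s)
      (G.differentiableAt_twist x), pd_Delta hΔ,
      pd_comp_coord u s (differentiableAt_A (mem_interval hx s)), pd_twist, logDeriv]
    split_ifs with h
    · field_simp
    · field_simp
      ring
  pd_θ_self x hx s a := pd_theta_self hx s a
  pd_θ x hx u s a hus := pd_theta_of_ne hx hus a
  pd_a x hx u s hus := by
    have hL := twist_ne hx
    rw [logDeriv_of_ne hus, pd_sub u (differentiableAt_slope_div hx u)
      (differentiableAt_dlogDelta (Delta_ne hx s) u), pd_slope_div_of_ne hx]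
    by_cases h : s.1 = u.1
    · obtain ⟨i, r⟩ := s
      obtain ⟨j, q⟩ := u
      obtain rfl : i = j := h
      have hqr : q ≠ r := fun h => hus (by rw [h])
      have h1 := sub_ne_of_Delta_ne (Delta_ne hx ⟨i, r⟩) hqr
      have hr : pd ⟨i, q⟩ (fun y : Slot d → ℝ => y ⟨i, r⟩ - y ⟨i, q⟩) x = -1 := by
        rw [pd_sub _ (by fun_prop) (by fun_prop), pd_coord, pd_coord]
        simp [hus]
      have h2 : dlogDelta ⟨i, q⟩ ⟨i, r⟩ = fun x : Slot d → ℝ => -1 / (x ⟨i, r⟩ - x ⟨i, q⟩) :=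
        funext fun y => dlogDelta_same hqr y
      rw [h2, pd_div _ (differentiableAt_const _) (by fun_prop) h1, hr, pd_const]
      dsimp only at h1 ⊢
      generalize x ⟨i, r⟩ - x ⟨i, q⟩ = δ at h1 ⊢
      field_simp
      ring
    · have h2 : dlogDelta u s = fun _ => 0 := funext fun y => dlogDelta_of_ne h y
      rw [h2, pd_const]
      ring
  det_ne x hx := det_theta_ne hx

end SeparableKahler

end SegreVeronese

namespace SegreVeronese

open ChartGeometry

variable {k : ℕ} {d : Fin k → ℕ}

/-! ### The extremality equation -/

lemma sum_erase_group {s : Slot d} {f : Slot d → ℝ} (hf : ∀ u, u.1 ≠ s.1 → f u = 0) :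
    ∑ u ∈ Finset.univ.erase s, f u = ∑ q ∈ Finset.univ.erase s.2, f ⟨s.1, q⟩ := by
  obtain ⟨i, r⟩ := s
  have h1 := Finset.add_sum_erase Finset.univ f (Finset.mem_univ (⟨i, r⟩ : Slot d))
  have h2 := Finset.add_sum_erase Finset.univ (fun q => f ⟨i, q⟩) (Finset.mem_univ r)
  have h3 : ∑ u, f u = ∑ q, f ⟨i, q⟩ := by
    rw [Fintype.sum_sigma, Finset.sum_eq_single i (fun j _ hj =>
      Finset.sum_eq_zero fun q _ => hf ⟨j, q⟩ hj) (by simp)]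
  dsimp only at h2 ⊢
  linarith

lemma card_slot : (Fintype.card (Slot d) : ℝ) = ((∑ i, d i : ℕ) : ℝ) := by
  rw [Fintype.card_sigma]
  simp

lemma sum_dlogDelta (s : Slot d) (x : Slot d → ℝ) :
    ∑ u ∈ Finset.univ.erase s, dlogDelta s u x = dlogDelta s s x := by
  rw [sum_erase_group fun u hu => dlogDelta_of_ne hu x, dlogDelta_self]
  obtain ⟨i, r⟩ := s
  refine Finset.sum_congr rfl fun q hq => ?_
  rw [dlogDelta_same (Finset.ne_of_mem_erase hq).symm, ← neg_sub (x ⟨i, r⟩), neg_div_neg_eq]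

namespace SeparableKahler

variable (G : SeparableKahler d)

/-- The contribution `⟨μ,β⟩^{m+3} ∂_s² (A_s / ⟨μ,β⟩^{m+1})` of the variable `x_s` to the scalar
curvature. -/
def density (s : Slot d) (x : Slot d → ℝ) : ℝ :=
  deriv (deriv (G.A s)) (x s) * G.twist x ^ 2 -
    2 * ((∑ i, d i : ℕ) + 1) * deriv (G.A s) (x s) * (G.twist x * slope G.twistCoeff s x) +
    ((∑ i, d i : ℕ) + 1) * ((∑ i, d i : ℕ) + 2) * G.A s (x s) * slope G.twistCoeff s x ^ 2

variable {G} {x : Slot d → ℝ}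

lemma sum_logDeriv [Nonempty (Slot d)] (s : Slot d) (x : Slot d → ℝ) :
    ∑ u ∈ Finset.univ.erase s, G.logDeriv s u x =
      ((∑ i, d i : ℕ) - 1) * (slope G.twistCoeff s x / G.twist x) - dlogDelta s s x := by
  have h1 : ∀ u ∈ Finset.univ.erase s, G.logDeriv s u x =
      slope G.twistCoeff s x / G.twist x - dlogDelta s u x := fun u hu => by
    rw [logDeriv_of_ne (Finset.ne_of_mem_erase hu).symm]
  rw [Finset.sum_congr rfl h1, Finset.sum_sub_distrib, sum_dlogDelta, Finset.sum_const,
    Finset.card_erase_of_mem (Finset.mem_univ s), Finset.card_univ, nsmul_eq_mul,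
    Nat.cast_sub Fintype.card_pos, card_slot, Nat.cast_one]

/-- The scalar curvature `-(∑_s D_s / Δ_s) / ⟨μ, β⟩`, where `D_s` is `density`. -/
lemma scalarCurvature_metric [Nonempty (Slot d)] {p : Slot d ⊕ Slot d → ℝ} (hp : base p ∈ G.U) :
    scalarCurvature G.toFrame.metric p =
      -(∑ s, G.density s (base p) / Delta d (base p) s) / G.twist (base p) := by
  rw [SeparableFrame.scalarCurvature_eq (F := G.toFrame) hp, neg_div, Finset.sum_div]
  congr 1
  refine Finset.sum_congr rfl fun s _ => ?_
  set x := base p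
  have hL := twist_ne hp
  have hA := A_ne hp s
  have hΔ := Delta_ne hp s
  have hh : ∀ y, G.toFrame.h s y = deriv (G.A s) (y s) / G.A s (y s) -
      ((∑ i, d i : ℕ) + 2) * (slope G.twistCoeff s y / G.twist y) := by
    intro y
    have h1 := sum_logDeriv (G := G) s y
    simp only [SeparableFrame.h, toFrame]
    rw [h1, logDeriv, if_pos rfl]
    ring
  have hj : G.toFrame.a s s x + G.toFrame.j s x = deriv (G.A s) (x s) / G.A s (x s) -
      (∑ i, d i : ℕ) * (slope G.twistCoeff s x / G.twist x) := by
    have h1 := sum_logDeriv (G := G) s x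
    simp only [SeparableFrame.j, toFrame]
    rw [h1, logDeriv, if_pos rfl]
    ring
  have d1 := differentiableAt_coord_comp hp s
  have d2 := differentiableAt_coord_comp_deriv hp s
  have d3 : DifferentiableAt ℝ (fun y : Slot d → ℝ => deriv (G.A s) (y s) / G.A s (y s)) x := by
    simp only [div_eq_mul_inv]
    exact d2.mul (d1.fun_inv hA)
  have d4 := differentiableAt_slope_div hp s
  have hpd : pd s (G.toFrame.h s) x =
      (deriv (deriv (G.A s)) (x s) * G.A s (x s) - deriv (G.A s) (x s) ^ 2) / G.A s (x s) ^ 2 +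
      ((∑ i, d i : ℕ) + 2) * (slope G.twistCoeff s x / G.twist x) ^ 2 := by
    rw [show G.toFrame.h s = _ from funext hh, pd_sub s d3 (d4.const_mul _),
      pd_div s d2 d1 hA, pd_const_mul s _ d4, pd_slope_div_of_ne hp,
      pd_comp_coord s s (differentiableAt_A (mem_interval hp s)),
      pd_comp_coord s s (differentiableAt_deriv_A (mem_interval hp s))]
    simp only [if_true]
    ring
  rw [hpd, hj, hh]
  have hP : G.toFrame.P s x = G.A s (x s) * G.twist x / Delta d x s := rfl
  rw [hP, density]
  field_simp
  ring

lemma differentiableAt_deriv_deriv_A {s : Slot d} {z : ℝ} (hz : z ∈ G.interval s) :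
    DifferentiableAt ℝ (deriv (deriv (G.A s))) z := by
  have h : ContDiffOn ℝ ∞ (deriv (deriv (G.A s))) (G.interval s) :=
    (contDiffOn_deriv_A s).deriv_of_isOpen (G.isOpen_interval s) (by simp)
  exact (h.contDiffAt ((G.isOpen_interval s).mem_nhds hz)).differentiableAt (by simp)

lemma differentiableAt_density (hx : x ∈ G.U) (s : Slot d) :
    DifferentiableAt ℝ (G.density s) x := by
  have d0 : DifferentiableAt ℝ (fun y : Slot d → ℝ => deriv (deriv (G.A s)) (y s)) x :=
    DifferentiableAt.comp x (differentiableAt_deriv_deriv_A (mem_interval hx s))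
      (differentiableAt_apply s x)
  have d1 := differentiableAt_coord_comp hx s
  have d2 := differentiableAt_coord_comp_deriv hx s
  have d3 := (analyticAt_slope (d := d) G.twistCoeff s x).differentiableAt
  have d4 := G.differentiableAt_twist x
  unfold density
  fun_prop

variable (G) in
/-- The geometry is extremal if and only if `⟨μ, β⟩ Scal` is of the form `⟨μ, h⟩`. -/
theorem isExtremal_iff [Nonempty (Slot d)] :
    G.IsExtremal ↔ ∃ b : Fin k → ℕ → ℝ, ∀ x ∈ G.U,
      ∑ s, G.density s x / Delta d x s = affineFun d b x := by
  let S : (Slot d → ℝ) → ℝ := fun x => -(∑ s, G.density s x / Delta d x s) / G.twist x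
  have hmetric : G.metric = G.toFrame.metric := by
    funext p
    simp only [metric, SeparableFrame.metric, toFrame, inv_div]
    rfl
  have hSd : ∀ x ∈ G.U, DifferentiableAt ℝ S x := by
    intro x hx
    simp only [S, div_eq_mul_inv]
    exact (DifferentiableAt.fun_sum fun s _ => (differentiableAt_density hx s).mul
      ((differentiable_Delta s x).fun_inv (Delta_ne hx s))).fun_neg.mul
      ((G.differentiableAt_twist x).fun_inv (twist_ne hx))
  have hkill := SeparableFrame.isKillingPotential_iff (F := G.toFrame) G.isConnected_U hSd
    fun p hp => scalarCurvature_metric hp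
  have hdq : ∀ a, ∀ x ∈ G.U, DifferentiableAt ℝ
      (fun y => momentum d y (G.frame a : Tensors d) / G.twist y) x := by
    intro a x hx
    simp only [div_eq_mul_inv]
    exact (differentiableAt_momentum _ x).mul ((G.differentiableAt_twist x).fun_inv (twist_ne hx))
  have hsum : ∀ (c : Slot d → ℝ), ∀ x ∈ G.U, ∀ s,
      pd s (fun y => ∑ a, c a * (momentum d y (G.frame a : Tensors d) / G.twist y)) x =
        ∑ a, G.theta x s a * c a := by
    intro c x hx s
    rw [pd_sum _ _ fun a _ => (hdq a x hx).const_mul (c a)]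
    exact Finset.sum_congr rfl fun a _ => by rw [pd_const_mul s _ (hdq a x hx), mul_comm]; rfl
  rw [IsExtremal, hmetric]
  refine Iff.trans hkill ⟨?_, ?_⟩
  · rintro ⟨c, hc⟩
    have hd : ∀ x ∈ G.U, DifferentiableAt ℝ (fun y =>
        ∑ a, c a * (momentum d y (G.frame a : Tensors d) / G.twist y)) x := fun x hx =>
      DifferentiableAt.fun_sum fun a _ => (hdq a x hx).const_mul (c a)
    obtain ⟨c₀, hc₀⟩ := G.isOpen_U.exists_is_const_of_fderiv_eq_zero
      G.isConnected_U.isPreconnected (f := fun x => S x -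
        ∑ a, c a * (momentum d x (G.frame a : Tensors d) / G.twist x))
      (fun x hx => ((hSd x hx).fun_sub (hd x hx)).differentiableWithinAt)
      fun x hx => fderiv_eq_zero_of_pd fun s => by
        rw [pd_sub s (hSd x hx) (hd x hx), hc x hx, hsum c x hx]
        exact sub_self _
    obtain ⟨b, hb, -⟩ := exists_affineFun (d := d)
      (h := -(c₀ • (G.β : Tensors d) + ∑ a, c a • (G.frame a : Tensors d)))
      ((productStructure d).neg_mem ((productStructure d).add_mem
        ((productStructure d).smul_mem _ G.β.2)
        ((productStructure d).sum_mem fun a _ => (productStructure d).smul_mem _ (G.frame a).2)))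
    refine ⟨b, fun x hx => ?_⟩
    have h1 := hc₀ x hx
    have hL := twist_ne hx
    have h2 : ∑ a, c a * (momentum d x (G.frame a : Tensors d) / G.twist x) =
        (∑ a, c a * momentum d x (G.frame a : Tensors d)) / G.twist x := by
      rw [Finset.sum_div]
      exact Finset.sum_congr rfl fun a _ => by ring
    simp only [S, h2] at h1
    rw [← hb, map_neg, map_add, map_smul, map_sum]
    simp only [map_smul, smul_eq_mul]
    change _ = -(c₀ * G.twist x + _)
    field_simp at h1
    linarith
  · rintro ⟨b, hb⟩
    obtain ⟨h, hh, hh'⟩ := exists_momentum_eq (d := d) b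
    obtain ⟨c, hc⟩ := exists_eq_sum_of_linearIndependent G.frame_basis hh
    refine ⟨fun a => -c (some a), fun x hx s => ?_⟩
    have hS : ∀ y ∈ G.U, S y = -c none +
        ∑ a, (-c (some a)) * (momentum d y (G.frame a : Tensors d) / G.twist y) := by
      intro y hy
      have hL := twist_ne hy
      have h1 : affineFun d b y = c none * G.twist y +
          ∑ a, c (some a) * momentum d y (G.frame a : Tensors d) := by
        rw [← hh', hc, map_sum, Fintype.sum_option]
        simp only [map_smul, smul_eq_mul]
        rfl
      simp only [S]
      rw [hb y hy, h1]
      have h2 : ∑ a, (-c (some a)) * (momentum d y (G.frame a : Tensors d) / G.twist y) =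
          -(∑ a, c (some a) * momentum d y (G.frame a : Tensors d)) / G.twist y := by
        rw [← Finset.sum_neg_distrib, Finset.sum_div]
        exact Finset.sum_congr rfl fun a _ => by ring
      rw [h2]
      field_simp
      ring
    rw [pd_congr G.isOpen_U hS hx s, pd_add s (differentiableAt_const _)
      (DifferentiableAt.fun_sum fun a _ => (hdq a x hx).const_mul _), pd_const, zero_add,
      hsum (fun a => -c (some a)) x hx]
    rfl

end SeparableKahler

end SegreVeronese

namespace SegreVeronese

/-! ### Lagrange summation over the coordinates of one group -/

section Lagrange

open Polynomial

variable {n : ℕ} {y : Fin n → ℝ}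

lemma sum_eval_div (hy : Function.Injective y) {f : ℝ[X]} (hf : f.degree < n) :
    ∑ r, f.eval (y r) / ∏ q ∈ Finset.univ.erase r, (y r - y q) = f.coeff (n - 1) := by
  have h := Lagrange.coeff_eq_sum (s := Finset.univ) (v := y) hy.injOn (by simpa using hf)
  rw [Finset.card_univ, Fintype.card_fin] at h
  exact h.symm

lemma sum_eval_mul_prod_div_of_degree_lt (hy : Function.Injective y) {f : ℝ[X]}
    (hf : f.degree < n) (w : ℝ) :
    ∑ r, f.eval (y r) * (∏ q ∈ Finset.univ.erase r, (y q - w)) /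
      ∏ q ∈ Finset.univ.erase r, (y r - y q) = (-1) ^ (n - 1) * f.eval w := by
  conv_rhs => rw [Lagrange.eq_interpolate (s := Finset.univ) (v := y) (f := f) hy.injOn
    (by simpa using hf)]
  rw [Lagrange.interpolate_apply, eval_finsetSum, Finset.mul_sum]
  refine Finset.sum_congr rfl fun r _ => ?_
  rw [eval_mul, eval_C, Lagrange.basis, eval_prod, mul_div_assoc, mul_left_comm]
  congr 1
  simp only [Lagrange.basisDivisor, eval_mul, eval_C, eval_sub, eval_X, Finset.prod_mul_distrib,
    Finset.prod_inv_distrib]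
  have h : ∏ q ∈ Finset.univ.erase r, (y q - w) =
      (-1) ^ (n - 1) * ∏ q ∈ Finset.univ.erase r, (w - y q) := by
    rw [show (n - 1) = (Finset.univ.erase r).card by simp, ← Finset.prod_const,
      ← Finset.prod_mul_distrib]
    exact Finset.prod_congr rfl fun q _ => by ring
  rw [h]
  ring

lemma sum_eval_mul_prod_div (hy : Function.Injective y) {f : ℝ[X]} {c₀ c₁ : ℝ}
    (hf : (f - (C c₁ * X + C c₀) * Lagrange.nodal Finset.univ y).degree < (n : WithBot ℕ)) (w : ℝ) :
    ∑ r, f.eval (y r) * (∏ q ∈ Finset.univ.erase r, (y q - w)) /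
      ∏ q ∈ Finset.univ.erase r, (y r - y q) =
    (-1) ^ (n - 1) * f.eval w - (-1) ^ (n - 1) * (-1) ^ n * (c₁ * w + c₀) * ∏ q, (y q - w) := by
  have h := sum_eval_mul_prod_div_of_degree_lt hy hf w
  have h1 : ∀ r, (f - (C c₁ * X + C c₀) * Lagrange.nodal Finset.univ y).eval (y r) =
      f.eval (y r) := fun r => by
    rw [eval_sub, eval_mul, Lagrange.eval_nodal_at_node (Finset.mem_univ r), mul_zero, sub_zero]
  have h2 : ∏ q, (w - y q) = (-1) ^ n * ∏ q, (y q - w) := by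
    rw [show (-1 : ℝ) ^ n = ∏ _q : Fin n, (-1) by simp, ← Finset.prod_mul_distrib]
    exact Finset.prod_congr rfl fun q _ => by ring
  simp only [h1] at h
  rw [h, eval_sub, eval_mul, Lagrange.eval_nodal, h2]
  simp only [eval_add, eval_mul, eval_C, eval_X]
  ring

lemma neg_one_pow_pred_mul {n : ℕ} (hn : 0 < n) : (-1 : ℝ) ^ (n - 1) * (-1) ^ n = -1 := by
  obtain ⟨n, rfl⟩ := Nat.exists_eq_succ_of_ne_zero hn.ne'
  rw [Nat.succ_sub_one, pow_succ, ← mul_assoc, ← mul_pow]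
  simp

/-- Subtracting a multiple of the nodal polynomial lowers the degree below the number of nodes
without changing the values at the nodes. -/
lemma degree_sub_mul_nodal_lt (hn : 0 < n) (y : Fin n → ℝ) {f : ℝ[X]}
    (hf : f.natDegree ≤ n + 1) :
    (f - (C (f.coeff (n + 1)) * X +
      C (f.coeff n - f.coeff (n + 1) * (Lagrange.nodal Finset.univ y).coeff (n - 1))) *
        Lagrange.nodal Finset.univ y).degree < (n : WithBot ℕ) := by
  set p := Lagrange.nodal Finset.univ y with hp
  have hpn : p.natDegree = n := by rw [hp, Lagrange.natDegree_nodal]; simp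
  have hp1 : p.coeff n = 1 := by
    have : p.Monic := Lagrange.nodal_monic
    rw [Monic, leadingCoeff, hpn] at this
    exact this
  rw [degree_lt_iff_coeff_zero]
  intro m hm
  obtain ⟨m, rfl⟩ := Nat.exists_eq_succ_of_ne_zero (show m ≠ 0 by omega)
  rw [coeff_sub, add_mul, coeff_add, mul_assoc, coeff_C_mul, coeff_C_mul, coeff_X_mul]
  rcases Nat.lt_trichotomy (m + 1) (n + 1) with h | h | h
  · have h' : n = m + 1 := by omega
    subst h'
    simp only [Nat.add_sub_cancel, Nat.succ_eq_add_one, hp1]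
    ring
  · have h' : n = m := by omega
    subst h'
    have h0 : p.coeff (n + 1) = 0 := coeff_eq_zero_of_natDegree_lt (by omega)
    simp only [Nat.succ_eq_add_one, hp1, h0]
    ring
  · have h0 : p.coeff (m + 1) = 0 := coeff_eq_zero_of_natDegree_lt (by omega)
    have h1 : p.coeff m = 0 := coeff_eq_zero_of_natDegree_lt (by omega)
    have h2 : f.coeff (m + 1) = 0 := coeff_eq_zero_of_natDegree_lt (by omega)
    simp only [Nat.succ_eq_add_one, h0, h1, h2]
    ring

/-- A polynomial of degree at most `n` has divided difference `f_{n-1} + f_n σ₁` at `n` nodes. -/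
lemma sum_eval_div_of_natDegree_le (hn : 0 < n) (hy : Function.Injective y) {f : ℝ[X]}
    (hf : f.natDegree ≤ n) :
    ∑ r, f.eval (y r) / ∏ q ∈ Finset.univ.erase r, (y r - y q) =
      f.coeff (n - 1) + f.coeff n * ∑ r, y r := by
  have h0 : f.coeff (n + 1) = 0 := coeff_eq_zero_of_natDegree_lt (by omega)
  have h := degree_sub_mul_nodal_lt hn y (f := f) (by omega)
  simp only [h0, C_0, zero_mul, zero_add, sub_zero] at h
  have h1 : ∀ r, (f - C (f.coeff n) * Lagrange.nodal Finset.univ y).eval (y r) =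
      f.eval (y r) := fun r => by
    rw [eval_sub, eval_mul, Lagrange.eval_nodal_at_node (Finset.mem_univ r), mul_zero, sub_zero]
  have h2 := sum_eval_div hy h
  simp only [h1] at h2
  have h3 : (Lagrange.nodal Finset.univ y).coeff (n - 1) = -∑ r, y r := by
    have := prod_X_sub_C_coeff_card_pred Finset.univ y (by simpa using hn)
    simpa [Lagrange.nodal] using this
  rw [h2, coeff_sub, coeff_C_mul, h3]
  ring

/-- Two symmetric multi-affine functions and their partial derivatives, written in terms of the
products `∏_r (y_r - w_l)`. -/
lemma exists_symAffine_eq_sum_prod (b : ℕ → ℝ) {w : Fin (n + 1) → ℝ}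
    (hw : Function.Injective w) :
    ∃ c : Fin (n + 1) → ℝ, (∀ y : Fin n → ℝ, symAffine b Finset.univ y =
      ∑ l, c l * ∏ q, (y q - w l)) ∧
      ∀ (y : Fin n → ℝ) (r : Fin n), symAffine (shift b) (Finset.univ.erase r) y =
        ∑ l, c l * ∏ q ∈ Finset.univ.erase r, (y q - w l) := by
  obtain ⟨c, hc⟩ := exists_rootCoeff_combination n b hw
  refine ⟨c, fun y => ?_, fun y r => ?_⟩
  · rw [symAffine_congr (b' := fun j => ∑ l, (c l • rootCoeff n (w l)) j) (y' := y)
      (fun j hj => hc j (by simpa using hj)) (fun _ _ => rfl), symAffine_sum]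
    refine Finset.sum_congr rfl fun l _ => ?_
    rw [symAffine_smul, ← symAffine_rootCoeff]
    simp
  · have hn : 0 < n := r.pos
    have hcard : (Finset.univ.erase r).card = n - 1 := by simp
    rw [symAffine_congr (b' := fun j => ∑ l, (c l • rootCoeff (n - 1) (w l)) j) (y' := y)
      (fun j hj => ?_) (fun _ _ => rfl), symAffine_sum]
    · refine Finset.sum_congr rfl fun l _ => ?_
      rw [symAffine_smul, ← symAffine_rootCoeff, hcard]
    · rw [hcard] at hj
      rw [shift, hc (j + 1) (by omega)]
      refine Finset.sum_congr rfl fun l _ => ?_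
      simp only [rootCoeff, Pi.smul_apply, smul_eq_mul]
      rw [Nat.sub_sub, add_comm 1 j]

/-- The first moment of the partial derivatives of a symmetric multi-affine function. -/
lemma exists_sum_eval_mul_slope_div (hn : 0 < n) {f : ℝ[X]} (hf : f.natDegree ≤ n) (b : ℕ → ℝ) :
    ∃ e : ℝ, ∀ y : Fin n → ℝ, Function.Injective y →
      ∑ r, f.eval (y r) * symAffine (shift b) (Finset.univ.erase r) y /
        ∏ q ∈ Finset.univ.erase r, (y r - y q) = f.coeff n * symAffine b Finset.univ y + e := by
  obtain ⟨c, hc, hc'⟩ := exists_symAffine_eq_sum_prod (n := n) b (w := fun l => (l : ℝ))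
    (fun l l' h => Fin.ext (Nat.cast_injective h))
  refine ⟨∑ l, c l * ((-1) ^ (n - 1) * f.eval (l : ℝ)), fun y hy => ?_⟩
  have h0 : f.coeff (n + 1) = 0 := coeff_eq_zero_of_natDegree_lt (by omega)
  have h := degree_sub_mul_nodal_lt hn y (f := f) (by omega)
  simp only [hc, hc', Finset.mul_sum, Finset.sum_div]
  rw [Finset.sum_comm, ← Finset.sum_add_distrib]
  refine Finset.sum_congr rfl fun l _ => ?_
  have := sum_eval_mul_prod_div hy h (l : ℝ)
  rw [neg_one_pow_pred_mul hn, h0] at this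
  calc _ = c l * ∑ r, f.eval (y r) * (∏ q ∈ Finset.univ.erase r, (y q - (l : ℝ))) /
      ∏ q ∈ Finset.univ.erase r, (y r - y q) := by
        rw [Finset.mul_sum]
        exact Finset.sum_congr rfl fun r _ => by ring
    _ = _ := by rw [this]; ring

lemma exists_sum_eval_mul_prod_mul_prod_div (hn : 0 < n) {f : ℝ[X]} (hf : f.natDegree ≤ n + 1)
    {v w : ℝ} (hvw : v ≠ w) (y : Fin n → ℝ) (hy : Function.Injective y) :
      ∑ r, f.eval (y r) * ((∏ q ∈ Finset.univ.erase r, (y q - w)) *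
        ∏ q ∈ Finset.univ.erase r, (y q - v)) / ∏ q ∈ Finset.univ.erase r, (y r - y q) =
      f.coeff (n + 1) * ((∏ q, (y q - w)) * ∏ q, (y q - v)) +
        (-1) ^ (n - 1) / (v - w) * (f.eval v * ∏ q, (y q - w) - f.eval w * ∏ q, (y q - v)) := by
  have h := degree_sub_mul_nodal_lt hn y hf
  have h1 := sum_eval_mul_prod_div hy h w
  have h2 := sum_eval_mul_prod_div hy h v
  rw [neg_one_pow_pred_mul hn] at h1 h2
  have hsub : v - w ≠ 0 := sub_ne_zero.2 hvw
  have key : ∀ r, f.eval (y r) * ((∏ q ∈ Finset.univ.erase r, (y q - w)) *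
        ∏ q ∈ Finset.univ.erase r, (y q - v)) / ∏ q ∈ Finset.univ.erase r, (y r - y q) =
      1 / (v - w) * ((∏ q, (y q - w)) * (f.eval (y r) * (∏ q ∈ Finset.univ.erase r, (y q - v)) /
        ∏ q ∈ Finset.univ.erase r, (y r - y q)) - (∏ q, (y q - v)) *
        (f.eval (y r) * (∏ q ∈ Finset.univ.erase r, (y q - w)) /
        ∏ q ∈ Finset.univ.erase r, (y r - y q))) := by
    intro r
    rw [← Finset.mul_prod_erase Finset.univ (fun q => y q - w) (Finset.mem_univ r),
      ← Finset.mul_prod_erase Finset.univ (fun q => y q - v) (Finset.mem_univ r)]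
    field_simp
    ring
  rw [Finset.sum_congr rfl fun r _ => key r, ← Finset.mul_sum, Finset.sum_sub_distrib,
    ← Finset.mul_sum, ← Finset.mul_sum, h1, h2]
  field_simp
  ring

/-- The second moment of the partial derivatives of a symmetric multi-affine function. -/
lemma exists_sum_eval_mul_slope_sq_div (hn : 0 < n) {f : ℝ[X]} (hf : f.natDegree ≤ n + 1)
    (b : ℕ → ℝ) :
    ∃ b' : ℕ → ℝ, ∀ y : Fin n → ℝ, Function.Injective y →
      ∑ r, f.eval (y r) * symAffine (shift b) (Finset.univ.erase r) y ^ 2 /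
        ∏ q ∈ Finset.univ.erase r, (y r - y q) =
      f.coeff (n + 1) * symAffine b Finset.univ y ^ 2 + symAffine b' Finset.univ y := by
  -- two disjoint sets of roots, so that the bilinear identity applies to every pair
  obtain ⟨c, hc, hc'⟩ := exists_symAffine_eq_sum_prod (n := n) b (w := fun l => (l : ℝ))
    (fun l l' h => Fin.ext (Nat.cast_injective h))
  obtain ⟨e, he, he'⟩ := exists_symAffine_eq_sum_prod (n := n) b (w := fun l => (n + 1 + l : ℝ))
    (fun l l' h => Fin.ext (Nat.cast_injective (add_left_cancel h)))
  have hne : ∀ l l' : Fin (n + 1), (n + 1 + l' : ℝ) ≠ l := by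
    intro l l' h
    have : n + 1 + (l' : ℕ) = l := by exact_mod_cast h
    omega
  refine ⟨fun j => ∑ l, ∑ l', ((c l * e l' * ((-1) ^ (n - 1) / ((n + 1 + l' : ℝ) - l))) •
      (f.eval (n + 1 + l' : ℝ) • rootCoeff n l + (-f.eval (l : ℝ)) • rootCoeff n (n + 1 + l'))) j,
    fun y hy => ?_⟩
  have hroot : ∀ w, symAffine (rootCoeff n w) Finset.univ y = ∏ q, (y q - w) := fun w => by
    rw [← symAffine_rootCoeff]; simp
  have hb' := symAffine_sum Finset.univ (fun l j => ∑ l', ((c l * e l' *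
    ((-1) ^ (n - 1) / ((n + 1 + l' : ℝ) - l))) • (f.eval (n + 1 + l' : ℝ) • rootCoeff n l +
      (-f.eval (l : ℝ)) • rootCoeff n (n + 1 + l'))) j) Finset.univ y
  rw [hb']
  simp only [symAffine_sum, symAffine_smul, symAffine_add, hroot]
  have h1 : ∀ r, f.eval (y r) * symAffine (shift b) (Finset.univ.erase r) y ^ 2 /
      ∏ q ∈ Finset.univ.erase r, (y r - y q) = ∑ l : Fin (n + 1), ∑ l' : Fin (n + 1),
        c l * e l' * (f.eval (y r) * ((∏ q ∈ Finset.univ.erase r, (y q - (l : ℝ))) *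
          ∏ q ∈ Finset.univ.erase r, (y q - (n + 1 + l' : ℝ))) /
            ∏ q ∈ Finset.univ.erase r, (y r - y q)) := by
    intro r
    rw [sq]
    nth_rewrite 1 [hc' y r]
    rw [he' y r, Finset.sum_mul_sum, Finset.mul_sum, Finset.sum_div]
    refine Finset.sum_congr rfl fun l _ => ?_
    rw [Finset.mul_sum, Finset.sum_div]
    exact Finset.sum_congr rfl fun l' _ => by ring
  have h2 : symAffine b Finset.univ y ^ 2 = ∑ l : Fin (n + 1), ∑ l' : Fin (n + 1),
      c l * e l' * ((∏ q, (y q - (l : ℝ))) * ∏ q, (y q - (n + 1 + l' : ℝ))) := by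
    rw [sq]
    nth_rewrite 1 [hc y]
    rw [he y, Finset.sum_mul_sum]
    exact Finset.sum_congr rfl fun l _ => Finset.sum_congr rfl fun l' _ => by ring
  rw [Finset.sum_congr rfl fun r _ => h1 r, Finset.sum_comm, h2, Finset.mul_sum,
    ← Finset.sum_add_distrib]
  refine Finset.sum_congr rfl fun l _ => ?_
  rw [Finset.sum_comm, Finset.mul_sum, ← Finset.sum_add_distrib]
  refine Finset.sum_congr rfl fun l' _ => ?_
  rw [← Finset.mul_sum, exists_sum_eval_mul_prod_mul_prod_div hn hf (hne l l') y hy]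
  ring

end Lagrange

end SegreVeronese

namespace SegreVeronese

/-! ### Slices of the equation in one group of coordinates -/

section Group

open Polynomial

variable {n : ℕ}

/-- The summand `α(y_r) L² + β(y_r) L ∂_rL + γ(y_r) (∂_rL)²`, for `L = ∑_j b_j σ_j`. -/
def quadTerm (b : ℕ → ℝ) (α β γ : ℝ → ℝ) (r : Fin n) (y : Fin n → ℝ) : ℝ :=
  α (y r) * symAffine b Finset.univ y ^ 2 +
    β (y r) * (symAffine b Finset.univ y * symAffine (shift b) (Finset.univ.erase r) y) +
    γ (y r) * symAffine (shift b) (Finset.univ.erase r) y ^ 2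

lemma symAffine_update_self {b : ℕ → ℝ} {R : Finset (Fin n)} {r : Fin n} (hr : r ∈ R)
    (y : Fin n → ℝ) (z : ℝ) : symAffine b R (Function.update y r z) =
      symAffine b (R.erase r) y + z * symAffine (shift b) (R.erase r) y := by
  have h : ∀ b : ℕ → ℝ, symAffine b (R.erase r) (Function.update y r z) =
      symAffine b (R.erase r) y := fun b => symAffine_congr (fun _ _ => rfl)
    fun q hq => Function.update_of_ne (Finset.ne_of_mem_erase hq) _ _
  rw [symAffine_erase b hr, h, h, Function.update_self]

lemma symAffine_update_of_notMem {b : ℕ → ℝ} {R : Finset (Fin n)} {r : Fin n} (hr : r ∉ R)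
    (y : Fin n → ℝ) (z : ℝ) : symAffine b R (Function.update y r z) = symAffine b R y :=
  symAffine_congr (fun _ _ => rfl) fun _ hq =>
    Function.update_of_ne (ne_of_mem_of_not_mem hq hr) _ _

/-- Restriction of a symmetric multi-affine function to a line parallel to the `r`-axis. -/
def slice (b : ℕ → ℝ) (R : Finset (Fin n)) (r : Fin n) (y : Fin n → ℝ) : ℝ[X] :=
  C (symAffine b (R.erase r) y) + X * C (symAffine (shift b) (R.erase r) y)

lemma eval_slice {b : ℕ → ℝ} {R : Finset (Fin n)} {r : Fin n} (hr : r ∈ R) (y : Fin n → ℝ)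
    (z : ℝ) : (slice b R r y).eval z = symAffine b R (Function.update y r z) := by
  rw [slice, symAffine_update_self hr, eval_add, eval_mul, eval_C, eval_C, eval_X]

lemma natDegree_slice_le (b : ℕ → ℝ) (R : Finset (Fin n)) (r : Fin n) (y : Fin n → ℝ) :
    (slice b R r y).natDegree ≤ 1 := by
  rw [slice]; compute_degree

lemma coeff_slice_one (b : ℕ → ℝ) (R : Finset (Fin n)) (r : Fin n) (y : Fin n → ℝ) :
    (slice b R r y).coeff 1 = symAffine (shift b) (R.erase r) y := by
  simp [slice, coeff_C]

/-- If `∑_q E_q / Δ_q + a L²` is symmetric multi-affine, then, as a function of `y_r`, the summand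
`E_r` is a polynomial of degree at most `n + 1`, whose leading coefficient is determined by `a` and
whose value at `y_q` is `E_q`. -/
lemma exists_slice_polynomial (b b' : ℕ → ℝ) (a : ℝ) (α β γ : Fin n → ℝ → ℝ) (r : Fin n)
    (y : Fin n → ℝ) (hy : Function.Injective y) {Z : Set ℝ}
    (hZ : ∀ z ∈ Z, ∀ q ≠ r, z ≠ y q)
    (h : ∀ z ∈ Z, ∑ q, quadTerm b (α q) (β q) (γ q) q (Function.update y r z) /
        ∏ p ∈ Finset.univ.erase q, (Function.update y r z q - Function.update y r z p) +
      a * symAffine b Finset.univ (Function.update y r z) ^ 2 =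
        symAffine b' Finset.univ (Function.update y r z)) :
    ∃ Q : ℝ[X], Q.natDegree ≤ n + 1 ∧
      Q.coeff (n + 1) = -a * symAffine (shift b) (Finset.univ.erase r) y ^ 2 ∧
      (∀ z ∈ Z, quadTerm b (α r) (β r) (γ r) r (Function.update y r z) = Q.eval z) ∧
      ∀ q ≠ r, Q.eval (y q) = quadTerm b (α q) (β q) (γ q) q (Function.update y r (y q)) := by
  classical
  have hn : 0 < n := r.pos
  set L := slice b Finset.univ r y with hL
  let E : Fin n → ℝ[X] := fun q => C (α q (y q)) * L ^ 2 +
    C (β q (y q)) * (L * slice (shift b) (Finset.univ.erase q) r y) +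
    C (γ q (y q)) * slice (shift b) (Finset.univ.erase q) r y ^ 2
  let Pq : Fin n → ℝ[X] := fun q => ∏ p ∈ (Finset.univ.erase r).erase q, (X - C (y p))
  let c : Fin n → ℝ := fun q => ∏ p ∈ (Finset.univ.erase r).erase q, (y q - y p)
  let P : ℝ[X] := ∏ p ∈ Finset.univ.erase r, (X - C (y p))
  have hE : ∀ q ≠ r, ∀ z, (E q).eval z =
      quadTerm b (α q) (β q) (γ q) q (Function.update y r z) := by
    intro q hq z
    simp only [E, quadTerm, eval_add, eval_mul, eval_C, eval_pow, hL,
      eval_slice (Finset.mem_univ r),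
      eval_slice (Finset.mem_erase.2 ⟨hq.symm, Finset.mem_univ r⟩), Function.update_of_ne hq]
  have hc : ∀ q, c q ≠ 0 := fun q => Finset.prod_ne_zero_iff.2 fun p hp =>
    sub_ne_zero.2 fun h' => Finset.ne_of_mem_erase hp (hy h').symm
  have hLd : L.natDegree ≤ 1 := natDegree_slice_le b Finset.univ r y
  have hPd : P.natDegree = n - 1 := by
    simp only [P]
    rw [natDegree_prod_of_monic _ _ fun p _ => monic_X_sub_C _]
    simp
  have hP1 : P.coeff (n - 1) = 1 := by
    have : P.Monic := monic_prod_of_monic _ _ fun p _ => monic_X_sub_C _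
    rw [Monic, leadingCoeff, hPd] at this
    exact this
  have hEd : ∀ q, (E q).natDegree ≤ 2 := by
    intro q
    have h1 := natDegree_slice_le (shift b) (Finset.univ.erase q) r y
    simp only [E]
    refine natDegree_add_le_of_degree_le (natDegree_add_le_of_degree_le ?_ ?_) ?_
    · exact (natDegree_C_mul_le _ _).trans (natDegree_pow_le.trans (by omega))
    · exact (natDegree_C_mul_le _ _).trans (natDegree_mul_le.trans (by omega))
    · exact (natDegree_C_mul_le _ _).trans (natDegree_pow_le.trans (by omega))
  have hPqd : ∀ q ≠ r, (Pq q).natDegree + 2 ≤ n := by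
    intro q hq
    have hqr : q ∈ Finset.univ.erase r := Finset.mem_erase.2 ⟨hq, Finset.mem_univ q⟩
    have := Finset.card_pos.2 ⟨q, hqr⟩
    simp only [Pq]
    rw [natDegree_prod_of_monic _ _ fun p _ => monic_X_sub_C _]
    simp only [natDegree_X_sub_C, Finset.sum_const, smul_eq_mul, mul_one,
      Finset.card_erase_of_mem hqr]
    rw [Finset.card_erase_of_mem (Finset.mem_univ r)] at this ⊢
    simp only [Finset.card_univ, Fintype.card_fin] at this ⊢
    omega
  -- the terms of the other coordinates, multiplied by the denominator `P` of the term of `y_r`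
  let T : ℝ[X] := ∑ q ∈ Finset.univ.erase r, C (c q)⁻¹ * (E q * Pq q)
  have hTd : T.natDegree ≤ n := natDegree_sum_le_of_forall_le _ _ fun q hq =>
    (natDegree_C_mul_le _ _).trans (natDegree_mul_le.trans
      (by have := hEd q; have := hPqd q (Finset.ne_of_mem_erase hq); omega))
  have hSd : (slice b' Finset.univ r y * P).natDegree ≤ n :=
    natDegree_mul_le.trans (by have := natDegree_slice_le b' Finset.univ r y; omega)
  have hL2 : (L ^ 2).natDegree ≤ 2 := natDegree_pow_le.trans (by omega)
  have hMd : (L ^ 2 * P).natDegree ≤ n + 1 := natDegree_mul_le.trans (by omega)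
  refine ⟨slice b' Finset.univ r y * P - C a * (L ^ 2 * P) + T, ?_, ?_, ?_, ?_⟩
  · exact natDegree_add_le_of_degree_le ((natDegree_sub_le_of_le (hSd.trans n.le_succ)
      ((natDegree_C_mul_le _ _).trans hMd)).trans (max_self _).le) (hTd.trans n.le_succ)
  · rw [coeff_add, coeff_sub, coeff_eq_zero_of_natDegree_lt (p := T) (by omega),
      coeff_eq_zero_of_natDegree_lt (p := slice b' Finset.univ r y * P) (by omega), coeff_C_mul,
      show n + 1 = 2 + (n - 1) by omega,
      coeff_mul_add_eq_of_natDegree_le hL2 hPd.le, hP1, sq L,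
      show (2 : ℕ) = 1 + 1 from rfl, coeff_mul_add_eq_of_natDegree_le hLd hLd, hL, coeff_slice_one]
    ring
  · intro z hz
    have h0 := h z hz
    set T' := ∑ q ∈ Finset.univ.erase r, (C (c q)⁻¹ * (E q * Pq q)).eval z with hT'
    have hz' := hZ z hz
    have hPz : P.eval z = ∏ p ∈ Finset.univ.erase r, (z - y p) := by
      simp [P, eval_prod]
    have hPz0 : P.eval z ≠ 0 := by
      rw [hPz]
      exact Finset.prod_ne_zero_iff.2 fun p hp => sub_ne_zero.2 (hz' p (Finset.ne_of_mem_erase hp))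
    have hden : ∏ p ∈ Finset.univ.erase r, (Function.update y r z r - Function.update y r z p) =
        P.eval z := by
      rw [hPz]
      exact Finset.prod_congr rfl fun p hp => by
        rw [Function.update_self, Function.update_of_ne (Finset.ne_of_mem_erase hp)]
    have hterm : ∀ q ∈ Finset.univ.erase r,
        quadTerm b (α q) (β q) (γ q) q (Function.update y r z) /
          ∏ p ∈ Finset.univ.erase q, (Function.update y r z q - Function.update y r z p) =
        -((C (c q)⁻¹ * (E q * Pq q)).eval z / P.eval z) := by
      intro q hq
      have hqr := Finset.ne_of_mem_erase hq
      have e1 : ∏ p ∈ Finset.univ.erase q, (Function.update y r z q - Function.update y r z p) =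
          (y q - z) * c q := by
        rw [← Finset.mul_prod_erase _ _ (Finset.mem_erase.2 ⟨hqr.symm, Finset.mem_univ r⟩),
          Function.update_self, Function.update_of_ne hqr, Finset.erase_right_comm]
        congr 1
        exact Finset.prod_congr rfl fun p hp => by
          rw [Function.update_of_ne (Finset.ne_of_mem_erase (Finset.mem_of_mem_erase hp))]
      have e2 : P.eval z = (z - y q) * (Pq q).eval z := by
        simp only [P, Pq]
        rw [← Finset.mul_prod_erase _ _ hq, eval_mul]
        simp
      have e3 : y q - z ≠ 0 := sub_ne_zero.2 (hz' q hqr).symm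
      have e4 : (Pq q).eval z ≠ 0 := fun h' => hPz0 (by rw [e2, h', mul_zero])
      have e5 : z - y q ≠ 0 := sub_ne_zero.2 (hz' q hqr)
      have hcq := hc q
      rw [e1, e2, ← hE q hqr, eval_mul, eval_mul, eval_C]
      field_simp
      ring
    rw [← Finset.add_sum_erase _ _ (Finset.mem_univ r), hden, Finset.sum_congr rfl hterm,
      Finset.sum_neg_distrib, ← Finset.sum_div, ← eval_slice (Finset.mem_univ r),
      ← eval_slice (Finset.mem_univ r), ← hL] at h0
    rw [eval_add, eval_sub, eval_mul, eval_mul, eval_mul, eval_C, eval_pow, eval_finsetSum]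
    change _ + -(T' / _) + _ = _ at h0
    change _ = _ - _ + T'
    field_simp at h0
    linear_combination h0
  · intro q hq
    have hqr : q ∈ Finset.univ.erase r := Finset.mem_erase.2 ⟨hq, Finset.mem_univ q⟩
    have hP0 : P.eval (y q) = 0 := by
      simp only [P, eval_prod]
      exact Finset.prod_eq_zero hqr (by simp)
    have hcq : (Pq q).eval (y q) = c q := by simp [Pq, c, eval_prod]
    have hT : T.eval (y q) = (E q).eval (y q) := by
      simp only [T, eval_finsetSum]
      rw [Finset.sum_eq_single_of_mem q hqr]
      · rw [eval_mul, eval_mul, eval_C, hcq]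
        have := hc q
        field_simp
      · intro p hp hpq
        have : (Pq p).eval (y q) = 0 := by
          simp only [Pq, eval_prod]
          exact Finset.prod_eq_zero (Finset.mem_erase.2 ⟨hpq.symm, hqr⟩) (by simp)
        rw [eval_mul, eval_mul, this, mul_zero, mul_zero]
    rw [eval_add, eval_sub, eval_mul, eval_mul, eval_mul, hP0, hT, hE q hq]
    ring

end Group

end SegreVeronese

namespace SegreVeronese

/-! ### Polynomials and analytic functions on open sets -/

section Polynomials

open Polynomial Topology

lemma eq_of_eqOn_ball {P Q : ℝ[X]} {w ε : ℝ} (hε : 0 < ε)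
    (h : ∀ z ∈ Metric.ball w ε, P.eval z = Q.eval z) : P = Q := by
  refine Polynomial.eq_of_infinite_eval_eq P Q (Set.Infinite.mono h ?_)
  rw [Real.ball_eq_Ioo]
  exact Set.Ioo_infinite (by linarith)

lemma exists_derivative_eq (F : ℝ[X]) : ∃ P : ℝ[X], P.derivative = F := by
  refine ⟨F.sum fun k a => monomial (k + 1) (a / (k + 1)), ?_⟩
  conv_rhs => rw [← F.sum_monomial_eq]
  simp only [Polynomial.sum, derivative_sum, derivative_monomial]
  refine Finset.sum_congr rfl fun k _ => ?_
  have : (k : ℝ) + 1 ≠ 0 := by positivity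
  push_cast
  rw [div_mul_cancel₀ _ this]

lemma natDegree_le_of_derivative (P : ℝ[X]) : P.natDegree ≤ P.derivative.natDegree + 1 := by
  by_contra! h
  have h1 : P.derivative.coeff (P.natDegree - 1) = 0 :=
    coeff_eq_zero_of_natDegree_lt (by omega)
  rw [coeff_derivative, show P.natDegree - 1 + 1 = P.natDegree by omega] at h1
  have h2 : ((P.natDegree - 1 : ℕ) : ℝ) + 1 ≠ 0 := by positivity
  have h3 := (mul_eq_zero.1 h1).resolve_right h2
  have h4 : P = 0 := leadingCoeff_eq_zero.1 h3
  rw [h4] at h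
  simp at h

/-- A function whose second derivative is given by a polynomial is given by a polynomial. -/
lemma exists_polynomial_of_second_derivative {I : Set ℝ} (hI : IsOpen I) (hI' : IsPreconnected I)
    {A A' : ℝ → ℝ} {F : ℝ[X]}
    (h : ∀ z ∈ I, HasDerivAt A (A' z) z ∧ HasDerivAt A' (F.eval z) z) :
    ∃ P : ℝ[X], P.derivative.derivative = F ∧ ∀ z ∈ I, A z = P.eval z := by
  obtain ⟨P₁, hP₁⟩ := exists_derivative_eq F
  obtain ⟨P₀, hP₀⟩ := exists_derivative_eq P₁
  have key : ∀ (f g : ℝ → ℝ), (∀ z ∈ I, HasDerivAt f (g z) z) → (∀ z ∈ I, g z = 0) →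
      ∃ c, ∀ z ∈ I, f z = c := fun f g hf hg =>
    hI.exists_is_const_of_deriv_eq_zero hI'
      (fun z hz => (hf z hz).differentiableAt.differentiableWithinAt)
      fun z hz => by rw [(hf z hz).deriv, hg z hz]; rfl
  obtain ⟨c₁, hc₁⟩ := key (fun z => A' z - P₁.eval z) (fun z => F.eval z - P₁.derivative.eval z)
    (fun z hz => (h z hz).2.fun_sub (P₁.hasDerivAt z)) fun z _ => by rw [hP₁, sub_self]
  let P₂ : ℝ[X] := P₀ + C c₁ * X
  have hP₂ : P₂.derivative = P₁ + C c₁ := by simp [P₂, hP₀]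
  obtain ⟨c₀, hc₀⟩ := key (fun z => A z - P₂.eval z) (fun z => A' z - P₂.derivative.eval z)
    (fun z hz => (h z hz).1.fun_sub (P₂.hasDerivAt z)) fun z hz => by
      rw [hP₂, eval_add, eval_C]
      linarith [hc₁ z hz]
  refine ⟨P₀ + C c₁ * X + C c₀, by simp [hP₀, hP₁], fun z hz => ?_⟩
  have := hc₀ z hz
  rw [eval_add, eval_C]
  change A z - P₂.eval z = c₀ at this
  change A z = P₂.eval z + c₀
  linarith

/-- A function on an interval which is given by a polynomial near every point is given by a single
polynomial. -/
lemma eqOn_polynomial_of_locally {I : Set ℝ} (hI : IsPreconnected I) {f : ℝ → ℝ}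
    (h : ∀ z ∈ I, ∃ P : ℝ[X], ∀ᶠ w in 𝓝 z, f w = P.eval w) {z₀ : ℝ} (hz₀ : z₀ ∈ I) {P : ℝ[X]}
    (hP : ∀ᶠ w in 𝓝 z₀, f w = P.eval w) : ∀ z ∈ I, f z = P.eval z := by
  have hpoly : ∀ (Q : ℝ[X]) (z : ℝ), AnalyticAt ℝ (fun z => Q.eval z) z := fun Q z => by
    simpa using (analyticAt_id (𝕜 := ℝ) (z := z)).aeval_polynomial Q
  have hf : AnalyticOnNhd ℝ f I := fun z hz => by
    obtain ⟨Q, hQ⟩ := h z hz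
    exact (hpoly Q z).congr (hQ.mono fun w hw => hw.symm)
  exact hf.eqOn_of_preconnected_of_eventuallyEq (fun z _ => hpoly P z) hI hz₀ hP

lemma exists_mem_ne_zero {ι : Type*} [Fintype ι] {f : (ι → ℝ) → ℝ} (hf : ∀ x, AnalyticAt ℝ f x)
    (h0 : ∃ x, f x ≠ 0) {V : Set (ι → ℝ)} (hV : IsOpen V) (hne : V.Nonempty) :
    ∃ x ∈ V, f x ≠ 0 := by
  by_contra! h
  obtain ⟨x, hx⟩ := h0
  obtain ⟨v, hv⟩ := hne
  refine hx (congrFun (AnalyticOnNhd.eq_of_eventuallyEq (𝕜 := ℝ) (z₀ := v) (f := f) (g := 0)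
    (fun x _ => hf x) (fun x _ => analyticAt_const) ?_) x)
  filter_upwards [hV.mem_nhds hv] with w hw using h w hw

lemma eq_zero_of_eqOn_open {ι : Type*} [Fintype ι] {f : (ι → ℝ) → ℝ}
    (hf : ∀ x, AnalyticAt ℝ f x) {V : Set (ι → ℝ)} (hV : IsOpen V) (hne : V.Nonempty)
    (h : ∀ x ∈ V, f x = 0) (x : ι → ℝ) : f x = 0 := by
  by_contra hx
  obtain ⟨y, hy, hy'⟩ := exists_mem_ne_zero hf ⟨x, hx⟩ hV hne
  exact hy' (h y hy)

/-- The open condition `f ≠ 0`. -/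
lemma isOpen_inter_ne_zero {ι : Type*} [Fintype ι] {f : (ι → ℝ) → ℝ}
    (hf : ∀ x, AnalyticAt ℝ f x) {V : Set (ι → ℝ)} (hV : IsOpen V) :
    IsOpen (V ∩ {x | f x ≠ 0}) :=
  hV.inter (isOpen_ne_fun (continuous_iff_continuousAt.2 fun x => (hf x).continuousAt)
    continuous_const)

/-- The operator `P ↦ P'' (z + c)² - 2 (N + 1) P' (z + c) + (N + 1) (N + 2) P`. -/
def ratioOperator (N : ℝ) (c : ℝ) (P : ℝ[X]) : ℝ[X] :=
  P.derivative.derivative * (X + C c) ^ 2 - C (2 * (N + 1)) * (P.derivative * (X + C c)) +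
    C ((N + 1) * (N + 2)) * P

lemma coeff_ratioOperator (N c : ℝ) (P : ℝ[X]) (j : ℕ) :
    (ratioOperator N c P).coeff (j + 2) =
      (j + 1 - N) * (j - N) * P.coeff (j + 2) +
        2 * (j + 3) * (j + 1 - N) * c * P.coeff (j + 3) +
        (j + 4) * (j + 3) * c ^ 2 * P.coeff (j + 4) := by
  have h : ratioOperator N c P = P.derivative.derivative * X * X +
      C (2 * c) * (P.derivative.derivative * X) + C (c ^ 2) * P.derivative.derivative -
      C (2 * (N + 1)) * (P.derivative * X) - C (2 * (N + 1) * c) * P.derivative +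
      C ((N + 1) * (N + 2)) * P := by
    rw [ratioOperator]
    simp only [map_mul, map_pow, map_add]
    rw [show (C (2 : ℝ) : ℝ[X]) = 2 from rfl]
    ring
  rw [h]
  simp only [coeff_add, coeff_sub, coeff_C_mul, coeff_mul_X, coeff_derivative]
  push_cast
  ring

lemma eval_ratioOperator (N c z : ℝ) (P : ℝ[X]) :
    (ratioOperator N c P).eval z = P.derivative.derivative.eval z * (z + c) ^ 2 -
      2 * (N + 1) * P.derivative.eval z * (z + c) + (N + 1) * (N + 2) * P.eval z := by
  simp only [ratioOperator, eval_add, eval_sub, eval_mul, eval_C, eval_X, eval_pow]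
  ring

/-- If the operator takes a function to polynomials for three values of the parameter `c`, then the
function is a polynomial: the second divided difference in `c` is the second derivative. -/
lemma exists_polynomial_of_three_ratios {N : ℝ} {n : ℕ} {w ε : ℝ} (hε : 0 < ε)
    {A A₁ A₂ : ℝ → ℝ} (hA : ∀ z ∈ Metric.ball w ε, HasDerivAt A (A₁ z) z)
    (hA₁ : ∀ z ∈ Metric.ball w ε, HasDerivAt A₁ (A₂ z) z) {c₁ c₂ c₃ : ℝ} (h₁₂ : c₁ ≠ c₂)
    (h₁₃ : c₁ ≠ c₃) (h₂₃ : c₂ ≠ c₃) {R : ℝ → ℝ[X]}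
    (hR : ∀ c, c = c₁ ∨ c = c₂ ∨ c = c₃ → (R c).natDegree ≤ n ∧ ∀ z ∈ Metric.ball w ε,
      A₂ z * (z + c) ^ 2 - 2 * (N + 1) * A₁ z * (z + c) + (N + 1) * (N + 2) * A z = (R c).eval z) :
    ∃ P : ℝ[X], P.natDegree ≤ n + 2 ∧ (∀ z ∈ Metric.ball w ε, A z = P.eval z ∧
      A₁ z = P.derivative.eval z ∧ A₂ z = P.derivative.derivative.eval z) ∧
      ∀ c, c = c₁ ∨ c = c₂ ∨ c = c₃ → ratioOperator N c P = R c := by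
  obtain ⟨hd₁, hR₁⟩ := hR c₁ (by simp)
  obtain ⟨hd₂, hR₂⟩ := hR c₂ (by simp)
  obtain ⟨hd₃, hR₃⟩ := hR c₃ (by simp)
  have e₁₂ : c₁ - c₂ ≠ 0 := sub_ne_zero.2 h₁₂
  have e₁₃ : c₁ - c₃ ≠ 0 := sub_ne_zero.2 h₁₃
  have e₂₃ : c₂ - c₃ ≠ 0 := sub_ne_zero.2 h₂₃
  let F : ℝ[X] := C (1 / ((c₁ - c₂) * (c₁ - c₃))) * R c₁ -
    C (1 / ((c₁ - c₂) * (c₂ - c₃))) * R c₂ + C (1 / ((c₁ - c₃) * (c₂ - c₃))) * R c₃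
  have hFd : F.natDegree ≤ n := by
    refine natDegree_add_le_of_degree_le ((natDegree_sub_le_of_le
      ((natDegree_C_mul_le _ _).trans hd₁) ((natDegree_C_mul_le _ _).trans hd₂)).trans
        (max_self _).le) ((natDegree_C_mul_le _ _).trans hd₃)
  have hF : ∀ z ∈ Metric.ball w ε, A₂ z = F.eval z := by
    intro z hz
    simp only [F, eval_add, eval_sub, eval_mul, eval_C]
    rw [← hR₁ z hz, ← hR₂ z hz, ← hR₃ z hz]
    field_simp
    ring
  obtain ⟨P, hP, hAP⟩ := exists_polynomial_of_second_derivative Metric.isOpen_ball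
    (convex_ball w ε).isPreconnected (A := A) (A' := A₁) (F := F) fun z hz =>
      ⟨hA z hz, hF z hz ▸ hA₁ z hz⟩
  have hA₁P : ∀ z ∈ Metric.ball w ε, A₁ z = P.derivative.eval z := fun z hz =>
    (hA z hz).unique ((P.hasDerivAt z).congr_of_eventuallyEq
      (by filter_upwards [Metric.isOpen_ball.mem_nhds hz] with v hv using hAP v hv))
  refine ⟨P, ?_, fun z hz => ⟨hAP z hz, hA₁P z hz, by rw [hF z hz, hP]⟩, fun c hc => ?_⟩
  · have := natDegree_le_of_derivative P
    have := natDegree_le_of_derivative P.derivative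
    rw [hP] at this
    omega
  · refine eq_of_eqOn_ball (w := w) hε fun z hz => ?_
    rw [← (hR c hc).2 z hz, eval_ratioOperator, hP, ← hF z hz, ← hA₁P z hz, ← hAP z hz]

/-- A polynomial solution of a homogeneous equation of Euler type vanishes if the indicial
polynomial does not vanish at its degree. -/
lemma eq_zero_of_euler_type {N : ℝ} {B l m : ℝ[X]} {e : ℕ} (hl : l.natDegree ≤ e)
    (hm : (X * m).natDegree ≤ e)
    (hne : (B.natDegree * (B.natDegree - 1) : ℝ) * l.coeff e ^ 2 -
      2 * (N + 1) * B.natDegree * (l.coeff e * (X * m).coeff e) +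
        (N + 1) * (N + 2) * (X * m).coeff e ^ 2 ≠ 0)
    (h : ∀ w : ℝ, B.derivative.derivative.eval w * l.eval w ^ 2 -
      2 * (N + 1) * B.derivative.eval w * (l.eval w * m.eval w) +
        (N + 1) * (N + 2) * B.eval w * m.eval w ^ 2 = 0) : B = 0 := by
  set j := B.natDegree with hj
  have hpoly : (B.derivative.derivative * X * X) * (l * l) - C (2 * (N + 1)) *
      ((B.derivative * X) * (l * (X * m))) +
        C ((N + 1) * (N + 2)) * (B * ((X * m) * (X * m))) = 0 := by
    refine Polynomial.funext fun w => ?_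
    simp only [eval_add, eval_sub, eval_mul, eval_C, eval_X, eval_zero]
    linear_combination w ^ 2 * h w
  have h1 : (B.derivative * X).natDegree ≤ j := by
    rw [natDegree_le_iff_coeff_eq_zero]
    intro k hk
    obtain ⟨k, rfl⟩ := Nat.exists_eq_succ_of_ne_zero (show k ≠ 0 by omega)
    rw [coeff_mul_X, coeff_derivative, coeff_eq_zero_of_natDegree_lt (by omega), zero_mul]
  have h2 : (B.derivative.derivative * X * X).natDegree ≤ j := by
    rw [natDegree_le_iff_coeff_eq_zero]
    intro k hk
    obtain ⟨k, rfl⟩ := Nat.exists_eq_succ_of_ne_zero (show k ≠ 0 by omega)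
    rw [coeff_mul_X]
    rcases k with - | k
    · simp
    · rw [coeff_mul_X, coeff_derivative, coeff_derivative,
        coeff_eq_zero_of_natDegree_lt (by omega), zero_mul, zero_mul]
  have c1 : (B.derivative * X).coeff j = j * B.coeff j := by
    rcases j with - | j
    · simp
    · rw [coeff_mul_X, coeff_derivative]; push_cast; ring
  have c2 : (B.derivative.derivative * X * X).coeff j = j * (j - 1) * B.coeff j := by
    rcases j with - | j
    · simp
    · rw [coeff_mul_X]
      rcases j with - | j
      · simp
      · rw [coeff_mul_X, coeff_derivative, coeff_derivative]; push_cast; ring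
  have d : ∀ {p q : ℝ[X]}, p.natDegree ≤ e → q.natDegree ≤ e → (p * q).natDegree ≤ e + e :=
    fun hp hq => natDegree_mul_le.trans (by omega)
  -- in the top degree only the leading coefficients of `B`, `l` and `X m` matter
  have hc := congrArg (fun p : ℝ[X] => p.coeff (j + (e + e))) hpoly
  simp only [coeff_add, coeff_sub, coeff_C_mul, coeff_zero] at hc
  rw [coeff_mul_add_eq_of_natDegree_le h2 (d hl hl), coeff_mul_add_eq_of_natDegree_le h1 (d hl hm),
    coeff_mul_add_eq_of_natDegree_le hj.ge (d hm hm), coeff_mul_add_eq_of_natDegree_le hl hl,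
    coeff_mul_add_eq_of_natDegree_le hl hm, coeff_mul_add_eq_of_natDegree_le hm hm, c1, c2] at hc
  have h3 : B.coeff j = 0 := by
    refine (mul_eq_zero.1 ?_).resolve_left hne
    linear_combination hc
  exact leadingCoeff_eq_zero.1 h3

end Polynomials

end SegreVeronese

namespace SegreVeronese

/-! ### The equation in one group of coordinates -/

section Group

open Polynomial

variable {n : ℕ} {y₀ : Fin n → ℝ} {ε : ℝ} {b : ℕ → ℝ} {a : ℝ} {α β γ : Fin n → ℝ → ℝ}

/-- Near `y₀` the function `∑_q E_q / Δ_q + a L²` of the coordinates of one group is symmetric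
multi-affine, where `L = ∑_j b_j σ_j` and `E_q = α_q L² + β_q L ∂_qL + γ_q (∂_qL)²`. -/
def GroupEquation (b : ℕ → ℝ) (a : ℝ) (α β γ : Fin n → ℝ → ℝ) (y₀ : Fin n → ℝ) (ε : ℝ) : Prop :=
  ∃ b' : ℕ → ℝ, ∀ y ∈ Metric.ball y₀ ε, Function.Injective y ∧
    ∑ q, quadTerm b (α q) (β q) (γ q) q y / ∏ p ∈ Finset.univ.erase q, (y q - y p) +
      a * symAffine b Finset.univ y ^ 2 = symAffine b' Finset.univ y

lemma update_mem_ball (hε : 0 < ε) {y : Fin n → ℝ} (hy : y ∈ Metric.ball y₀ ε) {r : Fin n} {z : ℝ}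
    (hz : z ∈ Metric.ball (y₀ r) ε) : Function.update y r z ∈ Metric.ball y₀ ε := by
  rw [Metric.mem_ball, dist_pi_lt_iff hε] at hy ⊢
  intro q
  by_cases h : q = r
  · subst h; simpa using hz
  · rw [Function.update_of_ne h]; exact hy q

lemma apply_mem_ball (hε : 0 < ε) {y : Fin n → ℝ} (hy : y ∈ Metric.ball y₀ ε) (r : Fin n) :
    y r ∈ Metric.ball (y₀ r) ε := by
  rw [Metric.mem_ball, dist_pi_lt_iff hε] at hy
  exact hy r

lemma GroupEquation.exists_slice (h : GroupEquation b a α β γ y₀ ε) (hε : 0 < ε) (r : Fin n)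
    {y : Fin n → ℝ} (hy : y ∈ Metric.ball y₀ ε) :
    ∃ Q : ℝ[X], Q.natDegree ≤ n + 1 ∧
      Q.coeff (n + 1) = -a * symAffine (shift b) (Finset.univ.erase r) y ^ 2 ∧
      (∀ z ∈ Metric.ball (y₀ r) ε,
        quadTerm b (α r) (β r) (γ r) r (Function.update y r z) = Q.eval z) ∧
      ∀ q ≠ r, Q.eval (y q) = quadTerm b (α q) (β q) (γ q) q (Function.update y r (y q)) := by
  obtain ⟨b', hb'⟩ := h
  refine exists_slice_polynomial b b' a α β γ r y (hb' y hy).1 (fun z hz q hq hzq => ?_)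
    fun z hz => (hb' _ (update_mem_ball hε hy hz)).2
  have := (hb' _ (update_mem_ball hε hy hz)).1
  exact hq (this (by rw [Function.update_self, Function.update_of_ne hq, hzq]))

/-- On the diagonal `y_r = y_q` the partial derivatives with respect to `y_r` and `y_q` agree. -/
lemma symAffine_shift_diag (c : ℕ → ℝ) {r q : Fin n} (hq : q ≠ r) (y : Fin n → ℝ) :
    symAffine c (Finset.univ.erase q) (Function.update y r (y q)) =
      symAffine c (Finset.univ.erase r) y := by
  rw [symAffine_update_self (Finset.mem_erase.2 ⟨hq.symm, Finset.mem_univ r⟩),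
    symAffine_erase c (Finset.mem_erase.2 ⟨hq, Finset.mem_univ q⟩) y, Finset.erase_right_comm]

lemma symAffine_shift_update_self (c : ℕ → ℝ) (r : Fin n) (y : Fin n → ℝ) (z : ℝ) :
    symAffine c (Finset.univ.erase r) (Function.update y r z) =
      symAffine c (Finset.univ.erase r) y :=
  symAffine_update_of_notMem (Finset.notMem_erase r _) y z

/-- The equation `∑_q f_q(y_q) / Δ_q ∈ symmetric multi-affine`: the functions `f_q` are given by a
single polynomial of degree at most `n`. -/
lemma GroupEquation.exists_polynomial_of_const (h : GroupEquation (Pi.single 0 1) 0 α 0 0 y₀ ε)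
    (hε : 0 < ε) :
    ∃ f : ℝ[X], f.natDegree ≤ n ∧ ∀ r, ∀ z ∈ Metric.ball (y₀ r) ε, α r z = f.eval z := by
  rcases Nat.eq_zero_or_pos n with rfl | hn
  · exact ⟨0, by simp, fun r => r.elim0⟩
  have hq : ∀ (r : Fin n) (y : Fin n → ℝ),
      quadTerm (Pi.single 0 1) (α r) ((0 : Fin n → ℝ → ℝ) r) ((0 : Fin n → ℝ → ℝ) r) r y =
        α r (y r) := by
    intro r y
    rw [quadTerm, symAffine_eq_of_tail_zero (fun j hj _ => Pi.single_eq_of_ne (by omega) 1)]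
    simp
  let r₀ : Fin n := ⟨0, hn⟩
  obtain ⟨f, hfd, hfc, hf, -⟩ := h.exists_slice hε r₀ (Metric.mem_ball_self hε)
  refine ⟨f, ?_, fun r z hz => ?_⟩
  · rw [natDegree_le_iff_coeff_eq_zero]
    intro N hN
    rcases Nat.eq_or_lt_of_le (Nat.succ_le_of_lt hN) with h1 | h1
    · rw [← h1, Nat.succ_eq_add_one, hfc]; simp
    · exact coeff_eq_zero_of_natDegree_lt (by omega)
  · by_cases hr : r = r₀
    · subst hr
      rw [← hf z hz, hq, Function.update_self]
    · obtain ⟨Q, -, -, hQ, hQ'⟩ := h.exists_slice hε r₀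
        (update_mem_ball hε (Metric.mem_ball_self hε) hz)
      have : Q = f := eq_of_eqOn_ball hε fun w hw => by
        rw [← hQ w hw, ← hf w hw, hq, hq, Function.update_self, Function.update_self]
      have h1 := hQ' r hr
      rw [hq, Function.update_of_ne hr, Function.update_self, this] at h1
      exact h1.symm

/-- The equation `∑_q f_q(y_q) (∂_qL)² / Δ_q + a L² ∈ symmetric multi-affine`: the functions `f_q`
are given by a single polynomial of degree at most `n + 1`. -/
lemma GroupEquation.exists_polynomial_of_slope_ne_zero (h : GroupEquation b a 0 0 γ y₀ ε)
    (hε : 0 < ε) (hn : 0 < n)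
    (hL : ∀ r, ∀ y ∈ Metric.ball y₀ ε, symAffine (shift b) (Finset.univ.erase r) y ≠ 0) :
    ∃ f : ℝ[X], f.natDegree ≤ n + 1 ∧ f.coeff (n + 1) = -a ∧
      ∀ r, ∀ z ∈ Metric.ball (y₀ r) ε, γ r z = f.eval z := by
  have hq : ∀ (r : Fin n) (y : Fin n → ℝ),
      quadTerm b ((0 : Fin n → ℝ → ℝ) r) ((0 : Fin n → ℝ → ℝ) r) (γ r) r y = γ r (y r) * symAffine (shift b) (Finset.univ.erase r) y ^ 2 := by
    intro r y; simp [quadTerm]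
  let r₀ : Fin n := ⟨0, hn⟩
  obtain ⟨Q₀, hfd, hfc, hf, -⟩ := h.exists_slice hε r₀ (Metric.mem_ball_self hε)
  set l₀ := symAffine (shift b) (Finset.univ.erase r₀) y₀ with hl₀
  have hl₀0 : l₀ ≠ 0 := hL r₀ y₀ (Metric.mem_ball_self hε)
  have hγ : ∀ w ∈ Metric.ball (y₀ r₀) ε, γ r₀ w = (C (1 / l₀ ^ 2) * Q₀).eval w := by
    intro w hw
    rw [eval_mul, eval_C, ← hf w hw, hq, Function.update_self, symAffine_shift_update_self, ← hl₀]
    field_simp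
  refine ⟨C (1 / l₀ ^ 2) * Q₀, (natDegree_C_mul_le _ _).trans hfd, ?_, fun r z hz => ?_⟩
  · rw [coeff_C_mul, hfc]; field_simp
  · by_cases hr : r = r₀
    · subst hr
      exact hγ z hz
    · have hy := update_mem_ball hε (Metric.mem_ball_self hε) hz
      obtain ⟨Q, -, -, hQ, hQ'⟩ := h.exists_slice hε r₀ hy
      set y := Function.update y₀ r z with hydef
      have hl := hL r₀ y hy
      have : Q = C (symAffine (shift b) (Finset.univ.erase r₀) y ^ 2) * (C (1 / l₀ ^ 2) * Q₀) :=
        eq_of_eqOn_ball hε fun w hw => by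
          rw [← hQ w hw, hq, Function.update_self, symAffine_shift_update_self, hγ w hw, eval_mul
            (p := C (symAffine _ _ _ ^ 2)), eval_C, mul_comm]
      have hyr : y r = z := by rw [hydef, Function.update_self]
      have h1 := hQ' r hr
      rw [hq, Function.update_of_ne hr, symAffine_shift_diag _ hr, this, eval_mul
        (p := C (symAffine _ _ _ ^ 2)), eval_C, hyr, mul_comm] at h1
      exact (mul_right_cancel₀ (pow_ne_zero 2 hl) h1).symm

lemma symAffine_update_univ (b : ℕ → ℝ) (r : Fin n) (y : Fin n → ℝ) (z : ℝ) :
    symAffine b Finset.univ (Function.update y r z) =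
      symAffine b (Finset.univ.erase r) y +
        z * symAffine (shift b) (Finset.univ.erase r) y :=
  symAffine_update_self (Finset.mem_univ r) y z

lemma analyticAt_symAffine_self (c : ℕ → ℝ) (R : Finset (Fin n)) (y : Fin n → ℝ) :
    AnalyticAt ℝ (symAffine c R) y :=
  analyticAt_symAffine c R (fun r : Fin n => r) y

/-- If `L` does not vanish on any hyperplane `y_r = c`, then the ratio of `L` at `y_r = 0` and
`∂_rL` takes at least three values on every open set. -/
lemma exists_three_ratios {V : Set (Fin n → ℝ)} (hV : IsOpen V) (hne : V.Nonempty) (r : Fin n)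
    (hL : ∃ y, symAffine (shift b) (Finset.univ.erase r) y ≠ 0)
    (hind : ∀ c, ∃ y, symAffine b Finset.univ (Function.update y r c) ≠ 0) :
    ∃ y : Fin 3 → Fin n → ℝ, (∀ i, y i ∈ V ∧
      symAffine (shift b) (Finset.univ.erase r) (y i) ≠ 0) ∧
      ∀ i j, i ≠ j → symAffine b (Finset.univ.erase r) (y i) /
        symAffine (shift b) (Finset.univ.erase r) (y i) ≠
        symAffine b (Finset.univ.erase r) (y j) /
        symAffine (shift b) (Finset.univ.erase r) (y j) := by
  set f := symAffine (shift b) (Finset.univ.erase r) with hf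
  set g := symAffine b (Finset.univ.erase r) with hg
  have hfa : ∀ y, AnalyticAt ℝ f y := analyticAt_symAffine_self _ _
  have hga : ∀ y, AnalyticAt ℝ g y := analyticAt_symAffine_self _ _
  have hWa : ∀ c y, AnalyticAt ℝ (fun y => g y - c * f y) y := fun c y =>
    (hga y).fun_sub (analyticAt_const.mul (hfa y))
  have hW : ∀ c, ∃ y, g y - c * f y ≠ 0 := fun c => by
    obtain ⟨y, hy⟩ := hind (-c)
    exact ⟨y, by rw [symAffine_update_univ] at hy; rwa [sub_eq_add_neg, ← neg_mul]⟩
  have hV₁ := isOpen_inter_ne_zero hfa hV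
  obtain ⟨y₁, hy₁⟩ := exists_mem_ne_zero hfa hL hV hne
  obtain ⟨y₂, hy₂, hy₂'⟩ := exists_mem_ne_zero (hWa (g y₁ / f y₁)) (hW _) hV₁ ⟨y₁, hy₁⟩
  obtain ⟨y₃, ⟨hy₃, hy₃'⟩, hy₃''⟩ := exists_mem_ne_zero (hWa (g y₂ / f y₂)) (hW _)
    (isOpen_inter_ne_zero (hWa (g y₁ / f y₁)) hV₁) ⟨y₂, hy₂, hy₂'⟩
  have h1 := hy₁.2
  have h2 : f y₂ ≠ 0 := hy₂.2
  have h3 : f y₃ ≠ 0 := hy₃.2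
  have h12 : g y₁ / f y₁ ≠ g y₂ / f y₂ := fun h => hy₂' (by rw [h]; field_simp; ring)
  have h13 : g y₁ / f y₁ ≠ g y₃ / f y₃ := fun h => hy₃' (by simp only [h]; field_simp; ring)
  have h23 : g y₂ / f y₂ ≠ g y₃ / f y₃ := fun h => hy₃'' (by rw [h]; field_simp; ring)
  refine ⟨![y₁, y₂, y₃], ?_, ?_⟩
  · intro i
    fin_cases i
    · exact ⟨hy₁.1, h1⟩
    · exact ⟨hy₂.1, h2⟩
    · exact ⟨hy₃.1, h3⟩
  · intro i j hij
    fin_cases i <;> fin_cases j <;>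
      first
        | exact absurd rfl hij
        | exact h12
        | exact h13
        | exact h23
        | exact h12.symm
        | exact h13.symm
        | exact h23.symm

variable {N : ℝ} {A A₁ A₂ : Fin n → ℝ → ℝ}

/-- Along the `r`-axis, the summand of the extremality equation is the second order operator of
`ratioOperator`, with parameter the ratio of `L` at `y_r = 0` and `∂_rL`. -/
lemma quadTerm_update_eq (r : Fin n) (y : Fin n → ℝ)
    (hl : symAffine (shift b) (Finset.univ.erase r) y ≠ 0) (A A₁ A₂ : ℝ → ℝ) (z : ℝ) :
    quadTerm b A₂ (fun z => -2 * (N + 1) * A₁ z) (fun z => (N + 1) * (N + 2) * A z) r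
      (Function.update y r z) =
    symAffine (shift b) (Finset.univ.erase r) y ^ 2 *
      (A₂ z * (z + symAffine b (Finset.univ.erase r) y /
          symAffine (shift b) (Finset.univ.erase r) y) ^ 2 -
        2 * (N + 1) * A₁ z * (z + symAffine b (Finset.univ.erase r) y /
          symAffine (shift b) (Finset.univ.erase r) y) + (N + 1) * (N + 2) * A z) := by
  rw [quadTerm, Function.update_self, symAffine_shift_update_self, symAffine_update_univ]
  field_simp
  ring

/-- A polynomial slice of the extremality equation, divided by the square of `∂_rL`. -/
lemma GroupEquation.exists_ratio_slice (h : GroupEquation b a A₂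
      (fun q z => -2 * (N + 1) * A₁ q z) (fun q z => (N + 1) * (N + 2) * A q z) y₀ ε) (hε : 0 < ε)
    (r : Fin n) {y : Fin n → ℝ} (hy : y ∈ Metric.ball y₀ ε)
    (hl : symAffine (shift b) (Finset.univ.erase r) y ≠ 0) :
    ∃ R : ℝ[X], R.natDegree ≤ n + 1 ∧ R.coeff (n + 1) = -a ∧ ∀ z ∈ Metric.ball (y₀ r) ε,
      A₂ r z * (z + symAffine b (Finset.univ.erase r) y /
          symAffine (shift b) (Finset.univ.erase r) y) ^ 2 -
        2 * (N + 1) * A₁ r z * (z + symAffine b (Finset.univ.erase r) y /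
          symAffine (shift b) (Finset.univ.erase r) y) + (N + 1) * (N + 2) * A r z = R.eval z := by
  obtain ⟨Q, hQd, hQc, hQ, -⟩ := h.exists_slice hε r hy
  refine ⟨C (1 / symAffine (shift b) (Finset.univ.erase r) y ^ 2) * Q,
    (natDegree_C_mul_le _ _).trans hQd, ?_, fun z hz => ?_⟩
  · rw [coeff_C_mul, hQc]; field_simp
  · have := hQ z hz
    rw [quadTerm_update_eq r y hl] at this
    rw [eval_mul, eval_C, ← this, ← mul_assoc, one_div_mul_cancel (pow_ne_zero 2 hl), one_mul]

/-- The restriction of the equation to the line `y_r` determines `A_r` as soon as three values of the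
ratio of `L` at `y_r = 0` to `∂_rL` occur; comparing these values also excludes terms of degree
greater than `n + 1`. -/
lemma GroupEquation.exists_polynomial (h : GroupEquation b a A₂
      (fun q z => -2 * (N + 1) * A₁ q z) (fun q z => (N + 1) * (N + 2) * A q z) y₀ ε) (hε : 0 < ε)
    (r : Fin n) (hN : (n : ℝ) < N)
    (hA : ∀ z ∈ Metric.ball (y₀ r) ε, HasDerivAt (A r) (A₁ r z) z)
    (hA₁ : ∀ z ∈ Metric.ball (y₀ r) ε, HasDerivAt (A₁ r) (A₂ r z) z)
    (hL : ∃ y, symAffine (shift b) (Finset.univ.erase r) y ≠ 0)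
    (hind : ∀ c, ∃ y, symAffine b Finset.univ (Function.update y r c) ≠ 0) :
    ∃ P : ℝ[X], P.natDegree ≤ n + 1 ∧ (N - n) * (N + 1 - n) * P.coeff (n + 1) = -a ∧
      ∀ z ∈ Metric.ball (y₀ r) ε, A r z = P.eval z ∧
      A₁ r z = P.derivative.eval z ∧ A₂ r z = P.derivative.derivative.eval z := by
  obtain ⟨y, hy, hne⟩ := exists_three_ratios (Metric.isOpen_ball (x := y₀) (ε := ε))
    ⟨y₀, Metric.mem_ball_self hε⟩ r hL hind
  set c : Fin 3 → ℝ := fun i => symAffine b (Finset.univ.erase r) (y i) /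
        symAffine (shift b) (Finset.univ.erase r) (y i) with hc
  choose R hRd hRc hR using fun i => h.exists_ratio_slice hε r (hy i).1 (hy i).2
  have h01 : c 0 ≠ c 1 := hne 0 1 (by decide)
  have h02 : c 0 ≠ c 2 := hne 0 2 (by decide)
  have h12 : c 1 ≠ c 2 := hne 1 2 (by decide)
  classical
  let R' : ℝ → ℝ[X] := fun e => if e = c 0 then R 0 else if e = c 1 then R 1 else R 2
  have hR0 : R' (c 0) = R 0 := by simp [R']
  have hR1 : R' (c 1) = R 1 := by simp [R', h01.symm]
  have hR2 : R' (c 2) = R 2 := by simp [R', h02.symm, h12.symm]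
  obtain ⟨P, hPd, hP, hPR⟩ := exists_polynomial_of_three_ratios (N := N) (n := n + 1) (R := R') hε
    hA hA₁ h01 h02 h12 (by
      rintro e (rfl | rfl | rfl)
      · rw [hR0]; exact ⟨hRd 0, hR 0⟩
      · rw [hR1]; exact ⟨hRd 1, hR 1⟩
      · rw [hR2]; exact ⟨hRd 2, hR 2⟩)
  have hn : 0 < n := r.pos
  have hco : ∀ i, (ratioOperator N (c i) P).coeff (n + 1) = -a := by
    intro i
    fin_cases i
    · exact (congrArg (fun p : ℝ[X] => p.coeff (n + 1)) ((hPR _ (by simp)).trans hR0)).trans (hRc 0)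
    · exact (congrArg (fun p : ℝ[X] => p.coeff (n + 1)) ((hPR _ (by simp)).trans hR1)).trans (hRc 1)
    · exact (congrArg (fun p : ℝ[X] => p.coeff (n + 1)) ((hPR _ (by simp)).trans hR2)).trans (hRc 2)
  obtain ⟨m, rfl⟩ := Nat.exists_eq_succ_of_ne_zero hn.ne'
  simp only [Nat.succ_eq_add_one] at *
  simp only [show m + 1 + 1 = m + 2 from rfl, coeff_ratioOperator] at hco
  push_cast at hN ⊢
  have g0 := hco 0
  have g1 := hco 1
  have g2 := hco 2
  have e01 := sub_ne_zero.2 h01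
  have e02 := sub_ne_zero.2 h02
  have e12 := sub_ne_zero.2 h12
  have hm4 : (m + 4) * (m + 3 : ℝ) ≠ 0 := by positivity
  -- the second divided difference in the ratio
  have p4 : P.coeff (m + 4) = 0 := by
    have : (c 0 - c 1) * (c 0 - c 2) * (c 1 - c 2) * ((m + 4) * (m + 3) * P.coeff (m + 4)) = 0 := by
      linear_combination (c 1 - c 2) * g0 - (c 0 - c 2) * g1 + (c 0 - c 1) * g2
    simpa [e01, e02, e12, hm4] using this
  have p3 : P.coeff (m + 3) = 0 := by
    have h1 : (c 0 - c 1) * (2 * (m + 3) * (m + 1 - N)) * P.coeff (m + 3) = 0 := by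
      rw [p4] at g0 g1
      linear_combination g0 - g1
    have h2 : 2 * (m + 3) * (m + 1 - N) ≠ 0 := by
      have : (m : ℝ) + 1 - N < 0 := by linarith
      have : (0 : ℝ) < m + 3 := by positivity
      exact mul_ne_zero (by positivity) (by linarith)
    exact (mul_eq_zero.1 h1).resolve_left (mul_ne_zero e01 h2)
  refine ⟨P, ?_, ?_, hP⟩
  · rw [natDegree_le_iff_coeff_eq_zero]
    intro k hk
    rcases Nat.lt_or_ge k (m + 5) with hk' | hk'
    · rcases (show k = m + 3 ∨ k = m + 4 by omega) with rfl | rfl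
      · exact p3
      · exact p4
    · exact coeff_eq_zero_of_natDegree_lt (by omega)
  · rw [p3, p4] at g0
    linear_combination g0

end Group

end SegreVeronese

namespace SegreVeronese

/-! ### Comparison of the functions of one group -/

section Group

open Polynomial

variable {n : ℕ} {y₀ : Fin n → ℝ} {ε : ℝ} {b : ℕ → ℝ} {a : ℝ}
variable {N : ℝ} {A A₁ A₂ : Fin n → ℝ → ℝ}

lemma coeff_eq_zero_of_symAffine_eq_zero {κ : Type*} [DecidableEq κ] {c : ℕ → ℝ} {R : Finset κ}
    (h : ∀ y, symAffine c R y = 0) : ∀ j ≤ R.card, c j = 0 := by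
  induction R using Finset.induction_on generalizing c with
  | empty =>
    intro j hj
    have := h 0
    simp only [Finset.card_empty, Nat.le_zero] at hj
    simpa [symAffine, hj] using this
  | insert r R hr ih =>
    have hs : ∀ (y : κ → ℝ) (z : ℝ), symAffine c R y + z * symAffine (shift c) R y = 0 := by
      intro y z
      have h1 := h (Function.update y r z)
      have h2 : ∀ c : ℕ → ℝ, symAffine c R (Function.update y r z) = symAffine c R y := fun c =>
        symAffine_congr (fun _ _ => rfl) fun q hq =>
          Function.update_of_ne (ne_of_mem_of_not_mem hq hr) _ _
      rwa [symAffine_erase c (Finset.mem_insert_self r R), Finset.erase_insert hr, h2, h2,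
        Function.update_self] at h1
    have h0 : ∀ y, symAffine c R y = 0 := fun y => by simpa using hs y 0
    have h1 : ∀ y, symAffine (shift c) R y = 0 := fun y => by simpa [h0] using hs y 1
    intro j hj
    rw [Finset.card_insert_of_notMem hr] at hj
    rcases j with - | j
    · exact ih h0 0 (Nat.zero_le _)
    · exact ih h1 j (by omega)

/-- On the diagonal `y_r = y_p` the equation compares the functions `A_r` and `A_p`. -/
lemma GroupEquation.diagonal (h : GroupEquation b a A₂
      (fun q z => -2 * (N + 1) * A₁ q z) (fun q z => (N + 1) * (N + 2) * A q z) y₀ ε) (hε : 0 < ε)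
    {P : Fin n → ℝ[X]}
    (hP : ∀ r, ∀ z ∈ Metric.ball (y₀ r) ε, A r z = (P r).eval z ∧
      A₁ r z = (P r).derivative.eval z ∧ A₂ r z = (P r).derivative.derivative.eval z)
    {r p : Fin n} (hpr : p ≠ r) (y : Fin n → ℝ) :
    (P r - P p).derivative.derivative.eval (y p) *
        (symAffine b (Finset.univ.erase r) y +
          y p * symAffine (shift b) (Finset.univ.erase r) y) ^ 2 -
      2 * (N + 1) * (P r - P p).derivative.eval (y p) *
        ((symAffine b (Finset.univ.erase r) y +
          y p * symAffine (shift b) (Finset.univ.erase r) y) *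
          symAffine (shift b) (Finset.univ.erase r) y) +
      (N + 1) * (N + 2) * (P r - P p).eval (y p) *
        symAffine (shift b) (Finset.univ.erase r) y ^ 2 = 0 := by
  have hpoly : ∀ (Q : ℝ[X]) (y : Fin n → ℝ), AnalyticAt ℝ (fun y : Fin n → ℝ => Q.eval (y p)) y :=
    fun Q y => by simpa using (analyticAt_coord p y).aeval_polynomial Q
  have h0 := analyticAt_symAffine_self b (Finset.univ.erase r)
  have h1 := analyticAt_symAffine_self (shift b) (Finset.univ.erase r)
  have h2 : ∀ y : Fin n → ℝ, AnalyticAt ℝ (fun y : Fin n → ℝ =>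
      symAffine b (Finset.univ.erase r) y +
        y p * symAffine (shift b) (Finset.univ.erase r) y) y := fun y =>
    (h0 y).fun_add ((analyticAt_coord p y).fun_mul (h1 y))
  refine eq_zero_of_eqOn_open (f := fun y : Fin n → ℝ =>
    (P r - P p).derivative.derivative.eval (y p) *
        (symAffine b (Finset.univ.erase r) y +
          y p * symAffine (shift b) (Finset.univ.erase r) y) ^ 2 -
      2 * (N + 1) * (P r - P p).derivative.eval (y p) *
        ((symAffine b (Finset.univ.erase r) y +
          y p * symAffine (shift b) (Finset.univ.erase r) y) *
          symAffine (shift b) (Finset.univ.erase r) y) +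
      (N + 1) * (N + 2) * (P r - P p).eval (y p) *
        symAffine (shift b) (Finset.univ.erase r) y ^ 2)
    (fun y => ?_) (Metric.isOpen_ball (x := y₀) (ε := ε))
    ⟨y₀, Metric.mem_ball_self hε⟩ (fun y hy => ?_) y
  · exact (((hpoly _ y).fun_mul ((h2 y).fun_pow 2)).fun_sub
      ((analyticAt_const.fun_mul (hpoly _ y)).fun_mul ((h2 y).fun_mul (h1 y)))).fun_add
        ((analyticAt_const.fun_mul (hpoly _ y)).fun_mul ((h1 y).fun_pow 2))
  · obtain ⟨Q, -, -, hQ, hQ'⟩ := h.exists_slice hε r hy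
    set l := symAffine (shift b) (Finset.univ.erase r) y with hl
    have hQP : Q = (P r).derivative.derivative * slice b Finset.univ r y ^ 2 -
        C (2 * (N + 1)) * ((P r).derivative * (slice b Finset.univ r y * C l)) +
        C ((N + 1) * (N + 2)) * (P r * C l ^ 2) := eq_of_eqOn_ball hε fun z hz => by
      obtain ⟨e0, e1, e2⟩ := hP r z hz
      rw [← hQ z hz, quadTerm, Function.update_self, symAffine_shift_update_self, ← hl, e0, e1, e2]
      simp only [eval_add, eval_sub, eval_mul, eval_pow, eval_C, eval_slice (Finset.mem_univ r)]
      ring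
    have h3 := hQ' p hpr
    obtain ⟨e0, e1, e2⟩ := hP p (y p) (apply_mem_ball hε hy p)
    rw [hQP, quadTerm, Function.update_of_ne hpr, symAffine_shift_diag _ hpr, ← hl, e0, e1, e2] at h3
    simp only [eval_add, eval_sub, eval_mul, eval_pow, eval_C, eval_slice (Finset.mem_univ r),
      symAffine_update_univ, ← hl] at h3
    simp only [derivative_sub, eval_sub]
    linear_combination h3

/-- The functions `A_r` of one group are given by the same polynomial. -/
lemma GroupEquation.polynomial_unique (h : GroupEquation b a A₂
      (fun q z => -2 * (N + 1) * A₁ q z) (fun q z => (N + 1) * (N + 2) * A q z) y₀ ε) (hε : 0 < ε)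
    (hN : (n : ℝ) + 1 ≤ N) (hN3 : ∃ N' : ℕ, N = N') {P : Fin n → ℝ[X]}
    (hPd : ∀ r, (P r).natDegree ≤ n + 1)
    (hPc : ∀ r, (N - n) * (N + 1 - n) * (P r).coeff (n + 1) = -a)
    (hP : ∀ r, ∀ z ∈ Metric.ball (y₀ r) ε, A r z = (P r).eval z ∧
      A₁ r z = (P r).derivative.eval z ∧ A₂ r z = (P r).derivative.derivative.eval z)
    {r p : Fin n} (hpr : p ≠ r)
    (hL : ∃ y, symAffine (shift b) (Finset.univ.erase r) y ≠ 0) : P r = P p := by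
  have hn : 2 ≤ n := by
    by_contra hn
    exact hpr (Fin.ext (by omega))
  set R := (Finset.univ.erase r).erase p with hR
  have hp : p ∈ Finset.univ.erase r := Finset.mem_erase.2 ⟨hpr, Finset.mem_univ p⟩
  have hRc : R.card = n - 2 := by
    rw [hR, Finset.card_erase_of_mem hp, Finset.card_erase_of_mem (Finset.mem_univ r)]
    simp; omega
  rw [← sub_eq_zero]
  set B := P r - P p with hB
  have hBd : B.natDegree ≤ n := by
    rw [natDegree_le_iff_coeff_eq_zero]
    intro k hk
    rcases Nat.eq_or_lt_of_le (Nat.succ_le_of_lt hk) with h1 | h1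
    · have h2 : (N - n) * (N + 1 - n) ≠ 0 :=
        mul_ne_zero (by linarith) (by linarith)
      rw [← h1, hB, coeff_sub, sub_eq_zero]
      exact mul_left_cancel₀ h2 ((hPc r).trans (hPc p).symm)
    · rw [hB, coeff_sub, coeff_eq_zero_of_natDegree_lt ((hPd r).trans_lt (by omega)),
        coeff_eq_zero_of_natDegree_lt ((hPd p).trans_lt (by omega)), sub_zero]
  have hBdN : (B.natDegree : ℝ) ≤ n := by exact_mod_cast hBd
  -- the equation on the diagonal, with the common value `w` of the two coordinates
  have hdiag : ∀ (y : Fin n → ℝ) (w : ℝ),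
      B.derivative.derivative.eval w * (symAffine b R y + 2 * w * symAffine (shift b) R y +
        w ^ 2 * symAffine (shift (shift b)) R y) ^ 2 -
      2 * (N + 1) * B.derivative.eval w * ((symAffine b R y + 2 * w * symAffine (shift b) R y +
        w ^ 2 * symAffine (shift (shift b)) R y) *
          (symAffine (shift b) R y + w * symAffine (shift (shift b)) R y)) +
      (N + 1) * (N + 2) * B.eval w *
        (symAffine (shift b) R y + w * symAffine (shift (shift b)) R y) ^ 2 = 0 := by
    intro y w
    have h1 := h.diagonal hε hP hpr (Function.update y p w)
    rw [symAffine_update_self hp, symAffine_update_self hp, Function.update_self] at h1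
    linear_combination h1
  -- `hdiag` is an Euler type equation for `B`, whose base has degree two or one in `w`
  by_cases h2 : ∃ y, symAffine (shift (shift b)) R y ≠ 0
  · obtain ⟨y, hy⟩ := h2
    set m₂ := symAffine (shift (shift b)) R y with hm₂
    have hm : X * (C (symAffine (shift b) R y) + X * C m₂) =
        C m₂ * X ^ 2 + C (symAffine (shift b) R y) * X := by ring
    refine eq_zero_of_euler_type (N := N) (e := 2)
      (l := C m₂ * X ^ 2 + C (2 * symAffine (shift b) R y) * X + C (symAffine b R y))
      (m := C (symAffine (shift b) R y) + X * C m₂) (by compute_degree)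
      (by rw [hm]; compute_degree) ?_ fun w => ?_
    · have c1 : (C m₂ * X ^ 2 + C (2 * symAffine (shift b) R y) * X +
          C (symAffine b R y)).coeff 2 = m₂ := by
        simp
      have c2 : (X * (C (symAffine (shift b) R y) + X * C m₂)).coeff 2 = m₂ := by
        rw [hm]; simp
      rw [c1, c2]
      have : m₂ ^ 2 * ((N + 1 - B.natDegree) * (N + 2 - B.natDegree)) ≠ 0 :=
        mul_ne_zero (pow_ne_zero 2 hy) (mul_ne_zero (by linarith) (by linarith))
      convert this using 1
      ring
    · simp only [eval_add, eval_mul, eval_C, eval_X, eval_pow]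
      linear_combination hdiag y w
  · push Not at h2
    have hb : ∀ j, 2 ≤ j → j ≤ n → b j = 0 := by
      intro j hj hjn
      have := coeff_eq_zero_of_symAffine_eq_zero h2 (j - 2) (by omega)
      rwa [shift, shift, show j - 2 + 1 + 1 = j by omega] at this
    have hs : ∀ (R' : Finset (Fin n)) (y : Fin n → ℝ), R'.card + 1 ≤ n →
        symAffine (shift b) R' y = b 1 := fun R' y hR' =>
      symAffine_eq_of_tail_zero (fun j hj hj' => hb (j + 1) (by omega) (by omega)) y
    have hb1 : b 1 ≠ 0 := by
      obtain ⟨y, hy⟩ := hL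
      rwa [hs _ y (by simp; omega)] at hy
    simp only [h2, mul_zero, add_zero, hs R _ (by omega)] at hdiag
    rcases Nat.lt_or_ge 2 n with hn2 | hn2
    · -- a third coordinate of the group makes `L` vanish on the diagonal
      obtain ⟨t, ht⟩ : R.Nonempty := Finset.card_pos.1 (by omega)
      refine Polynomial.funext fun w => ?_
      have h3 := hdiag (Function.update 0 t
        (-(symAffine b (R.erase t) 0 + 2 * w * b 1) / b 1)) w
      have hct : (R.erase t).card + 1 ≤ n := by
        rw [Finset.card_erase_of_mem ht]; omega
      rw [symAffine_update_self ht, hs _ _ hct, div_mul_cancel₀ _ hb1] at h3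
      have h4 : (N + 1) * (N + 2) * b 1 ^ 2 ≠ 0 := by
        have : (0 : ℝ) ≤ n := n.cast_nonneg
        exact mul_ne_zero (mul_ne_zero (by linarith) (by linarith)) (pow_ne_zero 2 hb1)
      rw [eval_zero]
      refine (mul_eq_zero.1 ?_).resolve_left h4
      linear_combination h3
    · have hn2' : n = 2 := by omega
      have hR0 : R = ∅ := Finset.card_eq_zero.1 (by omega)
      have hN3' : (3 : ℝ) ≤ N := by rw [hn2'] at hN; push_cast at hN; linarith
      refine eq_zero_of_euler_type (N := N) (e := 1) (l := C (2 * b 1) * X + C (b 0))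
        (m := C (b 1)) (by compute_degree) (by compute_degree) ?_ fun w => ?_
      · have c1 : (C (2 * b 1) * X + C (b 0)).coeff 1 = 2 * b 1 := by simp [coeff_C]
        have c2 : (X * C (b 1)).coeff 1 = b 1 := by simp
        rw [c1, c2]
        obtain ⟨N', rfl⟩ := hN3
        have hN'3 : 3 ≤ N' := by exact_mod_cast hN3'
        have hj : B.natDegree ≤ 2 := hn2' ▸ hBd
        have key : ∀ x : ℝ, x ≠ 0 → b 1 ^ 2 * x ≠ 0 := fun x hx =>
          mul_ne_zero (pow_ne_zero 2 hb1) hx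
        interval_cases hjB : B.natDegree
        · convert key ((N' + 1) * (N' + 2)) (by positivity) using 1
          push_cast; ring
        · convert key ((N' + 1) * (N' - 2)) (mul_ne_zero (by positivity) (by linarith)) using 1
          push_cast; ring
        · have h5 : (N' : ℤ) * (N' - 5) + 2 ≠ 0 := by
            rcases Nat.lt_or_ge N' 5 with h5 | h5
            · interval_cases N' <;> norm_num
            · have : (5 : ℤ) ≤ N' := by exact_mod_cast h5
              nlinarith
          convert key (N' * (N' - 5) + 2) (by exact_mod_cast h5) using 1
          push_cast; ring
      · have h3 := hdiag 0 w
        have h4 : symAffine b R 0 = b 0 := by rw [hR0]; simp [symAffine]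
        rw [h4] at h3
        simp only [eval_add, eval_mul, eval_C, eval_X]
        linear_combination h3

/-- If `L` does not vanish on any hyperplane `y_r = c`, the equation in one group of coordinates makes
all functions `A_r` of the group one polynomial. -/
theorem GroupEquation.exists_common_polynomial (h : GroupEquation b a A₂
      (fun q z => -2 * (N + 1) * A₁ q z) (fun q z => (N + 1) * (N + 2) * A q z) y₀ ε) (hε : 0 < ε)
    (hn : 0 < n) (hN : (n : ℝ) + 1 ≤ N) (hN3 : ∃ N' : ℕ, N = N')
    (hA : ∀ r, ∀ z ∈ Metric.ball (y₀ r) ε, HasDerivAt (A r) (A₁ r z) z)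
    (hA₁ : ∀ r, ∀ z ∈ Metric.ball (y₀ r) ε, HasDerivAt (A₁ r) (A₂ r z) z)
    (hL : ∀ r : Fin n, ∃ y, symAffine (shift b) (Finset.univ.erase r) y ≠ 0)
    (hind : ∀ (r : Fin n) (c : ℝ), ∃ y, symAffine b Finset.univ (Function.update y r c) ≠ 0) :
    ∃ P : ℝ[X], P.natDegree ≤ n + 1 ∧
      ∀ r, ∀ z ∈ Metric.ball (y₀ r) ε, A r z = P.eval z := by
  choose P hPd hPc hP using fun r => h.exists_polynomial hε r (by linarith) (hA r) (hA₁ r)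
    (hL r) (hind r)
  refine ⟨P ⟨0, hn⟩, hPd _, fun r z hz => ?_⟩
  by_cases hr : r = ⟨0, hn⟩
  · subst hr
    exact (hP _ z hz).1
  · rw [h.polynomial_unique hε hN hN3 hPd hPc hP hr (hL _)]
    exact (hP r z hz).1

/-- The extremality equation in a group with a single coordinate `z`, where `L` is proportional
to `z + c`: three values of `c` are needed, which are provided by varying the other groups. -/
theorem exists_polynomial_of_single {N : ℝ} (hN : 3 ≤ N) {w ε : ℝ} (hε : 0 < ε)
    {A A₁ A₂ : ℝ → ℝ} (hA : ∀ z ∈ Metric.ball w ε, HasDerivAt A (A₁ z) z)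
    (hA₁ : ∀ z ∈ Metric.ball w ε, HasDerivAt A₁ (A₂ z) z) {c₁ c₂ c₃ : ℝ} (h₁₂ : c₁ ≠ c₂)
    (h₁₃ : c₁ ≠ c₃) (h₂₃ : c₂ ≠ c₃) {R : ℝ → ℝ[X]}
    (hR : ∀ c, c = c₁ ∨ c = c₂ ∨ c = c₃ → (R c).natDegree ≤ 2 ∧ ∀ z ∈ Metric.ball w ε,
      A₂ z * (z + c) ^ 2 - 2 * (N + 1) * A₁ z * (z + c) + (N + 1) * (N + 2) * A z = (R c).eval z) :
    ∃ P : ℝ[X], P.natDegree ≤ 2 ∧ ∀ z ∈ Metric.ball w ε, A z = P.eval z := by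
  obtain ⟨P, hPd, hP, hPR⟩ := exists_polynomial_of_three_ratios (N := N) (n := 2) (R := R) hε hA hA₁ h₁₂ h₁₃ h₂₃ hR
  refine ⟨P, ?_, fun z hz => (hP z hz).1⟩
  have h5 : P.coeff 5 = 0 := coeff_eq_zero_of_natDegree_lt (by omega)
  have hco : ∀ c, c = c₁ ∨ c = c₂ ∨ c = c₃ →
      (2 - N) * (1 - N) * P.coeff 3 + 8 * (2 - N) * c * P.coeff 4 = 0 := by
    intro c hc
    have h1 : (ratioOperator N c P).coeff (1 + 2) = 0 := by
      rw [hPR c hc]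
      exact coeff_eq_zero_of_natDegree_lt ((hR c hc).1.trans_lt (by omega))
    rw [coeff_ratioOperator] at h1
    norm_num [h5] at h1
    linear_combination h1
  have g1 := hco c₁ (by simp)
  have g2 := hco c₂ (by simp)
  have e12 := sub_ne_zero.2 h₁₂
  have hN2 : 2 - N ≠ 0 := by linarith
  have hN1 : 1 - N ≠ 0 := by linarith
  have p4 : P.coeff 4 = 0 := by
    have : (8 * (2 - N) * (c₁ - c₂)) * P.coeff 4 = 0 := by linear_combination g1 - g2
    exact (mul_eq_zero.1 this).resolve_left (mul_ne_zero (mul_ne_zero (by norm_num) hN2) e12)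
  have p3 : P.coeff 3 = 0 := by
    have : ((2 - N) * (1 - N)) * P.coeff 3 = 0 := by
      rw [p4] at g1; linear_combination g1
    exact (mul_eq_zero.1 this).resolve_left (mul_ne_zero hN2 hN1)
  rw [natDegree_le_iff_coeff_eq_zero]
  intro k hk
  rcases Nat.lt_or_ge k 5 with hk' | hk'
  · rcases (show k = 3 ∨ k = 4 by omega) with rfl | rfl
    · exact p3
    · exact p4
  · exact coeff_eq_zero_of_natDegree_lt (by omega)

end Group

end SegreVeronese

namespace SegreVeronese

open ChartGeometry

/-! ### Varying the coordinates of one group -/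

section SetGroup

variable {k : ℕ} {d : Fin k → ℕ}

/-- Replace the coordinates of the `i`-th group by `y`. -/
def setGroup (x : Slot d → ℝ) (i : Fin k) (y : Fin (d i) → ℝ) : Slot d → ℝ :=
  fun s => Function.update (fun j r => x ⟨j, r⟩) i y s.1 s.2

@[simp] lemma setGroup_same (x : Slot d → ℝ) (i : Fin k) (y : Fin (d i) → ℝ) (r : Fin (d i)) :
    setGroup x i y ⟨i, r⟩ = y r := by
  simp [setGroup]

lemma setGroup_of_ne (x : Slot d → ℝ) {i j : Fin k} (h : j ≠ i) (y : Fin (d i) → ℝ)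
    (r : Fin (d j)) : setGroup x i y ⟨j, r⟩ = x ⟨j, r⟩ := by
  simp [setGroup, Function.update_of_ne h]

lemma setGroup_self (x : Slot d → ℝ) (i : Fin k) : setGroup x i (fun r => x ⟨i, r⟩) = x := by
  funext s
  obtain ⟨j, r⟩ := s
  by_cases h : j = i
  · subst h; simp
  · exact setGroup_of_ne x h _ r

lemma setGroup_update (x : Slot d → ℝ) (i : Fin k) (y : Fin (d i) → ℝ) (r : Fin (d i)) (z : ℝ) :
    setGroup x i (Function.update y r z) = Function.update (setGroup x i y) ⟨i, r⟩ z := by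
  funext s
  obtain ⟨j, q⟩ := s
  by_cases h : j = i
  · subst h
    rw [setGroup_same]
    by_cases hq : q = r
    · subst hq; simp
    · rw [Function.update_of_ne hq, update_mk_same _ _ hq, setGroup_same]
  · rw [setGroup_of_ne x h, update_mk_of_ne h, setGroup_of_ne x h]

lemma setGroup_mem_ball {x : Slot d → ℝ} {ε : ℝ} (hε : 0 < ε) {i : Fin k} {y : Fin (d i) → ℝ}
    (hy : y ∈ Metric.ball (fun r => x ⟨i, r⟩) ε) : setGroup x i y ∈ Metric.ball x ε := by
  rw [Metric.mem_ball, dist_pi_lt_iff hε] at hy ⊢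
  rintro ⟨j, r⟩
  by_cases h : j = i
  · subst h; rw [setGroup_same]; exact hy r
  · rw [setGroup_of_ne x h, dist_self]; exact hε

/-- Add the constant `c` to the function `∑_j b_j σ_j`. -/
def addConst (b : ℕ → ℝ) (c : ℝ) : ℕ → ℝ := b + Pi.single 0 c

lemma symAffine_single_zero {κ : Type*} [DecidableEq κ] (c : ℝ) (R : Finset κ) (y : κ → ℝ) :
    symAffine (Pi.single 0 c) R y = c := by
  have h : ∀ j, 1 ≤ j → j ≤ R.card → (Pi.single 0 c : ℕ → ℝ) j = 0 := fun j hj _ =>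
    Pi.single_eq_of_ne (M := fun _ => ℝ) (Nat.one_le_iff_ne_zero.1 hj) c
  rw [symAffine_eq_of_tail_zero h, Pi.single_eq_same]

lemma symAffine_addConst {κ : Type*} [DecidableEq κ] (b : ℕ → ℝ) (c : ℝ) (R : Finset κ)
    (y : κ → ℝ) : symAffine (addConst b c) R y = symAffine b R y + c := by
  rw [addConst, symAffine_add, symAffine_single_zero]

lemma shift_addConst (b : ℕ → ℝ) (c : ℝ) : shift (addConst b c) = shift b := by
  funext j
  simp [shift, addConst]

lemma addConst_of_pos (b : ℕ → ℝ) (c : ℝ) {j : ℕ} (hj : 0 < j) : addConst b c j = b j := by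
  simp [addConst, Pi.single_eq_of_ne hj.ne']

/-- The part of `affineFun d b` which does not depend on the `i`-th group of coordinates. -/
def outerConst (b : Fin k → ℕ → ℝ) (i : Fin k) (x : Slot d → ℝ) : ℝ :=
  ∑ j ∈ Finset.univ.erase i, symAffine (b j) Finset.univ fun r => x ⟨j, r⟩

lemma affineFun_eq_add_outerConst (b : Fin k → ℕ → ℝ) (i : Fin k) (x : Slot d → ℝ) :
    affineFun d b x = symAffine (b i) Finset.univ (fun r => x ⟨i, r⟩) + outerConst b i x := by
  rw [affineFun, ← Finset.add_sum_erase _ _ (Finset.mem_univ i), outerConst]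

lemma outerConst_setGroup (b : Fin k → ℕ → ℝ) (i : Fin k) (x : Slot d → ℝ) (y : Fin (d i) → ℝ) :
    outerConst b i (setGroup x i y) = outerConst b i x := by
  refine Finset.sum_congr rfl fun j hj => ?_
  simp only [setGroup_of_ne x (Finset.ne_of_mem_erase hj)]

lemma affineFun_setGroup (b : Fin k → ℕ → ℝ) (i : Fin k) (x : Slot d → ℝ) (y : Fin (d i) → ℝ) :
    affineFun d b (setGroup x i y) =
      symAffine (addConst (b i) (outerConst b i x)) Finset.univ y := by
  rw [affineFun_eq_add_outerConst b i, outerConst_setGroup, symAffine_addConst]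
  simp only [setGroup_same]

lemma slope_setGroup (b : Fin k → ℕ → ℝ) (i : Fin k) (x : Slot d → ℝ) (y : Fin (d i) → ℝ)
    (r : Fin (d i)) : slope b ⟨i, r⟩ (setGroup x i y) =
      symAffine (shift (b i)) (Finset.univ.erase r) y := by
  simp only [slope, setGroup_same]

lemma slope_setGroup_of_ne (b : Fin k → ℕ → ℝ) {i j : Fin k} (h : j ≠ i) (x : Slot d → ℝ)
    (y : Fin (d i) → ℝ) (r : Fin (d j)) : slope b ⟨j, r⟩ (setGroup x i y) = slope b ⟨j, r⟩ x := by
  simp only [slope, setGroup_of_ne x h]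

lemma Delta_setGroup (i : Fin k) (x : Slot d → ℝ) (y : Fin (d i) → ℝ) (r : Fin (d i)) :
    Delta d (setGroup x i y) ⟨i, r⟩ = ∏ q ∈ Finset.univ.erase r, (y r - y q) := by
  simp only [Delta, setGroup_same]

lemma Delta_setGroup_of_ne {i j : Fin k} (h : j ≠ i) (x : Slot d → ℝ) (y : Fin (d i) → ℝ)
    (r : Fin (d j)) : Delta d (setGroup x i y) ⟨j, r⟩ = Delta d x ⟨j, r⟩ := by
  simp only [Delta, setGroup_of_ne x h]

lemma symAffine_comp_perm {κ : Type*} [Fintype κ] (b : ℕ → ℝ) (σ : Equiv.Perm κ) (y : κ → ℝ) :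
    symAffine b Finset.univ (y ∘ σ) = symAffine b Finset.univ y := by
  rw [symAffine, symAffine, Finset.powerset_univ]
  refine Fintype.sum_equiv (Equiv.finsetCongr σ) _ _ fun T => ?_
  simp [Equiv.finsetCongr_apply, Finset.prod_map]

/-- A symmetric multi-affine function vanishing on a hyperplane `y_r = c` vanishes on all hyperplanes
`y_q = c`. -/
lemma symAffine_update_eq_zero {n : ℕ} {b : ℕ → ℝ} {r : Fin n} {c : ℝ}
    (h : ∀ y, symAffine b Finset.univ (Function.update y r c) = 0) (q : Fin n) (y : Fin n → ℝ) :
    symAffine b Finset.univ (Function.update y q c) = 0 := by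
  have : Function.update y q c =
      Function.update (y ∘ Equiv.swap r q) r c ∘ Equiv.swap r q := by
    funext p
    by_cases hp : p = q
    · subst hp; simp
    · have h1 : Equiv.swap r q p ≠ r := fun h' => hp (by
        rw [Equiv.swap_apply_eq_iff, Equiv.swap_apply_left] at h'; exact h')
      simp [Function.update_of_ne hp, Function.update_of_ne h1]
  rw [this, symAffine_comp_perm, h]

/-- A multi-affine function which vanishes on all hyperplanes `y_q = c` is a product. -/
lemma symAffine_eq_prod {κ : Type*} [DecidableEq κ] {R : Finset κ} {b : ℕ → ℝ} {c : ℝ}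
    (h : ∀ r ∈ R, ∀ y, symAffine b R (Function.update y r c) = 0) (y : κ → ℝ) :
    symAffine b R y = b R.card * ∏ r ∈ R, (y r - c) := by
  induction R using Finset.induction_on generalizing b with
  | empty => simp [symAffine]
  | insert r R hr ih =>
    have hupd : ∀ (b : ℕ → ℝ) (y : κ → ℝ) (z : ℝ),
        symAffine b R (Function.update y r z) = symAffine b R y := fun b y z =>
      symAffine_congr (fun _ _ => rfl) fun q hq =>
        Function.update_of_ne (ne_of_mem_of_not_mem hq hr) _ _
    have hex : ∀ y : κ → ℝ, symAffine b (insert r R) y =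
        symAffine b R y + y r * symAffine (shift b) R y := fun y => by
      rw [symAffine_erase b (Finset.mem_insert_self r R), Finset.erase_insert hr]
    have hfac : ∀ y : κ → ℝ, symAffine b (insert r R) y =
        (y r - c) * symAffine (shift b) R y := fun y => by
      have h1 := h r (Finset.mem_insert_self r R) y
      rw [hex, hupd, hupd, Function.update_self] at h1
      rw [hex]
      linear_combination h1
    have hs : ∀ q ∈ R, ∀ y, symAffine (shift b) R (Function.update y q c) = 0 := by
      intro q hq y
      have hqr : q ≠ r := ne_of_mem_of_not_mem hq hr
      have h1 := h q (Finset.mem_insert_of_mem hq) (Function.update y r (c + 1))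
      rw [hfac, Function.update_comm hqr.symm, Function.update_self, hupd] at h1
      simpa using h1
    rw [hfac, ih hs, Finset.prod_insert hr, Finset.card_insert_of_notMem hr, shift]
    ring

lemma affineFun_eq_prod {b : Fin k → ℕ → ℝ} {i : Fin k} {r : Fin (d i)} {c : ℝ}
    (h : ∀ x, affineFun d b (Function.update x ⟨i, r⟩ c) = 0) (x : Slot d → ℝ) :
    affineFun d b x = b i (d i) * ∏ q, (x ⟨i, q⟩ - c) := by
  have h1 : ∀ y, symAffine (addConst (b i) (outerConst b i x)) Finset.univ
      (Function.update y r c) = 0 := fun y => by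
    rw [← affineFun_setGroup, setGroup_update, h]
  conv_lhs => rw [← setGroup_self x i]
  rw [affineFun_setGroup, symAffine_eq_prod fun q _ y => symAffine_update_eq_zero h1 q y,
    addConst_of_pos _ _ (by simpa using r.pos)]
  simp

end SetGroup

namespace SeparableKahler

variable {k : ℕ} {d : Fin k → ℕ} {G : SeparableKahler d}

lemma slope_twistCoeff_eq_zero {i : Fin k} (hi : i ∉ G.support) (r : Fin (d i))
    (x : Slot d → ℝ) : slope G.twistCoeff ⟨i, r⟩ x = 0 := by
  have h : ∀ r : Fin (d i), G.twistCoeff i (r + 1) = 0 := fun r => by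
    rw [twistCoeff_succ]
    by_contra h
    exact hi (Finset.mem_filter.2 ⟨Finset.mem_univ i, r, h⟩)
  rw [slope, symAffine_eq_of_tail_zero]
  · have := h ⟨0, r.pos⟩
    simpa [shift] using this
  · intro j hj hj'
    have h1 : j + 1 ≤ d i := by
      have := r.pos
      simp at hj'; omega
    exact h ⟨j, by omega⟩

lemma symAffine_twistCoeff_eq_const {i : Fin k} (hi : i ∉ G.support) (y : Fin (d i) → ℝ) :
    symAffine (G.twistCoeff i) Finset.univ y = G.twistCoeff i 0 := by
  refine symAffine_eq_of_tail_zero (fun j hj hj' => ?_) y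
  rw [Finset.card_univ, Fintype.card_fin] at hj'
  have h : G.twistCoeff i ((⟨j - 1, by omega⟩ : Fin (d i)) + 1) = 0 := by
    rw [twistCoeff_succ]
    by_contra h
    exact hi (Finset.mem_filter.2 ⟨Finset.mem_univ i, _, h⟩)
  simpa [Nat.sub_add_cancel hj] using h

lemma exists_symAffine_shift_ne_zero {i : Fin k} (hi : i ∈ G.support) (r : Fin (d i)) :
    ∃ y, symAffine (shift (G.twistCoeff i)) (Finset.univ.erase r) y ≠ 0 := by
  by_contra! h
  obtain ⟨-, q, hq⟩ := Finset.mem_filter.1 hi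
  have := coeff_eq_zero_of_symAffine_eq_zero h q (by simp; omega)
  rw [shift, twistCoeff_succ] at this
  exact hq this

lemma exists_slope_ne_zero {i : Fin k} (hi : i ∈ G.support) (r : Fin (d i)) :
    ∃ x, slope G.twistCoeff ⟨i, r⟩ x ≠ 0 := by
  obtain ⟨y, hy⟩ := exists_symAffine_shift_ne_zero hi r
  exact ⟨setGroup 0 i y, by rwa [slope_setGroup]⟩

lemma mem_support_of_independentAt {s : Slot d} (h : G.IndependentAt s) : s.1 ∈ G.support := by
  by_contra hs
  have := (h 0 1 fun x => by
    rw [pd_twist, slope_twistCoeff_eq_zero hs s.2]; simp).2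
  exact one_ne_zero this

/-- `⟨μ, β⟩` and its partial derivative are linearly independent over `ℝ[x_s]` as soon as the
partial derivative does not vanish identically and `⟨μ, β⟩` does not vanish on a
hyperplane `x_s = c`. -/
lemma independentAt_of_ne_zero {s : Slot d} (hs : ∃ x, slope G.twistCoeff s x ≠ 0)
    (hind : ∀ c, ∃ x, affineFun d G.twistCoeff (Function.update x s c) ≠ 0) :
    G.IndependentAt s := by
  intro u v h
  have h' : ∀ (x : Slot d → ℝ) (z : ℝ), u.eval z * (affineFun d G.twistCoeff x +
      (z - x s) * slope G.twistCoeff s x) + v.eval z * slope G.twistCoeff s x = 0 := by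
    intro x z
    have := h (Function.update x s z)
    rwa [Function.update_self, twist_eq, affineFun_update, pd_twist, slope_update_self] at this
  obtain ⟨x₁, hx₁⟩ := hs
  set c := x₁ s - affineFun d G.twistCoeff x₁ / slope G.twistCoeff s x₁ with hc
  have h1 : ∀ z, u.eval z * (z - c) + v.eval z = 0 := by
    intro z
    refine mul_right_cancel₀ hx₁ ?_
    rw [zero_mul, ← h' x₁ z, hc]
    field_simp
    ring
  obtain ⟨x₂, hx₂⟩ := hind c
  rw [affineFun_update] at hx₂
  have hu : u = 0 := Polynomial.funext fun z => by
    rw [Polynomial.eval_zero]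
    refine (mul_eq_zero.1 ?_).resolve_right hx₂
    linear_combination h' x₂ z - slope G.twistCoeff s x₂ * h1 z
  refine ⟨hu, Polynomial.funext fun z => ?_⟩
  simpa [hu] using h1 z

end SeparableKahler

end SegreVeronese

namespace SegreVeronese

open ChartGeometry

namespace SeparableKahler

open Polynomial Topology

variable {k : ℕ} {d : Fin k → ℕ} {G : SeparableKahler d}

/-! ### Consequences of the extremality equation near a point -/

/-- The equation characterizing extremal geometries. -/
def ExtremalityEquation (G : SeparableKahler d) (b : Fin k → ℕ → ℝ) : Prop :=
  ∀ x ∈ G.U, ∑ s, G.density s x / Delta d x s = affineFun d b x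

/-- The coefficients of `⟨μ, β⟩` as a function of the coordinates of the `i`-th group. -/
def groupCoeff (G : SeparableKahler d) (x : Slot d → ℝ) (i : Fin k) : ℕ → ℝ :=
  addConst (G.twistCoeff i) (outerConst G.twistCoeff i x)

lemma symAffine_groupCoeff (x : Slot d → ℝ) (i : Fin k) (y : Fin (d i) → ℝ) :
    symAffine (G.groupCoeff x i) Finset.univ y = G.twist (setGroup x i y) := by
  rw [twist_eq, affineFun_setGroup, groupCoeff]

lemma shift_groupCoeff (x : Slot d → ℝ) (i : Fin k) :
    shift (G.groupCoeff x i) = shift (G.twistCoeff i) := shift_addConst _ _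

/-- The coefficient `∑_{u} A_u'' / Δ_u` of `⟨μ, β⟩²` arising from the variables outside
the `i`-th group. -/
def outerSum (G : SeparableKahler d) (i : Fin k) (x : Slot d → ℝ) : ℝ :=
  ∑ j ∈ Finset.univ.erase i, ∑ r, deriv (deriv (G.A ⟨j, r⟩)) (x ⟨j, r⟩) / Delta d x ⟨j, r⟩

lemma injective_of_Delta_ne {x : Slot d → ℝ} (i : Fin k) (h : ∀ s, Delta d x s ≠ 0) :
    Function.Injective fun r : Fin (d i) => x ⟨i, r⟩ := by
  intro r q hrq
  by_contra hne
  refine h ⟨i, r⟩ (Finset.prod_eq_zero (Finset.mem_erase.2 ⟨fun h' => hne h'.symm,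
    Finset.mem_univ q⟩) ?_)
  exact sub_eq_zero.2 hrq

lemma density_setGroup (i : Fin k) (x : Slot d → ℝ) (y : Fin (d i) → ℝ) (r : Fin (d i)) :
    G.density ⟨i, r⟩ (setGroup x i y) = quadTerm (G.groupCoeff x i)
      (deriv (deriv (G.A ⟨i, r⟩)))
      (fun z => -2 * ((∑ i, d i : ℕ) + 1) * deriv (G.A ⟨i, r⟩) z)
      (fun z => ((∑ i, d i : ℕ) + 1) * ((∑ i, d i : ℕ) + 2) * G.A ⟨i, r⟩ z) r y := by
  rw [density, quadTerm, symAffine_groupCoeff, shift_groupCoeff, slope_setGroup, setGroup_same]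
  ring

/-- The extremality equation as a function of the coordinates of one group. -/
lemma ExtremalityEquation.groupEquation {b : Fin k → ℕ → ℝ} (hb : G.ExtremalityEquation b)
    {x : Slot d → ℝ} {ε : ℝ} (hε : 0 < ε) (hx : Metric.ball x ε ⊆ G.U) (i : Fin k) :
    GroupEquation (G.groupCoeff x i) (G.outerSum i x) (fun r => deriv (deriv (G.A ⟨i, r⟩)))
      (fun r z => -2 * ((∑ i, d i : ℕ) + 1) * deriv (G.A ⟨i, r⟩) z)
      (fun r z => ((∑ i, d i : ℕ) + 1) * ((∑ i, d i : ℕ) + 2) * G.A ⟨i, r⟩ z)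
      (fun r => x ⟨i, r⟩) ε := by
  set p : ℝ := ∑ j ∈ Finset.univ.erase i, ∑ r, -2 * ((∑ i, d i : ℕ) + 1) *
    deriv (G.A ⟨j, r⟩) (x ⟨j, r⟩) * slope G.twistCoeff ⟨j, r⟩ x / Delta d x ⟨j, r⟩ with hp
  set q : ℝ := ∑ j ∈ Finset.univ.erase i, ∑ r, ((∑ i, d i : ℕ) + 1) * ((∑ i, d i : ℕ) + 2) *
    G.A ⟨j, r⟩ (x ⟨j, r⟩) * slope G.twistCoeff ⟨j, r⟩ x ^ 2 / Delta d x ⟨j, r⟩ with hq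
  refine ⟨addConst (b i + (-p) • G.groupCoeff x i) (outerConst b i x - q), fun y hy => ?_⟩
  have hX : setGroup x i y ∈ G.U := hx (setGroup_mem_ball hε hy)
  refine ⟨by simpa using injective_of_Delta_ne i (Delta_ne hX), ?_⟩
  have h := hb _ hX
  rw [Fintype.sum_sigma, ← Finset.add_sum_erase _ _ (Finset.mem_univ i)] at h
  simp only [density_setGroup, Delta_setGroup] at h
  have hout : ∑ j ∈ Finset.univ.erase i, ∑ r,
      G.density ⟨j, r⟩ (setGroup x i y) / Delta d (setGroup x i y) ⟨j, r⟩ =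
      G.outerSum i x * symAffine (G.groupCoeff x i) Finset.univ y ^ 2 +
        p * symAffine (G.groupCoeff x i) Finset.univ y + q := by
    rw [outerSum, hp, hq, Finset.sum_mul, Finset.sum_mul, ← Finset.sum_add_distrib,
      ← Finset.sum_add_distrib]
    refine Finset.sum_congr rfl fun j hj => ?_
    have hji := Finset.ne_of_mem_erase hj
    rw [Finset.sum_mul, Finset.sum_mul, ← Finset.sum_add_distrib, ← Finset.sum_add_distrib]
    refine Finset.sum_congr rfl fun r _ => ?_
    rw [density, setGroup_of_ne x hji, slope_setGroup_of_ne _ hji, Delta_setGroup_of_ne hji,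
      symAffine_groupCoeff]
    ring
  rw [hout, affineFun_setGroup, symAffine_addConst] at h
  rw [symAffine_addConst, symAffine_add, symAffine_smul]
  linarith

lemma exists_ball_subset {x : Slot d → ℝ} (hx : x ∈ G.U) :
    ∃ ε, 0 < ε ∧ Metric.ball x ε ⊆ G.U := Metric.isOpen_iff.1 G.isOpen_U x hx

lemma ball_subset_interval {x : Slot d → ℝ} {ε : ℝ} (hε : 0 < ε) (hx : Metric.ball x ε ⊆ G.U)
    (s : Slot d) {z : ℝ} (hz : z ∈ Metric.ball (x s) ε) : z ∈ G.interval s := by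
  refine ⟨Function.update x s z, hx ?_, by simp⟩
  rw [Metric.mem_ball, dist_pi_lt_iff hε]
  intro u
  by_cases h : u = s
  · subst h; simpa using hz
  · rw [Function.update_of_ne h, dist_self]; exact hε

/-- Outside the support, `A_{jr}''` is locally a polynomial, independent of `r`. -/
lemma ExtremalityEquation.exists_local_of_notMem [Nonempty (Slot d)] {b : Fin k → ℕ → ℝ}
    (hb : G.ExtremalityEquation b) {j : Fin k} (hj : j ∉ G.support) {x : Slot d → ℝ}
    (hx : x ∈ G.U) :
    ∃ f : ℝ[X], f.natDegree ≤ d j ∧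
      ∀ r, ∀ᶠ z in 𝓝 (x ⟨j, r⟩), deriv (deriv (G.A ⟨j, r⟩)) z = f.eval z := by
  obtain ⟨ε, hε, hball⟩ := exists_ball_subset hx
  obtain ⟨b', hb'⟩ := hb.groupEquation hε hball j
  have htwist : ∀ y : Fin (d j) → ℝ, symAffine (G.groupCoeff x j) Finset.univ y = G.twist x := by
    intro y
    rw [twist_eq, affineFun_eq_add_outerConst _ j, groupCoeff, symAffine_addConst,
      symAffine_twistCoeff_eq_const hj, symAffine_twistCoeff_eq_const hj]
  have hslope : ∀ r (y : Fin (d j) → ℝ),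
      symAffine (shift (G.groupCoeff x j)) (Finset.univ.erase r) y = 0 := by
    intro r y
    rw [shift_groupCoeff, ← slope_setGroup _ _ x, slope_twistCoeff_eq_zero hj]
  have hL := twist_ne hx
  have heq : GroupEquation (Pi.single 0 1) 0 (fun r => deriv (deriv (G.A ⟨j, r⟩))) 0 0
      (fun r => x ⟨j, r⟩) ε := by
    refine ⟨(1 / G.twist x ^ 2) • addConst b' (-(G.outerSum j x * G.twist x ^ 2)), fun y hy =>
      ⟨(hb' y hy).1, ?_⟩⟩
    have h := (hb' y hy).2
    rw [symAffine_smul, symAffine_addConst, ← h, htwist]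
    simp only [quadTerm, hslope, htwist]
    simp only [symAffine_single_zero, Pi.zero_apply]
    rw [add_neg_cancel_right, Finset.mul_sum, zero_mul, add_zero]
    refine Finset.sum_congr rfl fun r _ => ?_
    field_simp
    ring
  obtain ⟨f, hf, hf'⟩ := heq.exists_polynomial_of_const hε
  exact ⟨f, hf, fun r => Filter.eventually_of_mem (Metric.ball_mem_nhds _ hε) (hf' r)⟩

lemma hasDerivAt_A {s : Slot d} {z : ℝ} (hz : z ∈ G.interval s) :
    HasDerivAt (G.A s) (deriv (G.A s) z) z := (differentiableAt_A hz).hasDerivAt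

lemma hasDerivAt_deriv_A {s : Slot d} {z : ℝ} (hz : z ∈ G.interval s) :
    HasDerivAt (deriv (G.A s)) (deriv (deriv (G.A s)) z) z :=
  (differentiableAt_deriv_A hz).hasDerivAt

lemma symAffine_twistCoeff_analytic (i : Fin k) (c : ℝ) (y : Fin (d i) → ℝ) :
    AnalyticAt ℝ (fun y => symAffine (G.twistCoeff i) Finset.univ y - c) y :=
  (analyticAt_symAffine_self _ _ y).fun_sub analyticAt_const

lemma exists_symAffine_twistCoeff_ne {i : Fin k} (hi : i ∈ G.support) (c : ℝ) :
    ∃ y : Fin (d i) → ℝ, symAffine (G.twistCoeff i) Finset.univ y - c ≠ 0 := by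
  by_contra! h
  obtain ⟨-, r, -⟩ := Finset.mem_filter.1 hi
  obtain ⟨y, hy⟩ := exists_symAffine_shift_ne_zero hi r
  have h0 := h (Function.update y r 0)
  have h1 := h (Function.update y r 1)
  rw [symAffine_update_univ] at h0 h1
  exact hy (by linarith)

/-- The part of `⟨μ, β⟩` from outside the group `i` is not constant if the support contains another
group: it avoids two given numbers at some point with the given coordinates in the group `i`. -/
lemma exists_outerConst_ne {i j : Fin k} (hji : j ≠ i) (hj : j ∈ G.support) {x : Slot d → ℝ}
    {ε : ℝ} (hε : 0 < ε) (c₁ c₂ : ℝ) :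
    ∃ x' ∈ Metric.ball x ε, (∀ r, x' ⟨i, r⟩ = x ⟨i, r⟩) ∧
      outerConst G.twistCoeff i x' ≠ c₁ ∧ outerConst G.twistCoeff i x' ≠ c₂ := by
  set y₀ : Fin (d j) → ℝ := fun r => x ⟨j, r⟩ with hy₀
  set e := outerConst G.twistCoeff i x - symAffine (G.twistCoeff j) Finset.univ y₀ with he
  have hout : ∀ y, outerConst G.twistCoeff i (setGroup x j y) =
      symAffine (G.twistCoeff j) Finset.univ y + e := by
    intro y
    have hj' : j ∈ Finset.univ.erase i := Finset.mem_erase.2 ⟨hji, Finset.mem_univ j⟩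
    have h1 : ∀ x : Slot d → ℝ, outerConst G.twistCoeff i x =
        symAffine (G.twistCoeff j) Finset.univ (fun r => x ⟨j, r⟩) +
        ∑ l ∈ (Finset.univ.erase i).erase j,
          symAffine (G.twistCoeff l) Finset.univ fun r => x ⟨l, r⟩ := fun x =>
      (Finset.add_sum_erase _ (fun l => symAffine (G.twistCoeff l) Finset.univ
        fun r => x ⟨l, r⟩) hj').symm
    have h2 : ∑ l ∈ (Finset.univ.erase i).erase j, (symAffine (G.twistCoeff l) Finset.univ
        fun r => setGroup x j y ⟨l, r⟩) = ∑ l ∈ (Finset.univ.erase i).erase j,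
          symAffine (G.twistCoeff l) Finset.univ fun r => x ⟨l, r⟩ := by
      refine Finset.sum_congr rfl fun l hl => ?_
      simp only [setGroup_of_ne x (Finset.ne_of_mem_erase hl)]
    rw [he, h1, h1 x, h2]
    simp only [setGroup_same]
    ring
  obtain ⟨y₁, hy₁⟩ := exists_mem_ne_zero (symAffine_twistCoeff_analytic (G := G) j (c₁ - e))
    (exists_symAffine_twistCoeff_ne hj _) (Metric.isOpen_ball (x := y₀) (ε := ε))
    ⟨y₀, Metric.mem_ball_self hε⟩
  obtain ⟨y₂, hy₂, hy₂'⟩ := exists_mem_ne_zero (symAffine_twistCoeff_analytic (G := G) j (c₂ - e))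
    (exists_symAffine_twistCoeff_ne hj _)
    (isOpen_inter_ne_zero (symAffine_twistCoeff_analytic (G := G) j (c₁ - e)) Metric.isOpen_ball)
    ⟨y₁, hy₁⟩
  refine ⟨setGroup x j y₂, setGroup_mem_ball hε hy₂.1, fun r => setGroup_of_ne x hji.symm _ r, ?_, ?_⟩
  · intro h
    refine hy₂.2 ?_
    rw [hout] at h
    linarith
  · intro h
    refine hy₂' ?_
    rw [hout] at h
    linarith

/-- The group equation at a point for which `⟨μ, β⟩`, as a function of the coordinates of the group,
does not vanish on any hyperplane. -/
lemma ExtremalityEquation.exists_local_of_ne_zero {b : Fin k → ℕ → ℝ}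
    (hb : G.ExtremalityEquation b) {i : Fin k} (hi : i ∈ G.support)
    (hN : d i + 1 ≤ ∑ i, d i) {x : Slot d → ℝ} {ε : ℝ} (hε : 0 < ε)
    (hball : Metric.ball x ε ⊆ G.U)
    (hind : ∀ (r : Fin (d i)) (c : ℝ),
      ∃ y, symAffine (G.groupCoeff x i) Finset.univ (Function.update y r c) ≠ 0) :
    ∃ P : ℝ[X], P.natDegree ≤ d i + 1 ∧
      ∀ r, ∀ᶠ z in 𝓝 (x ⟨i, r⟩), G.A ⟨i, r⟩ z = P.eval z := by
  obtain ⟨-, r₀, -⟩ := Finset.mem_filter.1 hi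
  obtain ⟨P, hP, hP'⟩ := (hb.groupEquation hε hball i).exists_common_polynomial
    (N := (∑ i, d i : ℕ)) (A := fun r => G.A ⟨i, r⟩) (A₁ := fun r => deriv (G.A ⟨i, r⟩)) hε r₀.pos
    (by exact_mod_cast hN) ⟨_, rfl⟩
    (fun r z hz => hasDerivAt_A (ball_subset_interval hε hball ⟨i, r⟩ hz))
    (fun r z hz => hasDerivAt_deriv_A (ball_subset_interval hε hball ⟨i, r⟩ hz))
    (fun r => by rw [shift_groupCoeff]; exact exists_symAffine_shift_ne_zero hi r) hind
  exact ⟨P, hP, fun r => Filter.eventually_of_mem (Metric.ball_mem_nhds _ hε) (hP' r)⟩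

lemma ball_subset_of_mem_half {x x' : Slot d → ℝ} {ε : ℝ} (h : Metric.ball x ε ⊆ G.U)
    (hx' : x' ∈ Metric.ball x (ε / 2)) : Metric.ball x' (ε / 2) ⊆ G.U := by
  refine (Metric.ball_subset_ball' ?_).trans h
  have := Metric.mem_ball.1 hx'
  linarith

/-- If the support consists of a single group, then `⟨μ, β⟩` depends on this group only. -/
lemma outerConst_eq_of_support_subset {i : Fin k} (h : G.support ⊆ {i}) (x x' : Slot d → ℝ) :
    outerConst G.twistCoeff i x = outerConst G.twistCoeff i x' := by
  refine Finset.sum_congr rfl fun j hj => ?_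
  have hjs : j ∉ G.support := fun hjs =>
    Finset.ne_of_mem_erase hj (Finset.mem_singleton.1 (h hjs))
  rw [symAffine_twistCoeff_eq_const hjs, symAffine_twistCoeff_eq_const hjs]

/-- In the independent case `A_{ir}`, for `i` in the support, is locally a polynomial,
independent of `r`. -/
theorem ExtremalityEquation.exists_local_of_mem {b : Fin k → ℕ → ℝ}
    (hb : G.ExtremalityEquation b) {i : Fin k} (hi : i ∈ G.support)
    (hN : d i + 1 ≤ ∑ i, d i) (hN3 : 3 ≤ ∑ i, d i)
    (hind : ∀ (r : Fin (d i)) (c : ℝ),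
      ∃ x, affineFun d G.twistCoeff (Function.update x ⟨i, r⟩ c) ≠ 0)
    {x : Slot d → ℝ} (hx : x ∈ G.U) :
    ∃ P : ℝ[X], P.natDegree ≤ d i + 1 ∧
      ∀ r, ∀ᶠ z in 𝓝 (x ⟨i, r⟩), G.A ⟨i, r⟩ z = P.eval z := by
  obtain ⟨ε, hε, hball⟩ := exists_ball_subset hx
  by_cases hS : G.support ⊆ {i}
  · refine hb.exists_local_of_ne_zero hi hN hε hball fun r c => ?_
    obtain ⟨x', hx'⟩ := hind r c
    refine ⟨fun q => x' ⟨i, q⟩, ?_⟩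
    rwa [groupCoeff, outerConst_eq_of_support_subset hS x x', ← affineFun_setGroup,
      setGroup_update, setGroup_self]
  · obtain ⟨j, hj, hji⟩ := Finset.not_subset.1 hS
    rw [Finset.mem_singleton] at hji
    have hε2 : 0 < ε / 2 := by linarith
    -- in a group of at least two coordinates, `⟨μ, β⟩` vanishes on hyperplanes for at most one value
    -- of its part from the other groups; a single coordinate requires three of these values
    rcases Nat.lt_or_ge 1 (d i) with hd | hd
    · by_cases hloc : ∀ (r : Fin (d i)) (c : ℝ),
        ∃ y, symAffine (G.groupCoeff x i) Finset.univ (Function.update y r c) ≠ 0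
      · exact hb.exists_local_of_ne_zero hi hN hε hball hloc
      · push Not at hloc
        obtain ⟨r, c, hrc⟩ := hloc
        obtain ⟨x', hx', hxi, hne, -⟩ := exists_outerConst_ne (G := G) hji hj (x := x) hε2
          (outerConst G.twistCoeff i x) 0
        obtain ⟨P, hP, hP'⟩ := hb.exists_local_of_ne_zero hi hN hε2
          (ball_subset_of_mem_half hball hx') fun r' c' => by
            by_contra! h
            -- two products with the same leading coefficient which differ by a constant agree
            let y : Fin (d i) → ℝ := fun q => if q = ⟨0, by omega⟩ then c else c'
            have h1 := symAffine_eq_prod (fun q _ y => symAffine_update_eq_zero hrc q y) y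
            have h2 := symAffine_eq_prod (fun q _ y => symAffine_update_eq_zero h q y) y
            rw [Finset.prod_eq_zero (Finset.mem_univ ⟨0, by omega⟩) (by simp [y]), mul_zero,
              groupCoeff, symAffine_addConst] at h1
            rw [Finset.prod_eq_zero (Finset.mem_univ ⟨1, hd⟩) (by simp [y]), mul_zero,
              groupCoeff, symAffine_addConst] at h2
            exact hne (by linarith)
        refine ⟨P, hP, fun r => ?_⟩
        rw [← hxi r]
        exact hP' r
    · obtain ⟨-, r₀, -⟩ := Finset.mem_filter.1 hi
      have hd1 : d i = 1 := le_antisymm hd r₀.pos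
      obtain ⟨x₁, hx₁, hxi₁, -, -⟩ := exists_outerConst_ne (G := G) hji hj (x := x) hε2 0 0
      obtain ⟨x₂, hx₂, hxi₂, h₂₁, -⟩ := exists_outerConst_ne (G := G) hji hj (x := x) hε2
        (outerConst G.twistCoeff i x₁) 0
      obtain ⟨x₃, hx₃, hxi₃, h₃₁, h₃₂⟩ := exists_outerConst_ne (G := G) hji hj (x := x) hε2
        (outerConst G.twistCoeff i x₁) (outerConst G.twistCoeff i x₂)
      have hsub : Subsingleton (Fin (d i)) := by rw [hd1]; infer_instance
      have herase : Finset.univ.erase r₀ = ∅ := by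
        rw [← Finset.card_eq_zero, Finset.card_erase_of_mem (Finset.mem_univ _)]
        simp [hd1]
      set l := G.twistCoeff i 1 with hl
      have hslope : ∀ y : Fin (d i) → ℝ,
          symAffine (shift (G.twistCoeff i)) (Finset.univ.erase r₀) y = l := by
        intro y; rw [herase]; simp [symAffine, shift, hl]
      have hl0 : l ≠ 0 := by
        obtain ⟨y, hy⟩ := exists_symAffine_shift_ne_zero hi r₀
        rwa [hslope] at hy
      let ratio : (Slot d → ℝ) → ℝ := fun x =>
        (G.twistCoeff i 0 + outerConst G.twistCoeff i x) / l
      have hratio : ∀ x, symAffine (G.groupCoeff x i) (Finset.univ.erase r₀)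
          (fun r => x ⟨i, r⟩) / symAffine (shift (G.groupCoeff x i)) (Finset.univ.erase r₀)
            (fun r => x ⟨i, r⟩) = ratio x := by
        intro x
        rw [shift_groupCoeff, hslope, groupCoeff, symAffine_addConst, herase]
        simp [symAffine, ratio]
      have hrne : ∀ x x', outerConst G.twistCoeff i x ≠ outerConst G.twistCoeff i x' →
          ratio x ≠ ratio x' := by
        intro x x' h h'
        rw [div_left_inj' hl0] at h'
        exact h (by linarith)
      have hR : ∀ x' ∈ Metric.ball x (ε / 2), (∀ r, x' ⟨i, r⟩ = x ⟨i, r⟩) →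
          ∃ R : ℝ[X], R.natDegree ≤ 2 ∧ ∀ z ∈ Metric.ball (x ⟨i, r₀⟩) (ε / 2),
            deriv (deriv (G.A ⟨i, r₀⟩)) z * (z + ratio x') ^ 2 -
              2 * ((∑ i, d i : ℕ) + 1) * deriv (G.A ⟨i, r₀⟩) z * (z + ratio x') +
              ((∑ i, d i : ℕ) + 1) * ((∑ i, d i : ℕ) + 2) * G.A ⟨i, r₀⟩ z = R.eval z := by
        intro x' hx' hxi
        obtain ⟨R, hRd, -, hR⟩ := (hb.groupEquation hε2
          (ball_subset_of_mem_half hball hx') i).exists_ratio_slice (N := (∑ i, d i : ℕ))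
          (A := fun r => G.A ⟨i, r⟩) (A₁ := fun r => deriv (G.A ⟨i, r⟩)) hε2 r₀
          (Metric.mem_ball_self hε2) (by rw [shift_groupCoeff, hslope]; exact hl0)
        rw [hratio, hxi] at hR
        exact ⟨R, by omega, hR⟩
      have h12 := hrne _ _ h₂₁.symm
      have h13 := hrne _ _ h₃₁.symm
      have h23 := hrne _ _ h₃₂.symm
      have hR' : ∀ c, c = ratio x₁ ∨ c = ratio x₂ ∨ c = ratio x₃ →
          ∃ R : ℝ[X], R.natDegree ≤ 2 ∧ ∀ z ∈ Metric.ball (x ⟨i, r₀⟩) (ε / 2),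
            deriv (deriv (G.A ⟨i, r₀⟩)) z * (z + c) ^ 2 -
              2 * ((∑ i, d i : ℕ) + 1) * deriv (G.A ⟨i, r₀⟩) z * (z + c) +
              ((∑ i, d i : ℕ) + 1) * ((∑ i, d i : ℕ) + 2) * G.A ⟨i, r₀⟩ z = R.eval z := by
        rintro c (rfl | rfl | rfl)
        · exact hR x₁ hx₁ hxi₁
        · exact hR x₂ hx₂ hxi₂
        · exact hR x₃ hx₃ hxi₃
      choose! R hRR using hR'
      have hballx : Metric.ball x (ε / 2) ⊆ G.U :=
        (Metric.ball_subset_ball (by linarith)).trans hball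
      obtain ⟨P, hP, hP'⟩ := exists_polynomial_of_single (N := (∑ i, d i : ℕ))
        (by exact_mod_cast hN3) hε2
        (fun z hz => hasDerivAt_A (ball_subset_interval hε2 hballx ⟨i, r₀⟩ hz))
        (fun z hz => hasDerivAt_deriv_A (ball_subset_interval hε2 hballx ⟨i, r₀⟩ hz))
        h12 h13 h23 hRR
      refine ⟨P, by omega, fun r => ?_⟩
      rw [Subsingleton.elim r r₀]
      exact Filter.eventually_of_mem (Metric.ball_mem_nhds _ hε2) hP'

end SeparableKahler

end SegreVeronese

namespace SegreVeronese

open ChartGeometry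

namespace SeparableKahler

open Polynomial Topology

variable {k : ℕ} {d : Fin k → ℕ} {G : SeparableKahler d}

/-! ### Polynomials on the intervals of values of the coordinates -/

lemma exists_global {i : Fin k} {f : Fin (d i) → ℝ → ℝ} {p : ℝ[X] → Prop}
    (h : ∀ x ∈ G.U, ∃ P : ℝ[X], p P ∧ ∀ r, ∀ᶠ z in 𝓝 (x ⟨i, r⟩), f r z = P.eval z) :
    ∃ P : ℝ[X], p P ∧ ∀ r, ∀ z ∈ G.interval ⟨i, r⟩, f r z = P.eval z := by
  obtain ⟨x₀, hx₀⟩ := G.isConnected_U.nonempty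
  obtain ⟨P, hp, hP⟩ := h x₀ hx₀
  refine ⟨P, hp, fun r => eqOn_polynomial_of_locally (G.isPreconnected_interval ⟨i, r⟩) ?_
    (mem_interval hx₀ ⟨i, r⟩) (hP r)⟩
  rintro z ⟨x, hx, rfl⟩
  obtain ⟨Q, -, hQ⟩ := h x hx
  exact ⟨Q, hQ r⟩

lemma deriv_A_eq {s : Slot d} {P : ℝ[X]} (h : ∀ z ∈ G.interval s, G.A s z = P.eval z) :
    (∀ z ∈ G.interval s, deriv (G.A s) z = P.derivative.eval z) ∧
      ∀ z ∈ G.interval s, deriv (deriv (G.A s)) z = P.derivative.derivative.eval z := by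
  have key : ∀ (f : ℝ → ℝ) (Q : ℝ[X]), (∀ z ∈ G.interval s, f z = Q.eval z) →
      ∀ z ∈ G.interval s, deriv f z = Q.derivative.eval z := by
    intro f Q hf z hz
    rw [Filter.EventuallyEq.deriv_eq (Filter.eventually_of_mem
      ((G.isOpen_interval s).mem_nhds hz) hf), Polynomial.deriv]
  exact ⟨key _ _ h, key _ _ (key _ _ h)⟩

lemma update_mem_U {x : Slot d → ℝ} (hx : x ∈ G.U) (s : Slot d) :
    ∃ ε > 0, ∀ δ, |δ| < ε → Function.update x s (x s + δ) ∈ G.U := by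
  obtain ⟨ε, hε, hball⟩ := exists_ball_subset hx
  refine ⟨ε, hε, fun δ hδ => hball ?_⟩
  rw [Metric.mem_ball, dist_pi_lt_iff hε]
  intro u
  by_cases h : u = s
  · subst h; simpa using hδ
  · rw [Function.update_of_ne h, dist_self]; exact hε

/-- If the support is not empty, the polynomials `A_{jr}''` outside the support have degree at most
`d_j - 1`: the coefficient of degree `d_j` would give rise to a term `⟨μ, β⟩² σ₁` which is not
multi-affine. -/
lemma ExtremalityEquation.natDegree_le_of_notMem [Nonempty (Slot d)] {b : Fin k → ℕ → ℝ}
    (hb : G.ExtremalityEquation b) {i j : Fin k} (hj : j ∉ G.support) (hi : i ∈ G.support)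
    {f : ℝ[X]} (hf : f.natDegree ≤ d j)
    (hA : ∀ r, ∀ z ∈ G.interval ⟨j, r⟩, deriv (deriv (G.A ⟨j, r⟩)) z = f.eval z) :
    f.natDegree ≤ d j - 1 := by
  rcases Nat.eq_zero_or_pos (d j) with h0 | h0
  · omega
  let r₀ : Fin (d j) := ⟨0, h0⟩
  have hij : i ≠ j := fun h => hj (h ▸ hi)
  have htw : ∀ x y, G.twist (setGroup x j y) = G.twist x := by
    intro x y
    rw [← symAffine_groupCoeff, groupCoeff, symAffine_addConst, symAffine_twistCoeff_eq_const hj,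
      twist_eq, affineFun_eq_add_outerConst _ j, symAffine_twistCoeff_eq_const hj]
  have hsum : ∀ (x : Slot d → ℝ) (y : Fin (d j) → ℝ), setGroup x j y ∈ G.U →
      G.twist x ^ 2 * (f.coeff (d j - 1) + f.coeff (d j) * ∑ r, y r) +
        ∑ l ∈ Finset.univ.erase j, ∑ r, G.density ⟨l, r⟩ x / Delta d x ⟨l, r⟩ =
      affineFun d b (setGroup x j y) := by
    intro x y hX
    have hinj : Function.Injective y := by simpa using injective_of_Delta_ne j (Delta_ne hX)
    rw [← hb _ hX, Fintype.sum_sigma, ← Finset.add_sum_erase _ _ (Finset.mem_univ j)]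
    congr 1
    · rw [← sum_eval_div_of_natDegree_le h0 hinj hf, Finset.mul_sum]
      refine Finset.sum_congr rfl fun r _ => ?_
      have hz := mem_interval hX ⟨j, r⟩
      rw [setGroup_same] at hz
      rw [density, slope_twistCoeff_eq_zero hj, htw, Delta_setGroup, setGroup_same, hA r _ hz]
      ring
    · refine Finset.sum_congr rfl fun l hl => Finset.sum_congr rfl fun r _ => ?_
      have hlj := Finset.ne_of_mem_erase hl
      rw [density, density, htw, setGroup_of_ne x hlj, slope_setGroup_of_ne _ hlj,
        Delta_setGroup_of_ne hlj]
  have hcoef : ∀ x ∈ G.U, f.coeff (d j) * G.twist x ^ 2 = slope b ⟨j, r₀⟩ x := by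
    intro x hx
    obtain ⟨ε, hε, hU⟩ := update_mem_U hx ⟨j, r₀⟩
    have hx' := hU (ε / 2) (by rw [abs_of_pos (by linarith)]; linarith)
    have h1 := hsum x (fun r => x ⟨j, r⟩) (by rwa [setGroup_self])
    have h2 := hsum x (Function.update (fun r => x ⟨j, r⟩) r₀ (x ⟨j, r₀⟩ + ε / 2))
      (by rwa [setGroup_update, setGroup_self])
    rw [setGroup_self] at h1
    rw [setGroup_update, setGroup_self, affineFun_update,
      Finset.sum_update_of_mem (Finset.mem_univ r₀)] at h2
    rw [← Finset.add_sum_erase _ _ (Finset.mem_univ r₀)] at h1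
    rw [Finset.sdiff_singleton_eq_erase] at h2
    have h3 : (ε / 2) * (f.coeff (d j) * G.twist x ^ 2) = (ε / 2) * slope b ⟨j, r₀⟩ x := by
      linear_combination h2 - h1
    exact mul_left_cancel₀ (by positivity) h3
  have hfn : f.coeff (d j) = 0 := by
    by_contra hfn
    obtain ⟨-, q, -⟩ := Finset.mem_filter.1 hi
    obtain ⟨x, hx, hl⟩ := exists_mem_ne_zero (analyticAt_slope (d := d) G.twistCoeff ⟨i, q⟩)
      (exists_slope_ne_zero hi q) G.isOpen_U G.isConnected_U.nonempty
    obtain ⟨ε, hε, hU⟩ := update_mem_U hx ⟨i, q⟩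
    have key : ∀ δ, |δ| < ε → δ * slope G.twistCoeff ⟨i, q⟩ x *
        (2 * G.twist x + δ * slope G.twistCoeff ⟨i, q⟩ x) = 0 := by
      intro δ hδ
      have h1 := hcoef _ (hU δ hδ)
      rw [slope_update_of_ne _ (by exact hij.symm), ← hcoef x hx, twist_eq, affineFun_update,
        ← twist_eq] at h1
      have h2 := mul_left_cancel₀ hfn h1
      linear_combination h2
    have h1 := key (ε / 2) (by rw [abs_of_pos (by linarith)]; linarith)
    have h2 := key (-(ε / 2)) (by rw [abs_neg, abs_of_pos (by linarith)]; linarith)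
    have hε' : ε / 2 ≠ 0 := by positivity
    have h3 := (mul_eq_zero.1 h1).resolve_left (mul_ne_zero hε' hl)
    have h4 := (mul_eq_zero.1 h2).resolve_left (mul_ne_zero (neg_ne_zero.2 hε') hl)
    exact twist_ne hx (by linarith)
  rw [natDegree_le_iff_coeff_eq_zero]
  intro m hm
  rcases Nat.eq_or_lt_of_le (show d j ≤ m by omega) with h | h
  · rwa [← h]
  · exact coeff_eq_zero_of_natDegree_lt (by omega)

/-! ### The local equation for decomposable `⟨μ, β⟩` -/

lemma twist_eq_sub_mul_slope {p : Fin k} {t c : ℝ}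
    (h : ∀ x, G.twist x = t * ∏ q, (x ⟨p, q⟩ - c)) (r : Fin (d p)) (x : Slot d → ℝ) :
    G.twist x = (x ⟨p, r⟩ - c) * slope G.twistCoeff ⟨p, r⟩ x := by
  have h1 : G.twist (Function.update x ⟨p, r⟩ c) = 0 := by
    rw [h, Finset.prod_eq_zero (Finset.mem_univ r) (by simp), mul_zero]
  rw [twist_eq, affineFun_update, ← twist_eq] at h1
  linear_combination h1

/-- If `⟨μ, β⟩ = t ∏_q (x_{pq} - c)`, the extremality equation determines the functions
`(x - c)^{m+3} (A_{pq} / (x - c)^{m+1})''` near a point. -/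
lemma ExtremalityEquation.exists_local_of_prod [Nonempty (Slot d)] {b : Fin k → ℕ → ℝ}
    (hb : G.ExtremalityEquation b) {p : Fin k} (hp : 0 < d p) {t c : ℝ}
    (h : ∀ x, G.twist x = t * ∏ q, (x ⟨p, q⟩ - c)) {x : Slot d → ℝ} (hx : x ∈ G.U) :
    ∃ P : ℝ[X], P.natDegree ≤ d p + 1 ∧ P.coeff (d p + 1) = -G.outerSum p x ∧
      ∀ r, ∀ᶠ z in 𝓝 (x ⟨p, r⟩), deriv (deriv (G.A ⟨p, r⟩)) z * (z - c) ^ 2 -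
        2 * ((∑ i, d i : ℕ) + 1) * deriv (G.A ⟨p, r⟩) z * (z - c) +
        ((∑ i, d i : ℕ) + 1) * ((∑ i, d i : ℕ) + 2) * G.A ⟨p, r⟩ z = P.eval z := by
  obtain ⟨ε, hε, hball⟩ := exists_ball_subset hx
  obtain ⟨b', hb'⟩ := hb.groupEquation hε hball p
  have hfac : ∀ (r : Fin (d p)) (y : Fin (d p) → ℝ), symAffine (G.groupCoeff x p) Finset.univ y =
      (y r - c) * symAffine (shift (G.groupCoeff x p)) (Finset.univ.erase r) y := by
    intro r y
    rw [symAffine_groupCoeff, twist_eq_sub_mul_slope h r, slope_setGroup, shift_groupCoeff,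
      setGroup_same]
  have heq : GroupEquation (G.groupCoeff x p) (G.outerSum p x) 0 0
      (fun r z => deriv (deriv (G.A ⟨p, r⟩)) z * (z - c) ^ 2 -
        2 * ((∑ i, d i : ℕ) + 1) * deriv (G.A ⟨p, r⟩) z * (z - c) +
        ((∑ i, d i : ℕ) + 1) * ((∑ i, d i : ℕ) + 2) * G.A ⟨p, r⟩ z) (fun r => x ⟨p, r⟩) ε := by
    refine ⟨b', fun y hy => ⟨(hb' y hy).1, ?_⟩⟩
    rw [← (hb' y hy).2]
    congr 1
    refine Finset.sum_congr rfl fun r _ => ?_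
    simp only [quadTerm, Pi.zero_apply, hfac r y]
    ring
  obtain ⟨P, hPd, hPc, hP⟩ := heq.exists_polynomial_of_slope_ne_zero hε hp fun r y hy hl =>
    twist_ne (hball (setGroup_mem_ball hε hy)) (by
      rw [← symAffine_groupCoeff, hfac r y, hl, mul_zero])
  exact ⟨P, hPd, hPc, fun r => Filter.eventually_of_mem (Metric.ball_mem_nhds _ hε) (hP r)⟩

/-! ### The quadratic form in the parts of `⟨μ, β⟩` -/

/-- The part of `⟨μ, β⟩` which depends on the `i`-th group of coordinates. -/
def groupPart (G : SeparableKahler d) (i : Fin k) (x : Slot d → ℝ) : ℝ :=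
  symAffine (G.twistCoeff i) Finset.univ fun r => x ⟨i, r⟩

/-- The quadratic form in `⟨μ, β⟩` and its parts `M_i` which represents the left hand side of the
extremality equation modulo functions `⟨μ, h⟩`, in terms of the leading coefficients `γ_i` of the
polynomials `A_{ir}`, for `i` in the support, and the constant `Γ = ∑_u A_u'' / Δ_u`, summed over
the variables outside the support. -/
def quadForm (G : SeparableKahler d) (γ : Fin k → ℝ) (Γ : ℝ) (x : Slot d → ℝ) : ℝ :=
  ∑ i ∈ G.support, γ i * (d i * (d i + 1) * G.twist x ^ 2 -
    2 * (d i + 1) * ((∑ i, d i : ℕ) + 1) * (G.twist x * G.groupPart i x) +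
    ((∑ i, d i : ℕ) + 1) * ((∑ i, d i : ℕ) + 2) * G.groupPart i x ^ 2) + Γ * G.twist x ^ 2

lemma sum_density_of_notMem {j : Fin k} (hj : j ∉ G.support) (hd : 0 < d j) {f : ℝ[X]}
    (hf : f.natDegree ≤ d j - 1)
    (hA : ∀ r, ∀ z ∈ G.interval ⟨j, r⟩, deriv (deriv (G.A ⟨j, r⟩)) z = f.eval z)
    {x : Slot d → ℝ} (hx : x ∈ G.U) :
    ∑ r, G.density ⟨j, r⟩ x / Delta d x ⟨j, r⟩ = f.coeff (d j - 1) * G.twist x ^ 2 := by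
  have h0 : f.coeff (d j) = 0 := coeff_eq_zero_of_natDegree_lt (by omega)
  have h := sum_eval_div_of_natDegree_le hd (injective_of_Delta_ne j (Delta_ne hx))
    (f := f) (by omega)
  rw [h0, zero_mul, add_zero] at h
  rw [← h, Finset.sum_mul]
  refine Finset.sum_congr rfl fun r _ => ?_
  rw [density, slope_twistCoeff_eq_zero hj, hA r _ (mem_interval hx _), Delta]
  ring

/-- The contribution of a group inside the support to the quadratic form, by Lagrange summation. -/
lemma exists_sum_density_of_mem {i : Fin k} (hd : 0 < d i) {f : ℝ[X]}
    (hf : f.natDegree ≤ d i + 1)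
    (hA : ∀ r, ∀ z ∈ G.interval ⟨i, r⟩, G.A ⟨i, r⟩ z = f.eval z) :
    ∃ (e : ℝ) (b' : ℕ → ℝ), ∀ x ∈ G.U, ∑ r, G.density ⟨i, r⟩ x / Delta d x ⟨i, r⟩ =
      f.coeff (d i + 1) * (d i * (d i + 1) * G.twist x ^ 2 -
        2 * (d i + 1) * ((∑ i, d i : ℕ) + 1) * (G.twist x * G.groupPart i x) +
        ((∑ i, d i : ℕ) + 1) * ((∑ i, d i : ℕ) + 2) * G.groupPart i x ^ 2) +
        e * G.twist x + symAffine b' Finset.univ (fun r => x ⟨i, r⟩) := by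
  have hf1 : f.derivative.natDegree ≤ d i := (natDegree_derivative_le f).trans (by omega)
  have hf2 : f.derivative.derivative.natDegree ≤ d i - 1 :=
    (natDegree_derivative_le _).trans (by omega)
  have h0 : f.derivative.derivative.coeff (d i) = 0 := coeff_eq_zero_of_natDegree_lt (by omega)
  obtain ⟨e, he⟩ := exists_sum_eval_mul_slope_div hd hf1 (G.twistCoeff i)
  obtain ⟨b', hb'⟩ := exists_sum_eval_mul_slope_sq_div hd hf (G.twistCoeff i)
  refine ⟨-2 * ((∑ i, d i : ℕ) + 1) * e,
    (((∑ i, d i : ℕ) + 1) * ((∑ i, d i : ℕ) + 2) : ℝ) • b', fun x hx => ?_⟩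
  have hinj := injective_of_Delta_ne i (Delta_ne hx)
  have g1 := he _ hinj
  have g2 := hb' _ hinj
  have g0 := sum_eval_div_of_natDegree_le hd hinj (f := f.derivative.derivative) (by omega)
  rw [h0, zero_mul, add_zero, coeff_derivative, coeff_derivative,
    show d i - 1 + 1 = d i by omega] at g0
  rw [coeff_derivative] at g1
  have hcast : ((d i - 1 : ℕ) : ℝ) = d i - 1 := by
    rw [Nat.cast_sub (by omega)]; simp
  rw [hcast] at g0
  have hsplit : ∑ r, G.density ⟨i, r⟩ x / Delta d x ⟨i, r⟩ =
      G.twist x ^ 2 * (∑ r, f.derivative.derivative.eval (x ⟨i, r⟩) /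
        ∏ q ∈ Finset.univ.erase r, (x ⟨i, r⟩ - x ⟨i, q⟩)) -
      2 * ((∑ i, d i : ℕ) + 1) * G.twist x * (∑ r, f.derivative.eval (x ⟨i, r⟩) *
        symAffine (shift (G.twistCoeff i)) (Finset.univ.erase r) (fun q => x ⟨i, q⟩) /
        ∏ q ∈ Finset.univ.erase r, (x ⟨i, r⟩ - x ⟨i, q⟩)) +
      ((∑ i, d i : ℕ) + 1) * ((∑ i, d i : ℕ) + 2) * (∑ r, f.eval (x ⟨i, r⟩) *
        symAffine (shift (G.twistCoeff i)) (Finset.univ.erase r) (fun q => x ⟨i, q⟩) ^ 2 /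
        ∏ q ∈ Finset.univ.erase r, (x ⟨i, r⟩ - x ⟨i, q⟩)) := by
    rw [Finset.mul_sum, Finset.mul_sum, Finset.mul_sum, ← Finset.sum_sub_distrib,
      ← Finset.sum_add_distrib]
    refine Finset.sum_congr rfl fun r _ => ?_
    obtain ⟨e1, e2⟩ := deriv_A_eq (hA r)
    have hz := mem_interval hx ⟨i, r⟩
    rw [density, hA r _ hz, e1 _ hz, e2 _ hz, Delta, slope]
    ring
  rw [hsplit, g0, g1, g2, symAffine_smul, groupPart]
  ring

/-- For polynomials `A_{ir}` of the admissible degrees, the left hand side of the extremality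
equation is a quadratic form in the parts of `⟨μ, β⟩`, modulo functions `⟨μ, h⟩`. -/
theorem exists_sum_density_eq_quadForm (hd : ∀ i, 0 < d i) {Υ : Fin k → ℝ[X]}
    (h₁ : ∀ i ∈ G.support, (Υ i).natDegree ≤ d i + 1 ∧
      ∀ r, ∀ z ∈ G.interval ⟨i, r⟩, G.A ⟨i, r⟩ z = (Υ i).eval z)
    (h₂ : ∀ i ∉ G.support, (Υ i).natDegree ≤ d i - 1 ∧
      ∀ r, ∀ z ∈ G.interval ⟨i, r⟩, deriv (deriv (G.A ⟨i, r⟩)) z = (Υ i).eval z) :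
    ∃ b, ∀ x ∈ G.U, ∑ s, G.density s x / Delta d x s =
      G.quadForm (fun i => (Υ i).coeff (d i + 1)) (∑ i ∈ G.supportᶜ, (Υ i).coeff (d i - 1)) x +
        affineFun d b x := by
  classical
  choose! e b' h using fun i hi => exists_sum_density_of_mem (hd i) (h₁ i hi).1 (h₁ i hi).2
  refine ⟨fun i => (∑ i ∈ G.support, e i) • G.twistCoeff i +
    if i ∈ G.support then b' i else 0, fun x hx => ?_⟩
  have haff : affineFun d (fun i => (∑ i ∈ G.support, e i) • G.twistCoeff i +
      if i ∈ G.support then b' i else 0) x = (∑ i ∈ G.support, e i) * G.twist x +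
        ∑ i ∈ G.support, symAffine (b' i) Finset.univ (fun r => x ⟨i, r⟩) := by
    rw [twist_eq, affineFun, affineFun, Finset.mul_sum]
    simp only [symAffine_add, symAffine_smul, Finset.sum_add_distrib]
    congr 1
    rw [← Finset.sum_filter_add_sum_filter_not Finset.univ (· ∈ G.support),
      Finset.sum_congr rfl (g := fun i => symAffine (b' i) Finset.univ fun r => x ⟨i, r⟩)
        (s₁ := Finset.univ.filter (· ∈ G.support)) (fun i hi => by
          rw [if_pos (Finset.mem_filter.1 hi).2]),
      Finset.sum_eq_zero (s := Finset.univ.filter (· ∉ G.support)) (fun i hi => by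
          rw [if_neg (Finset.mem_filter.1 hi).2, symAffine_zero]), add_zero]
    simp
  rw [haff, quadForm, Fintype.sum_sigma, ← Finset.sum_add_sum_compl G.support,
    Finset.sum_congr rfl fun i hi => h i hi x hx,
    Finset.sum_congr (s₁ := G.supportᶜ) rfl fun j hj => sum_density_of_notMem
      (Finset.mem_compl.1 hj) (hd j) (h₂ j (Finset.mem_compl.1 hj)).1
      (h₂ j (Finset.mem_compl.1 hj)).2 hx]
  simp only [Finset.sum_add_distrib, Finset.sum_mul]
  ring

end SeparableKahler

end SegreVeronese

namespace SegreVeronese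

open ChartGeometry

variable {k : ℕ} {d : Fin k → ℕ}

/-! ### Relations between the leading coefficients -/

lemma affineFun_sub (b b' : Fin k → ℕ → ℝ) (x : Slot d → ℝ) :
    affineFun d (b - b') x = affineFun d b x - affineFun d b' x := by
  rw [affineFun, affineFun, affineFun, ← Finset.sum_sub_distrib]
  refine Finset.sum_congr rfl fun i _ => ?_
  simp [symAffine, sub_mul, Finset.sum_sub_distrib]

lemma affineFun_add (b b' : Fin k → ℕ → ℝ) (x : Slot d → ℝ) :
    affineFun d (b + b') x = affineFun d b x + affineFun d b' x := by
  rw [affineFun, affineFun, affineFun, ← Finset.sum_add_distrib]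
  exact Finset.sum_congr rfl fun i _ => symAffine_add _ _ _ _

/-- Linear combinations of `affineFun d b`, a constant, and a function of one group. -/
lemma exists_affineFun_combination (b : Fin k → ℕ → ℝ) (p : Fin k) (c₁ c₂ : ℝ) (b' : ℕ → ℝ) :
    ∃ b'', ∀ x : Slot d → ℝ, affineFun d b'' x =
      c₁ * affineFun d b x + c₂ + symAffine b' Finset.univ fun r => x ⟨p, r⟩ := by
  classical
  refine ⟨fun i => c₁ • b i + if i = p then addConst b' c₂ else 0, fun x => ?_⟩
  rw [affineFun, affineFun, Finset.mul_sum]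
  simp only [symAffine_add, symAffine_smul, Finset.sum_add_distrib]
  rw [Finset.sum_eq_single (f := fun i => symAffine (if i = p then addConst b' c₂ else 0)
    Finset.univ fun r => x ⟨i, r⟩) p (fun i _ hi => by simp [hi]) (by simp)]
  rw [if_pos rfl, symAffine_addConst]
  ring

namespace SeparableKahler

variable {G : SeparableKahler d} {γ : Fin k → ℝ} {Γ : ℝ}

lemma quadForm_eq (x : Slot d → ℝ) : G.quadForm γ Γ x =
    (∑ i ∈ G.support, γ i * (d i * (d i + 1)) + Γ) * G.twist x ^ 2 -
      2 * ((∑ i, d i : ℕ) + 1) * (G.twist x * ∑ i ∈ G.support, (d i + 1) * γ i * G.groupPart i x) +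
      ((∑ i, d i : ℕ) + 1) * ((∑ i, d i : ℕ) + 2) * ∑ i ∈ G.support, γ i * G.groupPart i x ^ 2 := by
  have hsum : ∑ i ∈ G.support, γ i * (d i * (d i + 1) * G.twist x ^ 2 -
      2 * (d i + 1) * ((∑ i, d i : ℕ) + 1) * (G.twist x * G.groupPart i x) +
      ((∑ i, d i : ℕ) + 1) * ((∑ i, d i : ℕ) + 2) * G.groupPart i x ^ 2) =
      (∑ i ∈ G.support, γ i * (d i * (d i + 1))) * G.twist x ^ 2 -
      2 * ((∑ i, d i : ℕ) + 1) * (G.twist x * ∑ i ∈ G.support, (d i + 1) * γ i * G.groupPart i x) +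
      ((∑ i, d i : ℕ) + 1) * ((∑ i, d i : ℕ) + 2) *
        ∑ i ∈ G.support, γ i * G.groupPart i x ^ 2 := by
    generalize ((∑ i, d i : ℕ) : ℝ) = N
    simp only [Finset.sum_mul, Finset.mul_sum, ← Finset.sum_sub_distrib, ← Finset.sum_add_distrib]
    exact Finset.sum_congr rfl fun i _ => by ring
  rw [quadForm]
  linear_combination hsum

lemma groupPart_update (x : Slot d → ℝ) (i j : Fin k) (r : Fin (d i)) (δ : ℝ) :
    G.groupPart j (Function.update x ⟨i, r⟩ (x ⟨i, r⟩ + δ)) =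
      G.groupPart j x + if j = i then δ * slope G.twistCoeff ⟨i, r⟩ x else 0 := by
  by_cases h : j = i
  · subst h
    rw [if_pos rfl, groupPart, groupPart, symAffine_update _ (Finset.mem_univ r), slope]
    ring
  · rw [if_neg h, groupPart, groupPart, add_zero]
    simp only [update_mk_of_ne h]

lemma twist_update (x : Slot d → ℝ) (s : Slot d) (δ : ℝ) :
    G.twist (Function.update x s (x s + δ)) = G.twist x + δ * slope G.twistCoeff s x := by
  rw [twist_eq, affineFun_update, ← twist_eq]
  ring

/-- Half the derivative of the quadratic form in the direction of the `i`-th group. -/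
def quadFormDeriv (G : SeparableKahler d) (γ : Fin k → ℝ) (Γ : ℝ) (i : Fin k) (x : Slot d → ℝ) :
    ℝ :=
  (∑ i ∈ G.support, γ i * (d i * (d i + 1)) + Γ) * G.twist x -
    ((∑ i, d i : ℕ) + 1) * ((∑ i ∈ G.support, (d i + 1) * γ i * G.groupPart i x) +
      (d i + 1) * γ i * G.twist x) +
    ((∑ i, d i : ℕ) + 1) * ((∑ i, d i : ℕ) + 2) * γ i * G.groupPart i x

lemma sum_groupPart_update {i : Fin k} (hi : i ∈ G.support) (w : Fin k → ℝ) (x : Slot d → ℝ)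
    (r : Fin (d i)) (δ : ℝ) :
    ∑ j ∈ G.support, w j * G.groupPart j (Function.update x ⟨i, r⟩ (x ⟨i, r⟩ + δ)) =
      (∑ j ∈ G.support, w j * G.groupPart j x) + w i * (δ * slope G.twistCoeff ⟨i, r⟩ x) := by
  simp only [groupPart_update, mul_add, Finset.sum_add_distrib, mul_ite, mul_zero,
    Finset.sum_ite_eq', if_pos hi]

lemma sum_groupPart_sq_update {i : Fin k} (hi : i ∈ G.support) (w : Fin k → ℝ) (x : Slot d → ℝ)
    (r : Fin (d i)) (δ : ℝ) :
    ∑ j ∈ G.support, w j * G.groupPart j (Function.update x ⟨i, r⟩ (x ⟨i, r⟩ + δ)) ^ 2 =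
      (∑ j ∈ G.support, w j * G.groupPart j x ^ 2) + w i * (2 * G.groupPart i x *
        (δ * slope G.twistCoeff ⟨i, r⟩ x) + (δ * slope G.twistCoeff ⟨i, r⟩ x) ^ 2) := by
  rw [← Finset.add_sum_erase _ _ hi, ← Finset.add_sum_erase _ (fun j => w j * G.groupPart j x ^ 2)
    hi]
  have : ∀ j ∈ G.support.erase i,
      w j * G.groupPart j (Function.update x ⟨i, r⟩ (x ⟨i, r⟩ + δ)) ^ 2 =
        w j * G.groupPart j x ^ 2 := fun j hj => by
    rw [groupPart_update, if_neg (Finset.ne_of_mem_erase hj), add_zero]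
  rw [Finset.sum_congr rfl this, groupPart_update, if_pos rfl]
  ring

/-- The quadratic form along a coordinate line, in powers of the increment of `⟨μ, β⟩`. -/
lemma quadForm_update {i : Fin k} (hi : i ∈ G.support) (x : Slot d → ℝ) (r : Fin (d i)) (δ : ℝ) :
    G.quadForm γ Γ (Function.update x ⟨i, r⟩ (x ⟨i, r⟩ + δ)) = G.quadForm γ Γ x +
      2 * (δ * slope G.twistCoeff ⟨i, r⟩ x) * G.quadFormDeriv γ Γ i x +
      (δ * slope G.twistCoeff ⟨i, r⟩ x) ^ 2 *
        ((∑ i ∈ G.support, γ i * (d i * (d i + 1)) + Γ) +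
          γ i * ((∑ i, d i : ℕ) + 1) * ((∑ i, d i : ℕ) - 2 * d i)) := by
  rw [quadForm_eq, quadForm_eq, quadFormDeriv, sum_groupPart_update hi, sum_groupPart_sq_update hi,
    twist_update]
  ring

lemma quadFormDeriv_update {i j : Fin k} (hij : i ≠ j) (hj : j ∈ G.support) (x : Slot d → ℝ)
    (q : Fin (d j)) (δ : ℝ) :
    G.quadFormDeriv γ Γ i (Function.update x ⟨j, q⟩ (x ⟨j, q⟩ + δ)) = G.quadFormDeriv γ Γ i x +
      δ * slope G.twistCoeff ⟨j, q⟩ x * ((∑ i ∈ G.support, γ i * (d i * (d i + 1)) + Γ) -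
        ((∑ i, d i : ℕ) + 1) * ((d i + 1) * γ i + (d j + 1) * γ j)) := by
  rw [quadFormDeriv, quadFormDeriv, sum_groupPart_update hj, groupPart_update, if_neg hij,
    twist_update]
  ring

/-- If the quadratic form is a function `⟨μ, h⟩`, then its coefficients vanish. -/
theorem quadForm_coefficients {b : Fin k → ℕ → ℝ}
    (h : ∀ x ∈ G.U, G.quadForm γ Γ x = affineFun d b x) :
    (∀ i ∈ G.support, (∑ i ∈ G.support, γ i * (d i * (d i + 1)) + Γ) +
      γ i * ((∑ i, d i : ℕ) + 1) * ((∑ i, d i : ℕ) - 2 * d i) = 0) ∧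
    ∀ i ∈ G.support, ∀ j ∈ G.support, i ≠ j →
      (∑ i ∈ G.support, γ i * (d i * (d i + 1)) + Γ) -
        ((∑ i, d i : ℕ) + 1) * ((d i + 1) * γ i + (d j + 1) * γ j) = 0 := by
  have hne := G.isConnected_U.nonempty
  have hdiag : ∀ i ∈ G.support, (∑ i ∈ G.support, γ i * (d i * (d i + 1)) + Γ) +
      γ i * ((∑ i, d i : ℕ) + 1) * ((∑ i, d i : ℕ) - 2 * d i) = 0 := by
    intro i hi
    obtain ⟨-, r, -⟩ := Finset.mem_filter.1 hi
    obtain ⟨x, hx, hl⟩ := exists_mem_ne_zero (analyticAt_slope (d := d) G.twistCoeff ⟨i, r⟩)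
      (exists_slope_ne_zero hi r) G.isOpen_U hne
    obtain ⟨ε, hε, hU⟩ := update_mem_U hx ⟨i, r⟩
    have h0 := h x hx
    have h1 := h _ (hU (ε / 2) (by rw [abs_of_pos (by linarith)]; linarith))
    have h2 := h _ (hU (-(ε / 2)) (by rw [abs_neg, abs_of_pos (by linarith)]; linarith))
    rw [quadForm_update hi, affineFun_update] at h1 h2
    have hc : (ε / 2 * slope G.twistCoeff ⟨i, r⟩ x) ^ 2 ≠ 0 :=
      pow_ne_zero 2 (mul_ne_zero (by positivity) hl)
    -- second difference quotient: a multi-affine function has none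
    refine mul_left_cancel₀ hc ?_
    linear_combination (1 / 2) * h1 + (1 / 2) * h2 - h0
  refine ⟨hdiag, fun i hi j hj hij => ?_⟩
  obtain ⟨-, r, -⟩ := Finset.mem_filter.1 hi
  obtain ⟨-, q, -⟩ := Finset.mem_filter.1 hj
  have hderiv : ∀ x ∈ G.U, 2 * slope G.twistCoeff ⟨i, r⟩ x * G.quadFormDeriv γ Γ i x =
      slope b ⟨i, r⟩ x := by
    intro x hx
    obtain ⟨ε, hε, hU⟩ := update_mem_U hx ⟨i, r⟩
    have h0 := h x hx
    have h1 := h _ (hU (ε / 2) (by rw [abs_of_pos (by linarith)]; linarith))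
    rw [quadForm_update hi, affineFun_update, hdiag i hi] at h1
    refine mul_left_cancel₀ (a := ε / 2) (by positivity) ?_
    linear_combination h1 - h0
  have ha := analyticAt_slope (d := d) G.twistCoeff ⟨i, r⟩
  obtain ⟨x₁, hx₁, hl₁⟩ := exists_mem_ne_zero ha (exists_slope_ne_zero hi r) G.isOpen_U hne
  obtain ⟨x, ⟨hx, hl⟩, hl'⟩ := exists_mem_ne_zero
    (analyticAt_slope (d := d) G.twistCoeff ⟨j, q⟩) (exists_slope_ne_zero hj q)
    (isOpen_inter_ne_zero ha G.isOpen_U) ⟨x₁, hx₁, hl₁⟩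
  obtain ⟨ε, hε, hU⟩ := update_mem_U hx ⟨j, q⟩
  have h0 := hderiv x hx
  have h1 := hderiv _ (hU (ε / 2) (by rw [abs_of_pos (by linarith)]; linarith))
  rw [slope_update_of_ne _ (by exact hij), slope_update_of_ne _ (by exact hij),
    quadFormDeriv_update hij hj] at h1
  have hc : 2 * slope G.twistCoeff ⟨i, r⟩ x * (ε / 2 * slope G.twistCoeff ⟨j, q⟩ x) ≠ 0 :=
    mul_ne_zero (mul_ne_zero two_ne_zero hl) (mul_ne_zero (by positivity) hl')
  refine mul_left_cancel₀ hc ?_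
  linear_combination h1 - h0

lemma sum_eq_add_sum_erase_erase {f : Fin k → ℕ} {p p' : Fin k} (h : p' ≠ p) :
    ∑ i, f i = f p + f p' + ∑ i ∈ (Finset.univ.erase p).erase p', f i := by
  rw [← Finset.add_sum_erase _ _ (Finset.mem_univ p),
    ← Finset.add_sum_erase _ _ (Finset.mem_erase.2 ⟨h, Finset.mem_univ p'⟩)]
  ring

lemma three_le_of_sum_ne (hd : ∀ i, 0 < d i) {p p' : Fin k} (h : p' ≠ p) :
    ∑ i, d i ≠ d p + d p' ↔ 3 ≤ k := by
  rw [sum_eq_add_sum_erase_erase h]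
  have hcard : ((Finset.univ.erase p).erase p').card = k - 2 := by
    rw [Finset.card_erase_of_mem (Finset.mem_erase.2 ⟨h, Finset.mem_univ p'⟩),
      Finset.card_erase_of_mem (Finset.mem_univ p), Finset.card_univ, Fintype.card_fin]
    rfl
  constructor
  · intro h1
    by_contra h2
    have h3 : (Finset.univ.erase p).erase p' = ∅ := Finset.card_eq_zero.1 (by omega)
    rw [h3] at h1
    simp at h1
  · intro h1
    obtain ⟨l, hl⟩ : ((Finset.univ.erase p).erase p').Nonempty := Finset.card_pos.1 (by omega)
    have := Finset.single_le_sum (f := d) (fun _ _ => Nat.zero_le _) hl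
    have := hd l
    omega

/-- The relations between the leading coefficients of the polynomials `A_{ir}`: the three
alternatives. -/
theorem leadingCoeff_relations (hd : ∀ i, 0 < d i) {b : Fin k → ℕ → ℝ}
    (h : ∀ x ∈ G.U, G.quadForm γ Γ x = affineFun d b x) {p : Fin k} (hp : p ∈ G.support) :
    (G.support = {p} ∧
      ((∑ i, d i : ℕ) - d p : ℝ) * ((∑ i, d i : ℕ) + 1 - d p : ℝ) * γ p + Γ = 0) ∨
    (∃ p', p' ≠ p ∧ G.support = {p, p'} ∧ ∑ i, d i = d p + d p' ∧ γ p + γ p' = 0) ∨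
    (2 ≤ G.support.card ∧ 3 ≤ k ∧ (∀ j ∈ G.support, γ j = 0) ∧ Γ = 0) := by
  obtain ⟨hdiag, hoff⟩ := quadForm_coefficients h
  have hN2 : ((∑ i, d i : ℕ) : ℝ) + 2 ≠ 0 := by positivity
  have hN1 : ((∑ i, d i : ℕ) : ℝ) + 1 ≠ 0 := by positivity
  have hneg : ∀ i ∈ G.support, ∀ j ∈ G.support, i ≠ j → γ i + γ j = 0 ∧
      γ i * ((∑ i, d i : ℕ) - (d i + d j)) = 0 := by
    intro i hi j hj hij
    have h1 := hdiag i hi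
    have h2 := hdiag j hj
    have h3 := hoff i hi j hj hij
    have h4 : γ i + γ j = 0 := by
      refine (mul_eq_zero.1 (?_ : (((∑ i, d i : ℕ) + 1) * ((∑ i, d i : ℕ) + 2) : ℝ) *
        (γ i + γ j) = 0)).resolve_left (mul_ne_zero hN1 hN2)
      linear_combination h1 + h2 - 2 * h3
    refine ⟨h4, (mul_eq_zero.1 (?_ : ((∑ i, d i : ℕ) + 1 : ℝ) *
      (γ i * ((∑ i, d i : ℕ) - (d i + d j))) = 0)).resolve_left hN1⟩
    have h5 : γ j = -γ i := by linarith
    rw [h5] at h3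
    linear_combination h1 - h3
  have hzero : (∀ j ∈ G.support, γ j = 0) → Γ = 0 := by
    intro h0
    have h1 := hdiag p hp
    rw [h0 p hp, Finset.sum_eq_zero fun i hi => by rw [h0 i hi, zero_mul]] at h1
    linarith
  by_cases hS : G.support = {p}
  · refine Or.inl ⟨hS, ?_⟩
    have h1 := hdiag p hp
    rw [hS, Finset.sum_singleton] at h1
    linear_combination h1
  · right
    obtain ⟨p', hp', hne⟩ : ∃ p' ∈ G.support, p' ≠ p := by
      by_contra! h'
      exact hS (Finset.eq_singleton_iff_unique_mem.2 ⟨hp, h'⟩)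
    have hcard : 2 ≤ G.support.card :=
      Finset.one_lt_card.2 ⟨p, hp, p', hp', hne.symm⟩
    obtain ⟨h1, h2⟩ := hneg p hp p' hp' hne.symm
    by_cases hN : ∑ i, d i = d p + d p'
    · refine Or.inl ⟨p', hne, ?_, hN, h1⟩
      have hk : ¬ 3 ≤ k := fun h3 => (three_le_of_sum_ne hd hne).2 h3 hN
      refine (Finset.eq_of_subset_of_card_le ?_ ?_).symm
      · intro l hl
        rcases Finset.mem_insert.1 hl with rfl | hl
        · exact hp
        · rwa [Finset.mem_singleton.1 hl]
      · rw [Finset.card_pair hne.symm]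
        have := Finset.card_le_univ G.support
        rw [Fintype.card_fin] at this
        omega
    · have h3 : γ p = 0 := (mul_eq_zero.1 h2).resolve_right fun h4 =>
        hN (by exact_mod_cast sub_eq_zero.1 h4)
      have h0 : ∀ j ∈ G.support, γ j = 0 := by
        intro j hj
        by_cases hjp : j = p
        · rw [hjp, h3]
        · have := (hneg p hp j hj (Ne.symm hjp)).1
          linarith
      exact Or.inr ⟨hcard, (three_le_of_sum_ne hd hne).1 hN, h0, hzero h0⟩

/-- Conversely, in each of the three cases the quadratic form is a function `⟨μ, h⟩`. -/
theorem exists_quadForm_eq (hd : ∀ i, 0 < d i) {p : Fin k}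
    (h : (G.support = {p} ∧
      ((∑ i, d i : ℕ) - d p : ℝ) * ((∑ i, d i : ℕ) + 1 - d p : ℝ) * γ p + Γ = 0) ∨
    (∃ p', p' ≠ p ∧ G.support = {p, p'} ∧ ∑ i, d i = d p + d p' ∧ γ p + γ p' = 0 ∧ Γ = 0) ∨
    ((∀ j ∈ G.support, γ j = 0) ∧ Γ = 0)) :
    ∃ b, ∀ x, G.quadForm γ Γ x = affineFun d b x := by
  rcases h with ⟨hS, h⟩ | ⟨p', hne, hS, hN, hγ, hΓ⟩ | ⟨hγ, hΓ⟩
  · set e := outerConst G.twistCoeff p 0 with he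
    have hM : ∀ x, G.groupPart p x = G.twist x - e := by
      intro x
      rw [twist_eq, affineFun_eq_add_outerConst _ p, he,
        outerConst_eq_of_support_subset hS.subset x 0, add_sub_cancel_right, groupPart]
    obtain ⟨b, hb⟩ := exists_affineFun_combination (d := d) G.twistCoeff p
      (γ p * (2 * (d p + 1) * ((∑ i, d i : ℕ) + 1) * e -
        2 * ((∑ i, d i : ℕ) + 1) * ((∑ i, d i : ℕ) + 2) * e))
      (γ p * (((∑ i, d i : ℕ) + 1) * ((∑ i, d i : ℕ) + 2) * e ^ 2)) 0
    refine ⟨b, fun x => ?_⟩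
    rw [hb, quadForm, hS, Finset.sum_singleton, hM, symAffine_zero, ← twist_eq]
    linear_combination G.twist x ^ 2 * h
  · refine ⟨0, fun x => ?_⟩
    have hk : (Finset.univ.erase p).erase p' = ∅ := by
      rw [sum_eq_add_sum_erase_erase hne, add_eq_left, Finset.sum_eq_zero_iff] at hN
      exact Finset.eq_empty_of_forall_notMem fun l hl => (hd l).ne' (hN l hl)
    have hL : G.twist x = G.groupPart p x + G.groupPart p' x := by
      rw [twist_eq, affineFun, ← Finset.add_sum_erase _ _ (Finset.mem_univ p),
        ← Finset.add_sum_erase _ _ (Finset.mem_erase.2 ⟨hne, Finset.mem_univ p'⟩), hk,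
        Finset.sum_empty, add_zero]
      rfl
    have h0 : affineFun d (0 : Fin k → ℕ → ℝ) x = 0 :=
      Finset.sum_eq_zero fun i _ => symAffine_zero _ _
    have hγ' : γ p' = -γ p := by linarith
    rw [h0, quadForm, hS, Finset.sum_pair hne.symm, hL, hN, hγ', hΓ]
    push_cast
    ring
  · refine ⟨0, fun x => ?_⟩
    have h0 : affineFun d (0 : Fin k → ℕ → ℝ) x = 0 :=
      Finset.sum_eq_zero fun i _ => symAffine_zero _ _
    rw [h0, quadForm, Finset.sum_eq_zero fun i hi => by rw [hγ i hi, zero_mul], hΓ]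
    ring

end SeparableKahler

end SegreVeronese

namespace SegreVeronese

open ChartGeometry Topology

/-! ### Double primitives -/

lemma IsDoublePrimitive.eq {I : Set ℝ} (hI : IsOpen I) {f g F H : ℝ → ℝ}
    (hF : IsDoublePrimitive I f F) (hH : IsDoublePrimitive I g H) (h : ∀ z ∈ I, F z = H z) :
    ∀ z ∈ I, f z = g z := by
  obtain ⟨F', hF⟩ := hF
  obtain ⟨H', hH⟩ := hH
  have key : ∀ {u v u' v' : ℝ → ℝ}, (∀ z ∈ I, HasDerivAt u (u' z) z) →
      (∀ z ∈ I, HasDerivAt v (v' z) z) → (∀ z ∈ I, u z = v z) → ∀ z ∈ I, u' z = v' z :=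
    fun hu hv h z hz => (hu z hz).unique <| (hv z hz).congr_of_eventuallyEq <|
      Filter.eventually_of_mem (hI.mem_nhds hz) h
  exact key (fun z hz => (hF z hz).2) (fun z hz => (hH z hz).2)
    (key (fun z hz => (hF z hz).1) (fun z hz => (hH z hz).1) h)

lemma hasDerivAt_div_pow {B : ℝ → ℝ} {B' a b z : ℝ} (hB : HasDerivAt B B' z)
    (hu : a + b * z ≠ 0) (n : ℕ) :
    HasDerivAt (fun z => B z / (a + b * z) ^ n)
      ((B' * (a + b * z) - n * b * B z) / (a + b * z) ^ (n + 1)) z := by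
  have hlin : HasDerivAt (fun z : ℝ => a + b * z) b z := by
    simpa using ((hasDerivAt_id z).const_mul b).const_add a
  refine (hB.fun_div (hlin.fun_pow n) (pow_ne_zero n hu)).congr_deriv ?_
  rcases n with _ | n
  · simp [hu]
  · rw [Nat.add_sub_cancel]
    field_simp
    ring

section Interpolation

open Polynomial

lemma exists_sum_eval_div_eq_symAffine {n : ℕ} (hn : 0 < n) {f : ℝ[X]} (hf : f.natDegree ≤ n) :
    ∃ b : ℕ → ℝ, ∀ y : Fin n → ℝ, Function.Injective y →
      ∑ r, f.eval (y r) / ∏ q ∈ Finset.univ.erase r, (y r - y q) =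
        symAffine b Finset.univ y := by
  obtain ⟨e, he⟩ := exists_sum_eval_mul_slope_div hn hf (Pi.single 1 1)
  have h1 : shift (Pi.single 1 1) = Pi.single 0 1 := by
    funext j
    rcases j with _ | j <;> simp [shift]
  refine ⟨addConst (f.coeff n • Pi.single 1 1) e, fun y hy => ?_⟩
  rw [symAffine_addConst, symAffine_smul, ← he y hy]
  refine Finset.sum_congr rfl fun r _ => ?_
  rw [h1, symAffine_single_zero, mul_one]

end Interpolation

namespace SeparableKahler

open Polynomial

variable {k : ℕ} {d : Fin k → ℕ} {G : SeparableKahler d}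

lemma isDoublePrimitive_A (s : Slot d) :
    IsDoublePrimitive (G.interval s) (deriv (deriv (G.A s))) (G.A s) :=
  ⟨deriv (G.A s), fun _ hz => ⟨hasDerivAt_A hz, hasDerivAt_deriv_A hz⟩⟩

/-- The second derivative of `A_s / (a + b x)^n`. -/
lemma isDoublePrimitive_div_pow {s : Slot d} {a b : ℝ} (hu : ∀ z ∈ G.interval s, a + b * z ≠ 0)
    (n : ℕ) : IsDoublePrimitive (G.interval s)
      (fun z => (deriv (deriv (G.A s)) z * (a + b * z) ^ 2 -
        2 * n * b * deriv (G.A s) z * (a + b * z) + n * (n + 1) * b ^ 2 * G.A s z) /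
        (a + b * z) ^ (n + 2)) (fun z => G.A s z / (a + b * z) ^ n) := by
  refine ⟨_, fun z hz => ⟨hasDerivAt_div_pow (hasDerivAt_A hz) (hu z hz) n, ?_⟩⟩
  have hlin : HasDerivAt (fun z : ℝ => a + b * z) b z := by
    simpa using ((hasDerivAt_id z).const_mul b).const_add a
  refine (hasDerivAt_div_pow (((hasDerivAt_deriv_A hz).fun_mul hlin).fun_sub
    ((hasDerivAt_A hz).const_mul (n * b))) (hu z hz) (n + 1)).congr_deriv ?_
  congr 1
  push_cast
  ring

/-! ### Constant `⟨μ, β⟩` -/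

/-- If the support is empty, then `⟨μ, β⟩` is constant and the equation reads
`∑_s A_s'' / Δ_s = affineFun d b`: this makes the functions `A_{pr}''` polynomials of degree at
most `d_p`. -/
theorem ExtremalityEquation.of_support_eq_empty [Nonempty (Slot d)] {b : Fin k → ℕ → ℝ}
    (hb : G.ExtremalityEquation b) (hS : G.support = ∅) :
    ∃ t : ℝ, t ≠ 0 ∧ (G.β : Tensors d) = t • PiTensorProduct.tprod ℝ (fun _ => ![1, 0]) ∧
      ∃ (Υ : Fin k → ℝ[X]) (ν₀ ν₁ : Slot d → ℝ), (∀ p, (Υ p).natDegree ≤ d p + 2) ∧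
        ∀ p q, ∀ x ∈ G.interval ⟨p, q⟩,
          G.A ⟨p, q⟩ x = (Υ p).eval x + ν₀ ⟨p, q⟩ + ν₁ ⟨p, q⟩ * x := by
  have hmem : ∀ i, i ∉ G.support := fun i => by simp [hS]
  have ht : ∀ x, G.twist x = ∑ i, G.twistCoeff i 0 := fun x => by
    rw [twist_eq, affineFun]
    exact Finset.sum_congr rfl fun i _ => symAffine_twistCoeff_eq_const (hmem i) _
  obtain ⟨x₀, hx₀⟩ := G.isConnected_U.nonempty
  refine ⟨∑ i, G.twistCoeff i 0, by rw [← ht x₀]; exact twist_ne hx₀, ?_, ?_⟩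
  · refine eq_of_momentum_eq fun x => (ht x).trans ?_
    change _ = pairing (fun s => ![1, x s]) _
    simp
  choose f hf hA using fun p => exists_global
    (p := fun P : ℝ[X] => P.natDegree ≤ d p) (f := fun r => deriv (deriv (G.A ⟨p, r⟩)))
    fun x hx => hb.exists_local_of_notMem (hmem p) hx
  choose f₁ hf₁ using fun p => exists_derivative_eq (f p)
  choose Υ hΥ using fun p => exists_derivative_eq (f₁ p)
  have hlin : ∀ s : Slot d, ∃ c₀ c₁ : ℝ, ∀ z ∈ G.interval s,
      G.A s z = (Υ s.1).eval z + c₀ + c₁ * z := by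
    rintro ⟨p, r⟩
    obtain ⟨P, hP, hAP⟩ := exists_polynomial_of_second_derivative (F := f p)
      (G.isOpen_interval ⟨p, r⟩) (G.isPreconnected_interval ⟨p, r⟩)
      (fun z hz => ⟨hasDerivAt_A hz, by rw [← hA p r z hz]; exact hasDerivAt_deriv_A hz⟩)
    have h0 : (P - Υ p).derivative.derivative = 0 := by simp [hP, hΥ, hf₁]
    obtain ⟨c₁, hc₁⟩ := natDegree_eq_zero.1 (derivative_eq_zero.1 h0)
    have h1 : (P - Υ p - C c₁ * X).derivative = 0 := by
      rw [derivative_sub (f := P - Υ p), ← hc₁]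
      simp
    obtain ⟨c₀, hc₀⟩ := natDegree_eq_zero.1 (derivative_eq_zero.1 h1)
    refine ⟨c₀, c₁, fun z hz => ?_⟩
    have := congrArg (eval z) hc₀
    simp at this
    rw [hAP z hz, this]
    ring
  choose ν₀ ν₁ hν using hlin
  refine ⟨Υ, ν₀, ν₁, fun p => ?_, fun p q => hν ⟨p, q⟩⟩
  have h1 := natDegree_le_of_derivative (Υ p)
  have h2 := natDegree_le_of_derivative (f₁ p)
  have h3 := hf p
  rw [hΥ] at h1
  rw [hf₁] at h2
  omega

/-- Conversely, for constant `⟨μ, β⟩` such functions `A_{pq}` solve the extremality equation. -/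
theorem exists_extremalityEquation_of_const (hd : ∀ i, 0 < d i) {t : ℝ}
    (hβ : (G.β : Tensors d) = t • PiTensorProduct.tprod ℝ (fun _ => ![1, 0]))
    {Υ : Fin k → ℝ[X]} {ν₀ ν₁ : Slot d → ℝ} (hΥ : ∀ p, (Υ p).natDegree ≤ d p + 2)
    (hA : ∀ p q, ∀ x ∈ G.interval ⟨p, q⟩,
      G.A ⟨p, q⟩ x = (Υ p).eval x + ν₀ ⟨p, q⟩ + ν₁ ⟨p, q⟩ * x) :
    ∃ b, G.ExtremalityEquation b := by
  have ht : G.twist = fun _ => t := by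
    funext x
    rw [twist, hβ]
    change pairing (fun s => ![1, x s]) _ = t
    simp
  have hslope : ∀ s x, slope G.twistCoeff s x = 0 := fun s x => by
    rw [← pd_twist, ht, pd]
    simp
  have hdeg : ∀ p, (Υ p).derivative.derivative.natDegree ≤ d p := fun p =>
    (natDegree_derivative_le _).trans (by
      have := natDegree_derivative_le (Υ p)
      have := hΥ p
      omega)
  choose b hb using fun p => exists_sum_eval_div_eq_symAffine (hd p) (hdeg p)
  refine ⟨fun p => t ^ 2 • b p, fun x hx => ?_⟩
  rw [Fintype.sum_sigma, affineFun]
  refine Finset.sum_congr rfl fun p _ => ?_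
  rw [symAffine_smul, ← hb p _ (injective_of_Delta_ne p (Delta_ne hx)), Finset.mul_sum]
  refine Finset.sum_congr rfl fun r _ => ?_
  have hP : ∀ z ∈ G.interval ⟨p, r⟩, G.A ⟨p, r⟩ z =
      (Υ p + C (ν₀ ⟨p, r⟩) + C (ν₁ ⟨p, r⟩) * X).eval z := fun z hz => by
    rw [hA p r z hz]
    simp
  rw [density, hslope, ht, (deriv_A_eq hP).2 _ (mem_interval hx _), Delta]
  simp
  ring

/-! ### Decomposable `⟨μ, β⟩` -/

lemma twist_of_ins {p : Fin k} {t a b : ℝ} (hb : b ≠ 0) (hβ : (G.β : Tensors d) =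
    ins d p (t • PiTensorProduct.tprod ℝ (fun _ => ![a, b]))) (x : Slot d → ℝ) :
    G.twist x = (t * b ^ d p) * ∏ q, (x ⟨p, q⟩ - -a / b) := by
  rw [twist, hβ, map_smul, map_smul, momentum_ins, pairing_tprod, smul_eq_mul, mul_assoc]
  congr 1
  rw [← Fin.prod_const, ← Finset.prod_mul_distrib]
  refine Finset.prod_congr rfl fun q _ => ?_
  simp
  field_simp
  ring

lemma notMem_support_of_twist_eq_prod {p : Fin k} {t c : ℝ}
    (h : ∀ x, G.twist x = t * ∏ q, (x ⟨p, q⟩ - c)) {j : Fin k} (hj : j ≠ p) :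
    j ∉ G.support := by
  intro hmem
  obtain ⟨-, r, -⟩ := Finset.mem_filter.1 hmem
  obtain ⟨x, hx⟩ := exists_slope_ne_zero hmem r
  have h1 := twist_update (G := G) x ⟨j, r⟩ 1
  rw [h, h] at h1
  simp only [update_mk_of_ne hj.symm, one_mul, left_eq_add] at h1
  exact hx h1

lemma sub_ne_of_twist_eq_prod [Nonempty (Slot d)] {p : Fin k} {t c : ℝ}
    (h : ∀ x, G.twist x = t * ∏ q, (x ⟨p, q⟩ - c)) {q : Fin (d p)} {z : ℝ}
    (hz : z ∈ G.interval ⟨p, q⟩) : z - c ≠ 0 := by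
  obtain ⟨x, hx, rfl⟩ := hz
  intro h0
  refine twist_ne hx ?_
  rw [h, Finset.prod_eq_zero (Finset.mem_univ q) h0, mul_zero]

/-- If `⟨μ, β⟩ = t ∏_q (x_{pq} - c)`, the functions `(x - c)^{m+3} (A_{pq} / (x - c)^{m+1})''` are
given by one polynomial, the functions `A_{jr}''`, `j ≠ p`, are polynomials, and their leading
coefficients satisfy one relation. -/
theorem ExtremalityEquation.of_prod [Nonempty (Slot d)] (hd : ∀ i, 0 < d i)
    {b : Fin k → ℕ → ℝ} (hb : G.ExtremalityEquation b) {p : Fin k} (hp : p ∈ G.support) {t c : ℝ}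
    (h : ∀ x, G.twist x = t * ∏ q, (x ⟨p, q⟩ - c)) :
    t ≠ 0 ∧ (G.β : Tensors d) = ins d p (t • PiTensorProduct.tprod ℝ (fun _ => ![-c, 1])) ∧
      ∃ Υ : Fin k → ℝ[X], (Υ p).natDegree ≤ d p + 1 ∧
        (∀ i, i ≠ p → (Υ i).natDegree ≤ d i - 1) ∧
        (∀ q, ∃ F : ℝ → ℝ, IsDoublePrimitive (G.interval ⟨p, q⟩)
            (fun x => (Υ p).eval x / (-c + 1 * x) ^ ((∑ i, d i) + 3)) F ∧
          ∀ x ∈ G.interval ⟨p, q⟩, G.A ⟨p, q⟩ x = (-c + 1 * x) ^ ((∑ i, d i) + 1) * F x) ∧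
        (∀ i, i ≠ p → ∀ r, IsDoublePrimitive (G.interval ⟨i, r⟩)
          (fun x => (Υ i).eval x) (G.A ⟨i, r⟩)) ∧
        (Υ p).coeff (d p + 1) / 1 ^ 2 +
          ∑ i ∈ Finset.univ.erase p, (Υ i).coeff (d i - 1) = 0 := by
  obtain ⟨x₀, hx₀⟩ := G.isConnected_U.nonempty
  refine ⟨fun h0 => twist_ne hx₀ (by rw [h, h0, zero_mul]), ?_, ?_⟩
  · refine eq_of_momentum_eq fun x => (h x).trans ?_
    rw [map_smul, map_smul, momentum_ins, pairing_tprod, smul_eq_mul]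
    congr 1
    refine Finset.prod_congr rfl fun q _ => ?_
    simp
    ring
  have hout : ∀ j, j ≠ p → j ∉ G.support := fun j hj => notMem_support_of_twist_eq_prod h hj
  have hf : ∀ j, ∃ f : ℝ[X], j ≠ p → f.natDegree ≤ d j - 1 ∧
      ∀ r, ∀ z ∈ G.interval ⟨j, r⟩, deriv (deriv (G.A ⟨j, r⟩)) z = f.eval z := by
    intro j
    by_cases hj : j = p
    · exact ⟨0, fun h => absurd hj h⟩
    obtain ⟨f, hf, hA⟩ := exists_global
      (p := fun P : ℝ[X] => P.natDegree ≤ d j) (f := fun r => deriv (deriv (G.A ⟨j, r⟩)))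
      fun x hx => hb.exists_local_of_notMem (hout j hj) hx
    exact ⟨f, fun _ => ⟨hb.natDegree_le_of_notMem (hout j hj) hp hf hA, hA⟩⟩
  choose f hf using hf
  obtain ⟨P, hPd, hP⟩ := exists_global
    (p := fun P : ℝ[X] => P.natDegree ≤ d p + 1) fun x hx => by
      obtain ⟨P, hP, -, hP'⟩ := hb.exists_local_of_prod (hd p) h hx
      exact ⟨P, hP, hP'⟩
  have hPc : P.coeff (d p + 1) = -G.outerSum p x₀ := by
    obtain ⟨Q, -, hQ, hQ'⟩ := hb.exists_local_of_prod (hd p) h hx₀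
    let r : Fin (d p) := ⟨0, hd p⟩
    obtain ⟨ε, hε, hball⟩ := Metric.eventually_nhds_iff_ball.1 ((hQ' r).and
      (Filter.eventually_of_mem ((G.isOpen_interval ⟨p, r⟩).mem_nhds (mem_interval hx₀ ⟨p, r⟩))
        (hP r)))
    rw [← hQ, eq_of_eqOn_ball hε fun z hz => (hball z hz).2.symm.trans (hball z hz).1]
  have hsum : G.outerSum p x₀ = ∑ i ∈ Finset.univ.erase p, (f i).coeff (d i - 1) := by
    refine Finset.sum_congr rfl fun j hj => ?_
    obtain ⟨h1, h2⟩ := hf j (Finset.ne_of_mem_erase hj)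
    have h3 : (f j).coeff (d j) = 0 := coeff_eq_zero_of_natDegree_lt (by have := hd j; omega)
    have h4 := sum_eval_div_of_natDegree_le (hd j) (injective_of_Delta_ne j (Delta_ne hx₀))
      (f := f j) (by omega)
    rw [h3, zero_mul, add_zero] at h4
    rw [← h4]
    exact Finset.sum_congr rfl fun r _ => by rw [h2 r _ (mem_interval hx₀ _), Delta]
  have hΥp : Function.update f p P p = P := Function.update_self _ _ _
  have hΥ : ∀ j, j ≠ p → Function.update f p P j = f j := fun j hj =>
    Function.update_of_ne hj _ _
  refine ⟨Function.update f p P, by rwa [hΥp], fun i hi => by rw [hΥ i hi]; exact (hf i hi).1,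
    fun q => ?_, fun i hi r => ?_, ?_⟩
  · have hu : ∀ z ∈ G.interval ⟨p, q⟩, -c + 1 * z ≠ 0 := fun z hz h0 =>
      sub_ne_of_twist_eq_prod h hz (by linarith)
    refine ⟨_, ?_, fun z hz => (mul_div_cancel₀ _ (pow_ne_zero _ (hu z hz))).symm⟩
    obtain ⟨F', hF'⟩ := isDoublePrimitive_div_pow hu ((∑ i, d i) + 1)
    refine ⟨F', fun z hz => ⟨(hF' z hz).1, (hF' z hz).2.congr_deriv ?_⟩⟩
    simp only [hΥp, ← hP q z hz]
    congr 1
    push_cast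
    ring
  · rw [hΥ i hi]
    obtain ⟨F', hF'⟩ := isDoublePrimitive_A (G := G) ⟨i, r⟩
    exact ⟨F', fun z hz => ⟨(hF' z hz).1, (hF' z hz).2.congr_deriv ((hf i hi).2 r z hz)⟩⟩
  · have hrest : ∑ i ∈ Finset.univ.erase p, (Function.update f p P i).coeff (d i - 1) =
        G.outerSum p x₀ := by
      rw [hsum]
      exact Finset.sum_congr rfl fun j hj => by rw [hΥ j (Finset.ne_of_mem_erase hj)]
    rw [hΥp, hPc, hrest]
    ring

/-- Conversely, for decomposable `⟨μ, β⟩` such functions solve the extremality equation: the group `p`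
contributes the first summand of the relation times `⟨μ, β⟩²`, up to functions `⟨μ, h⟩`, and the
other groups contribute the remaining summands times `⟨μ, β⟩²`. -/
theorem exists_extremalityEquation_of_ins [Nonempty (Slot d)] (hd : ∀ i, 0 < d i) {p : Fin k}
    {t a b : ℝ} (hb : b ≠ 0) (hβ : (G.β : Tensors d) =
      ins d p (t • PiTensorProduct.tprod ℝ (fun _ => ![a, b]))) {Υ : Fin k → ℝ[X]}
    (hp : (Υ p).natDegree ≤ d p + 1) (hΥ : ∀ i, i ≠ p → (Υ i).natDegree ≤ d i - 1)
    (hAp : ∀ q, ∃ F : ℝ → ℝ, IsDoublePrimitive (G.interval ⟨p, q⟩)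
        (fun x => (Υ p).eval x / (a + b * x) ^ ((∑ i, d i) + 3)) F ∧
      ∀ x ∈ G.interval ⟨p, q⟩, G.A ⟨p, q⟩ x = (a + b * x) ^ ((∑ i, d i) + 1) * F x)
    (hA : ∀ i, i ≠ p → ∀ r, IsDoublePrimitive (G.interval ⟨i, r⟩)
      (fun x => (Υ i).eval x) (G.A ⟨i, r⟩))
    (hγ : (Υ p).coeff (d p + 1) / b ^ 2 +
      ∑ i ∈ Finset.univ.erase p, (Υ i).coeff (d i - 1) = 0) :
    ∃ b', G.ExtremalityEquation b' := by
  have htw := twist_of_ins hb hβ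
  have hout : ∀ j, j ≠ p → j ∉ G.support := fun j hj => notMem_support_of_twist_eq_prod htw hj
  have hu : ∀ q, ∀ z ∈ G.interval ⟨p, q⟩, a + b * z ≠ 0 := fun q z hz h0 =>
    sub_ne_of_twist_eq_prod htw hz (by field_simp; linarith)
  have hS : G.support ⊆ {p} := fun j hj => by
    by_contra hne
    exact hout j (by simpa using hne) hj
  have hode : ∀ q, ∀ z ∈ G.interval ⟨p, q⟩, (Υ p).eval z =
      deriv (deriv (G.A ⟨p, q⟩)) z * (a + b * z) ^ 2 -
        2 * ((∑ i, d i : ℕ) + 1) * b * deriv (G.A ⟨p, q⟩) z * (a + b * z) +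
        ((∑ i, d i : ℕ) + 1) * ((∑ i, d i : ℕ) + 2) * b ^ 2 * G.A ⟨p, q⟩ z := by
    intro q z hz
    obtain ⟨F, hF, hAF⟩ := hAp q
    have h1 := hF.eq (G.isOpen_interval _) (isDoublePrimitive_div_pow (hu q) ((∑ i, d i) + 1))
      (fun z hz => by rw [hAF z hz, mul_div_cancel_left₀ _ (pow_ne_zero _ (hu q z hz))]) z hz
    have h2 := pow_ne_zero ((∑ i, d i) + 3) (hu q z hz)
    rw [show (∑ i, d i) + 1 + 2 = (∑ i, d i) + 3 by ring, div_left_inj' h2] at h1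
    rw [h1]
    push_cast
    ring
  set e := outerConst G.twistCoeff p 0 with he
  have hM : ∀ x : Slot d → ℝ, symAffine (G.twistCoeff p) Finset.univ (fun r => x ⟨p, r⟩) =
      G.twist x - e := fun x => by
    rw [twist_eq, affineFun_eq_add_outerConst _ p, he, outerConst_eq_of_support_subset hS x 0,
      add_sub_cancel_right]
  obtain ⟨b', hb'⟩ := exists_sum_eval_mul_slope_sq_div (hd p) hp (G.twistCoeff p)
  set γ := (Υ p).coeff (d p + 1) with hγp
  obtain ⟨b'', hb''⟩ := exists_affineFun_combination (d := d) G.twistCoeff p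
    (-2 * e * γ / b ^ 2) (e ^ 2 * γ / b ^ 2) ((1 / b ^ 2) • b')
  refine ⟨b'', fun x hx => ?_⟩
  have hgroup : ∑ r, G.density ⟨p, r⟩ x / Delta d x ⟨p, r⟩ =
      (1 / b ^ 2) * (γ * (G.twist x - e) ^ 2 +
        symAffine b' Finset.univ (fun r => x ⟨p, r⟩)) := by
    rw [← hM, ← hb' _ (injective_of_Delta_ne p (Delta_ne hx)), Finset.mul_sum]
    refine Finset.sum_congr rfl fun r _ => ?_
    rw [hode r _ (mem_interval hx _), density, twist_eq_sub_mul_slope htw r x, Delta, slope]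
    field_simp
    ring
  rw [Fintype.sum_sigma, ← Finset.add_sum_erase _ _ (Finset.mem_univ p), hgroup,
    Finset.sum_congr rfl fun j hj => sum_density_of_notMem
      (hout j (Finset.ne_of_mem_erase hj)) (hd j) (hΥ j (Finset.ne_of_mem_erase hj))
      (fun r => (isDoublePrimitive_A ⟨j, r⟩).eq (G.isOpen_interval _)
        (hA j (Finset.ne_of_mem_erase hj) r) fun _ _ => rfl) hx, ← Finset.sum_mul, hb'',
    symAffine_smul, ← twist_eq]
  linear_combination G.twist x ^ 2 * hγ

end SeparableKahler

end SegreVeronese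

namespace SegreVeronese

open ChartGeometry Topology

variable {k : ℕ} {d : Fin k → ℕ}

/-! ### The independent case -/

lemma IsVeroneseTimesLine.sum_eq {i j : Fin k} (h : IsVeroneseTimesLine d i j) :
    ∑ l, d l = d i + d j := by
  obtain ⟨hij, hall, -⟩ := h
  rw [← Finset.sum_pair hij]
  refine (Finset.sum_subset (Finset.subset_univ _) fun l _ hl => ?_).symm
  rcases hall l with rfl | rfl <;> simp at hl

lemma existsUnique_fin_three {a b c : Prop}
    (h : (a ∧ ¬b ∧ ¬c) ∨ (b ∧ ¬a ∧ ¬c) ∨ (c ∧ ¬a ∧ ¬b)) :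
    ∃! n : Fin 3, (![a, b, c] : Fin 3 → Prop) n := by
  rcases h with ⟨h1, h2, h3⟩ | ⟨h1, h2, h3⟩ | ⟨h1, h2, h3⟩
  · refine ⟨0, h1, fun n hn => ?_⟩
    fin_cases n
    exacts [rfl, absurd hn h2, absurd hn h3]
  · refine ⟨1, h1, fun n hn => ?_⟩
    fin_cases n
    exacts [absurd hn h2, rfl, absurd hn h3]
  · refine ⟨2, h1, fun n hn => ?_⟩
    fin_cases n
    exacts [absurd hn h2, absurd hn h3, rfl]

namespace SeparableKahler

open Polynomial

variable {G : SeparableKahler d}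

/-- If the support is not empty and `⟨μ, β⟩` does not vanish on any hyperplane `x_{ir} = c` with
`i` in the support, then the extremality equation makes the functions `A_{ir}` (inside the support)
and `A_{ir}''` (outside the support) polynomials. -/
theorem ExtremalityEquation.exists_polynomials [Nonempty (Slot d)]
    (hN : ∀ i, d i + 1 ≤ ∑ i, d i) (hN3 : 3 ≤ ∑ i, d i) {b : Fin k → ℕ → ℝ}
    (hb : G.ExtremalityEquation b) {p : Fin k} (hp : p ∈ G.support)
    (hind : ∀ i ∈ G.support, ∀ (r : Fin (d i)) (c : ℝ),
      ∃ x, affineFun d G.twistCoeff (Function.update x ⟨i, r⟩ c) ≠ 0) :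
    ∃ Υ : Fin k → ℝ[X],
      (∀ i ∈ G.support, (Υ i).natDegree ≤ d i + 1 ∧
        ∀ r, ∀ z ∈ G.interval ⟨i, r⟩, G.A ⟨i, r⟩ z = (Υ i).eval z) ∧
      (∀ i ∉ G.support, (Υ i).natDegree ≤ d i - 1 ∧
        ∀ r, ∀ z ∈ G.interval ⟨i, r⟩, deriv (deriv (G.A ⟨i, r⟩)) z = (Υ i).eval z) := by
  have key : ∀ i, ∃ f : ℝ[X],
      (i ∈ G.support → f.natDegree ≤ d i + 1 ∧
        ∀ r, ∀ z ∈ G.interval ⟨i, r⟩, G.A ⟨i, r⟩ z = f.eval z) ∧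
      (i ∉ G.support → f.natDegree ≤ d i - 1 ∧
        ∀ r, ∀ z ∈ G.interval ⟨i, r⟩, deriv (deriv (G.A ⟨i, r⟩)) z = f.eval z) := by
    intro i
    by_cases hi : i ∈ G.support
    · obtain ⟨f, hf⟩ := exists_global (p := fun P : ℝ[X] => P.natDegree ≤ d i + 1)
        (f := fun r => G.A ⟨i, r⟩)
        fun x hx => hb.exists_local_of_mem hi (hN i) hN3 (hind i hi) hx
      exact ⟨f, fun _ => hf, fun h => absurd hi h⟩
    · obtain ⟨f, hf, hA⟩ := exists_global
        (p := fun P : ℝ[X] => P.natDegree ≤ d i) (f := fun r => deriv (deriv (G.A ⟨i, r⟩)))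
        fun x hx => hb.exists_local_of_notMem hi hx
      exact ⟨f, fun h => absurd h hi, fun _ => ⟨hb.natDegree_le_of_notMem hi hp hf hA, hA⟩⟩
  choose Υ hΥ using key
  exact ⟨Υ, fun i => (hΥ i).1, fun i => (hΥ i).2⟩

lemma exists_independentAt (hd : ∀ i, 0 < d i) {p : Fin k} (hp : p ∈ G.support)
    (hind : ∀ (r : Fin (d p)) (c : ℝ),
      ∃ x, affineFun d G.twistCoeff (Function.update x ⟨p, r⟩ c) ≠ 0) :
    ∃ q, G.IndependentAt ⟨p, q⟩ :=
  ⟨⟨0, hd p⟩, independentAt_of_ne_zero (exists_slope_ne_zero hp _) (hind _)⟩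

/-- A function `⟨μ, β⟩` which depends on a single variable vanishes on a hyperplane. -/
lemma exists_affineFun_update_eq_zero {j : Fin k} (hdj : d j = 1) (hS : G.support ⊆ {j})
    (hj : j ∈ G.support) (r : Fin (d j)) :
    ∃ c, ∀ x, affineFun d G.twistCoeff (Function.update x ⟨j, r⟩ c) = 0 := by
  have herase : Finset.univ.erase r = ∅ := by
    rw [← Finset.card_eq_zero, Finset.card_erase_of_mem (Finset.mem_univ r), Finset.card_univ,
      Fintype.card_fin, hdj]
  have hempty : ∀ (c : ℕ → ℝ) (y : Fin (d j) → ℝ), symAffine c ∅ y = c 0 := fun c y => by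
    simp [symAffine]
  obtain ⟨x₀, hx₀⟩ := exists_slope_ne_zero hj r
  rw [slope, herase, hempty] at hx₀
  have hx₀ : shift (G.twistCoeff j) 0 ≠ 0 := hx₀
  refine ⟨-(G.twistCoeff j 0 + outerConst (d := d) G.twistCoeff j 0) / shift (G.twistCoeff j) 0,
    fun x => ?_⟩
  generalize hc : -(G.twistCoeff j 0 + outerConst (d := d) G.twistCoeff j 0) /
    shift (G.twistCoeff j) 0 = c
  rw [div_eq_iff hx₀] at hc
  rw [affineFun_eq_add_outerConst _ j, outerConst_eq_of_support_subset hS _ 0,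
    symAffine_erase _ (Finset.mem_univ r), herase, hempty, hempty, Function.update_self, ← hc]
  ring

/-- Conversely, polynomials whose leading coefficients satisfy one of the three relations solve
the extremality equation. -/
theorem exists_extremalityEquation_of_polynomials (hd : ∀ i, 0 < d i) {Υ : Fin k → ℝ[X]}
    (h₁ : ∀ i ∈ G.support, (Υ i).natDegree ≤ d i + 1 ∧
      ∀ r, ∀ z ∈ G.interval ⟨i, r⟩, G.A ⟨i, r⟩ z = (Υ i).eval z)
    (h₂ : ∀ i ∉ G.support, (Υ i).natDegree ≤ d i - 1 ∧
      ∀ r, IsDoublePrimitive (G.interval ⟨i, r⟩) (fun x => (Υ i).eval x) (G.A ⟨i, r⟩))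
    {p : Fin k}
    (h : (G.support = {p} ∧
      ((∑ i, d i : ℕ) - d p : ℝ) * ((∑ i, d i : ℕ) + 1 - d p : ℝ) * (Υ p).coeff (d p + 1) +
        ∑ i ∈ G.supportᶜ, (Υ i).coeff (d i - 1) = 0) ∨
    (∃ p', p' ≠ p ∧ G.support = {p, p'} ∧ ∑ i, d i = d p + d p' ∧
      (Υ p).coeff (d p + 1) + (Υ p').coeff (d p' + 1) = 0) ∨
    ((∀ j ∈ G.support, (Υ j).natDegree ≤ d j) ∧
      ∑ i ∈ G.supportᶜ, (Υ i).coeff (d i - 1) = 0)) :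
    ∃ b, G.ExtremalityEquation b := by
  obtain ⟨b, hb⟩ := exists_sum_density_eq_quadForm hd h₁ fun i hi => ⟨(h₂ i hi).1, fun r =>
    (isDoublePrimitive_A ⟨i, r⟩).eq (G.isOpen_interval _) ((h₂ i hi).2 r) fun _ _ => rfl⟩
  obtain ⟨b', hb'⟩ := exists_quadForm_eq (G := G) (γ := fun i => (Υ i).coeff (d i + 1))
      (Γ := ∑ i ∈ G.supportᶜ, (Υ i).coeff (d i - 1)) hd (p := p) <| by
    rcases h with h | ⟨p', hne, hS, hN, h⟩ | ⟨hdeg, h⟩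
    · exact Or.inl h
    · refine Or.inr (Or.inl ⟨p', hne, hS, hN, h, ?_⟩)
      have hk : ¬ 3 ≤ k := fun h3 => (three_le_of_sum_ne hd hne).2 h3 hN
      have hempty : G.supportᶜ = ∅ := by
        rw [← Finset.card_eq_zero, Finset.card_compl, Fintype.card_fin, hS,
          Finset.card_pair hne.symm]
        omega
      rw [hempty, Finset.sum_empty]
    · exact Or.inr (Or.inr ⟨fun j hj => coeff_eq_zero_of_natDegree_lt
        (Nat.lt_succ_of_le (hdeg j hj)), h⟩)
  exact ⟨b' + b, fun x hx => by rw [hb x hx, hb', affineFun_add]⟩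

/-- The alternatives for the leading coefficients of the polynomials given by the extremality
equation. -/
theorem ExtremalityEquation.leadingCoeff_relations (hd : ∀ i, 0 < d i) {b : Fin k → ℕ → ℝ}
    (hb : G.ExtremalityEquation b) {Υ : Fin k → ℝ[X]}
    (h₁ : ∀ i ∈ G.support, (Υ i).natDegree ≤ d i + 1 ∧
      ∀ r, ∀ z ∈ G.interval ⟨i, r⟩, G.A ⟨i, r⟩ z = (Υ i).eval z)
    (h₂ : ∀ i ∉ G.support, (Υ i).natDegree ≤ d i - 1 ∧
      ∀ r, ∀ z ∈ G.interval ⟨i, r⟩, deriv (deriv (G.A ⟨i, r⟩)) z = (Υ i).eval z)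
    {p : Fin k} (hp : p ∈ G.support) :
    (G.support = {p} ∧
      ((∑ i, d i : ℕ) - d p : ℝ) * ((∑ i, d i : ℕ) + 1 - d p : ℝ) * (Υ p).coeff (d p + 1) +
        ∑ i ∈ G.supportᶜ, (Υ i).coeff (d i - 1) = 0) ∨
    (∃ p', p' ≠ p ∧ G.support = {p, p'} ∧ ∑ i, d i = d p + d p' ∧
      (Υ p).coeff (d p + 1) + (Υ p').coeff (d p' + 1) = 0) ∨
    (2 ≤ G.support.card ∧ 3 ≤ k ∧ (∀ j ∈ G.support, (Υ j).natDegree ≤ d j) ∧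
      ∑ i ∈ G.supportᶜ, (Υ i).coeff (d i - 1) = 0) := by
  obtain ⟨b', hb'⟩ := exists_sum_density_eq_quadForm hd h₁ h₂
  have hq : ∀ x ∈ G.U, G.quadForm (fun i => (Υ i).coeff (d i + 1))
      (∑ i ∈ G.supportᶜ, (Υ i).coeff (d i - 1)) x = affineFun d (b - b') x := fun x hx => by
    rw [affineFun_sub, ← hb x hx, hb' x hx, add_sub_cancel_right]
  rcases SeparableKahler.leadingCoeff_relations hd hq hp with h | h | ⟨h1, h2, h3, h4⟩
  · exact Or.inl h
  · exact Or.inr (Or.inl h)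
  · refine Or.inr (Or.inr ⟨h1, h2, fun j hj => ?_, h4⟩)
    refine natDegree_le_iff_coeff_eq_zero.2 fun n hn => ?_
    rcases Nat.eq_or_lt_of_le (Nat.succ_le_of_lt hn) with h | h
    · rw [← h]; exact h3 j hj
    · exact coeff_eq_zero_of_natDegree_lt ((h₁ j hj).1.trans_lt h)

/-- The relation for the partition `m = (m - 1) + 1` in terms of a quadratic polynomial. -/
lemma C_add_derivative_derivative_eq_zero_iff {P : ℝ[X]} (hP : P.natDegree ≤ 2) (c : ℝ) :
    C (2 * c) + P.derivative.derivative = 0 ↔ c + P.coeff 2 = 0 := by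
  have h2 : P.derivative.derivative.natDegree ≤ 0 := (natDegree_derivative_le _).trans (by
    have := natDegree_derivative_le P
    omega)
  have h3 : P.derivative.derivative.coeff 0 = P.coeff 2 * 2 := by
    rw [coeff_derivative, coeff_derivative]
    norm_num
  rw [eq_C_of_natDegree_le_zero h2, h3, ← C_add, C_eq_zero]
  constructor <;> intro h <;> linarith

/-- In the independent case the alternatives (a) and (b), specialized to the partition
`m = (m - 1) + 1`, are one relation for `Υ_1` and the quadratic polynomial `A_2`. -/
theorem ExtremalityEquation.of_isVeroneseTimesLine (hd : ∀ i, 0 < d i) {b : Fin k → ℕ → ℝ}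
    (hb : G.ExtremalityEquation b) {Υ : Fin k → ℝ[X]}
    (h₁ : ∀ i ∈ G.support, (Υ i).natDegree ≤ d i + 1 ∧
      ∀ r, ∀ z ∈ G.interval ⟨i, r⟩, G.A ⟨i, r⟩ z = (Υ i).eval z)
    (h₂ : ∀ i ∉ G.support, (Υ i).natDegree ≤ d i - 1 ∧
      ∀ r, ∀ z ∈ G.interval ⟨i, r⟩, deriv (deriv (G.A ⟨i, r⟩)) z = (Υ i).eval z)
    {i j : Fin k} (hij : IsVeroneseTimesLine d i j) (hi : i ∈ G.support) :
    ∃ Υ P : ℝ[X], Υ.natDegree ≤ ∑ i, d i ∧ P.natDegree ≤ 2 ∧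
      (∀ r, ∀ x ∈ G.interval ⟨i, r⟩, G.A ⟨i, r⟩ x = Υ.eval x) ∧
      (∀ r, ∀ x ∈ G.interval ⟨j, r⟩, G.A ⟨j, r⟩ x = P.eval x) ∧
      C (2 * Υ.coeff (∑ i, d i)) + P.derivative.derivative = 0 := by
  have hsum := hij.sum_eq
  obtain ⟨hne, hall, hdj⟩ := hij
  rw [hdj] at hsum
  obtain ⟨hi1, hi2⟩ := h₁ i hi
  rcases hb.leadingCoeff_relations hd h₁ h₂ hi with ⟨hS, h⟩ | ⟨p', hp', hS, -, h⟩ | ⟨-, h3, -⟩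
  · have hj : j ∉ G.support := by rw [hS]; simpa using hne.symm
    have hc : G.supportᶜ = {j} := by
      ext l
      rw [hS]
      rcases hall l with rfl | rfl
      · simp [hne]
      · simp [hne.symm]
    obtain ⟨hj1, hj2⟩ := h₂ j hj
    let r₀ : Fin (d j) := ⟨0, hd j⟩
    obtain ⟨P, hP, hAP⟩ := exists_polynomial_of_second_derivative (F := Υ j)
      (G.isOpen_interval ⟨j, r₀⟩) (G.isPreconnected_interval ⟨j, r₀⟩)
      (fun z hz => ⟨hasDerivAt_A hz, by rw [← hj2 r₀ z hz]; exact hasDerivAt_deriv_A hz⟩)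
    have hP2 : P.natDegree ≤ 2 := by
      have e1 := natDegree_le_of_derivative P
      have e2 := natDegree_le_of_derivative P.derivative
      rw [hP] at e2
      omega
    refine ⟨Υ i, P, by omega, hP2, hi2, fun r => ?_, ?_⟩
    · rwa [show r = r₀ from Fin.ext (by have := r.2; simp [r₀]; omega)]
    · have h0 : (Υ j).coeff 0 = P.coeff 2 * 2 := by
        rw [← hP, coeff_derivative, coeff_derivative]
        norm_num
      rw [C_add_derivative_derivative_eq_zero_iff hP2]
      rw [hc, Finset.sum_singleton, hdj, Nat.sub_self, h0, hsum] at h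
      rw [hsum]
      push_cast at h
      linear_combination (1 / 2) * h
  · have hp'j : p' = j := (hall p').resolve_left hp'
    rw [hp'j] at hS h
    have hj : j ∈ G.support := by rw [hS]; simp
    obtain ⟨hj1, hj2⟩ := h₁ j hj
    rw [hdj] at hj1 h
    refine ⟨Υ i, Υ j, by omega, hj1, hi2, hj2, ?_⟩
    rw [C_add_derivative_derivative_eq_zero_iff hj1, hsum]
    exact h
  · refine absurd hsum ?_
    rw [← hdj]
    exact (three_le_of_sum_ne hd hne.symm).2 h3

/-- Conversely, for the partition `m = (m - 1) + 1` the relation implies alternative (a) or (b),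
according to whether the group `j` belongs to the support. -/
theorem exists_extremalityEquation_of_isVeroneseTimesLine (hd : ∀ i, 0 < d i) {i j : Fin k}
    (hij : IsVeroneseTimesLine d i j) (hi : i ∈ G.support) {Υ P : ℝ[X]}
    (hΥ : Υ.natDegree ≤ ∑ i, d i) (hP : P.natDegree ≤ 2)
    (hAi : ∀ r, ∀ x ∈ G.interval ⟨i, r⟩, G.A ⟨i, r⟩ x = Υ.eval x)
    (hAj : ∀ r, ∀ x ∈ G.interval ⟨j, r⟩, G.A ⟨j, r⟩ x = P.eval x)
    (h : C (2 * Υ.coeff (∑ i, d i)) + P.derivative.derivative = 0) :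
    ∃ b, G.ExtremalityEquation b := by
  rw [C_add_derivative_derivative_eq_zero_iff hP] at h
  have hsum := hij.sum_eq
  obtain ⟨hne, hall, hdj⟩ := hij
  by_cases hj : j ∈ G.support
  · refine exists_extremalityEquation_of_polynomials hd (p := i)
      (Υ := fun l => if l = i then Υ else P) (fun l _ => ?_) (fun l hl => ?_)
      (Or.inr (Or.inl ⟨j, hne.symm, ?_, hsum, ?_⟩))
    · rcases hall l with rfl | rfl
      · rw [if_pos rfl]
        exact ⟨by omega, hAi⟩
      · rw [if_neg hne.symm]
        exact ⟨by omega, hAj⟩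
    · rcases hall l with rfl | rfl
      exacts [absurd hi hl, absurd hj hl]
    · ext l
      rcases hall l with rfl | rfl <;> simp [hi, hj]
    · rw [if_pos rfl, if_neg hne.symm, hdj]
      rwa [hsum, hdj] at h
  · have hS : G.support = {i} := by
      ext l
      rcases hall l with rfl | rfl
      · simp [hi]
      · simp [hj, hne.symm]
    have hc : G.supportᶜ = {j} := by
      ext l
      rw [hS]
      rcases hall l with rfl | rfl
      · simp [hne]
      · simp [hne.symm]
    refine exists_extremalityEquation_of_polynomials hd (p := i)
      (Υ := fun l => if l = i then Υ else P.derivative.derivative) (fun l hl => ?_)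
      (fun l hl => ?_) (Or.inl ⟨hS, ?_⟩)
    · rcases hall l with rfl | rfl
      · rw [if_pos rfl]
        exact ⟨by omega, hAi⟩
      · exact absurd hl hj
    · rcases hall l with rfl | rfl
      · exact absurd hi hl
      · rw [if_neg hne.symm]
        refine ⟨?_, fun r => ⟨deriv (G.A ⟨l, r⟩), fun z hz => ⟨hasDerivAt_A hz,
          (hasDerivAt_deriv_A hz).congr_deriv ((deriv_A_eq (hAj r)).2 z hz)⟩⟩⟩
        have e1 := natDegree_derivative_le P
        have e2 := natDegree_derivative_le P.derivative
        omega
    · have h3 : P.derivative.derivative.coeff 0 = P.coeff 2 * 2 := by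
        rw [coeff_derivative, coeff_derivative]
        norm_num
      rw [hsum, hdj] at h
      rw [hc, Finset.sum_singleton, if_pos rfl, if_neg hne.symm, hdj, Nat.sub_self, h3, hsum, hdj]
      push_cast
      linear_combination 2 * h

end SeparableKahler

end SegreVeronese

end

theorem mainTheorem1 {k : ℕ} (d : Fin k → ℕ) (hd : ∀ i, 1 ≤ d i)
    (not_veronese : 2 ≤ k) (not_segre : ∃ i, d i ≠ 1)
    (G : SegreVeronese.SeparableKahler d) :
    G.IsExtremal ↔
      -- (1) constant twist
      (∃ t : ℝ, t ≠ 0 ∧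
        (G.β : SegreVeronese.Tensors d) = t • PiTensorProduct.tprod ℝ (fun _ => ![1, 0]) ∧
        ∃ (Υ : Fin k → ℝ[X]) (ν₀ ν₁ : SegreVeronese.Slot d → ℝ),
          (∀ p, (Υ p).natDegree ≤ d p + 2) ∧
          ∀ p q, ∀ x ∈ G.interval ⟨p, q⟩,
            G.A ⟨p, q⟩ x = (Υ p).eval x + ν₀ ⟨p, q⟩ + ν₁ ⟨p, q⟩ * x) ∨
      -- (2) the twist decomposes in one group of slots
      (∃ (p : Fin k) (t a b : ℝ), t ≠ 0 ∧ b ≠ 0 ∧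
        (G.β : SegreVeronese.Tensors d) =
          SegreVeronese.ins d p (t • PiTensorProduct.tprod ℝ (fun _ => ![a, b])) ∧
        ∃ Υ : Fin k → ℝ[X],
          (Υ p).natDegree ≤ d p + 1 ∧
          (∀ i, i ≠ p → (Υ i).natDegree ≤ d i - 1) ∧
          (∀ q, ∃ F : ℝ → ℝ,
            SegreVeronese.IsDoublePrimitive (G.interval ⟨p, q⟩)
              (fun x => (Υ p).eval x / (a + b * x) ^ ((∑ i, d i) + 3)) F ∧
            ∀ x ∈ G.interval ⟨p, q⟩, G.A ⟨p, q⟩ x = (a + b * x) ^ ((∑ i, d i) + 1) * F x) ∧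
          (∀ i, i ≠ p → ∀ r, SegreVeronese.IsDoublePrimitive (G.interval ⟨i, r⟩)
            (fun x => (Υ i).eval x) (G.A ⟨i, r⟩)) ∧
          (Υ p).coeff (d p + 1) / b ^ 2 +
            ∑ i ∈ Finset.univ.erase p, (Υ i).coeff (d i - 1) = 0) ∨
      -- (3) partition `m = (m - 1) + 1`, independent case
      (∃ i j : Fin k, SegreVeronese.IsVeroneseTimesLine d i j ∧
        (∃ q, G.IndependentAt ⟨i, q⟩) ∧
        ∃ Υ P : ℝ[X], Υ.natDegree ≤ ∑ i, d i ∧ P.natDegree ≤ 2 ∧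
          (∀ r, ∀ x ∈ G.interval ⟨i, r⟩, G.A ⟨i, r⟩ x = Υ.eval x) ∧
          (∀ r, ∀ x ∈ G.interval ⟨j, r⟩, G.A ⟨j, r⟩ x = P.eval x) ∧
          Polynomial.C (2 * Υ.coeff (∑ i, d i)) + P.derivative.derivative = 0) ∨
      -- (4) all other partitions, independent case
      (∃ (p : Fin k) (q : Fin (d p)), G.IndependentAt ⟨p, q⟩ ∧
        (¬ ∃ i j : Fin k, SegreVeronese.IsVeroneseTimesLine d i j) ∧
        ∃ Υ : Fin k → ℝ[X],
          (∀ i ∈ G.support, (Υ i).natDegree ≤ d i + 1 ∧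
            ∀ r, ∀ x ∈ G.interval ⟨i, r⟩, G.A ⟨i, r⟩ x = (Υ i).eval x) ∧
          (∀ i ∉ G.support, (Υ i).natDegree ≤ d i - 1 ∧
            ∀ r, SegreVeronese.IsDoublePrimitive (G.interval ⟨i, r⟩)
              (fun x => (Υ i).eval x) (G.A ⟨i, r⟩)) ∧
          -- exactly one of (a), (b), (c) holds
          ∃! n : Fin 3, (![
            -- (a)
            G.support = {p} ∧
              ((∑ i, d i : ℕ) - d p : ℝ) * ((∑ i, d i : ℕ) + 1 - d p : ℝ) *
                  (Υ p).coeff (d p + 1) +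
                ∑ i ∈ G.supportᶜ, (Υ i).coeff (d i - 1) = 0,
            -- (b)
            ∃ p', p' ≠ p ∧ G.support = {p, p'} ∧ ∑ i, d i = d p + d p' ∧
              (Υ p).coeff (d p + 1) + (Υ p').coeff (d p' + 1) = 0,
            -- (c)
            2 ≤ G.support.card ∧ 3 ≤ k ∧
              (∀ j ∈ G.support, (Υ j).natDegree ≤ d j) ∧
              ∑ i ∈ G.supportᶜ, (Υ i).coeff (d i - 1) = 0] : Fin 3 → Prop) n) := open SegreVeronese SegreVeronese.SeparableKahler in by
  have hd' : ∀ i, 0 < d i := fun i => hd i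
  obtain ⟨i₁, hi₁⟩ := not_segre
  have : Nonempty (Slot d) := ⟨⟨i₁, ⟨0, hd i₁⟩⟩⟩
  have hN : ∀ i, d i + 1 ≤ ∑ i, d i := by
    intro i
    have : Nontrivial (Fin k) := Fin.nontrivial_iff_two_le.2 not_veronese
    obtain ⟨j, hj⟩ := exists_ne i
    have h1 := hd j
    rw [sum_eq_add_sum_erase_erase hj]
    omega
  have hN3 : 3 ≤ ∑ i, d i := by
    have h1 := hN i₁
    have h2 := hd i₁
    omega
  rw [isExtremal_iff]
  constructor
  · rintro ⟨b, hb⟩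
    replace hb : G.ExtremalityEquation b := hb
    rcases G.support.eq_empty_or_nonempty with hS | ⟨p, hp⟩
    · exact Or.inl (hb.of_support_eq_empty hS)
    by_cases hind : ∀ i ∈ G.support, ∀ (r : Fin (d i)) (c : ℝ),
        ∃ x, affineFun d G.twistCoeff (Function.update x ⟨i, r⟩ c) ≠ 0
    swap
    · push Not at hind
      obtain ⟨i, hi, r, c, h⟩ := hind
      obtain ⟨ht, hβ, hΥ⟩ := hb.of_prod hd' hi fun x => by rw [twist_eq, affineFun_eq_prod h]
      exact Or.inr (Or.inl ⟨i, _, -c, 1, ht, one_ne_zero, hβ, hΥ⟩)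
    obtain ⟨Υ, h₁, h₂⟩ := hb.exists_polynomials hN hN3 hp hind
    refine Or.inr (Or.inr ?_)
    by_cases hij : ∃ i j, IsVeroneseTimesLine d i j
    · obtain ⟨i, j, hij⟩ := hij
      have hi : i ∈ G.support := by
        by_contra hi
        have hS : G.support ⊆ {j} := fun l hl => by
          rcases hij.2.1 l with rfl | rfl
          · exact absurd hl hi
          · exact Finset.mem_singleton_self _
        have hj : j ∈ G.support := by rwa [← Finset.mem_singleton.1 (hS hp)]
        obtain ⟨c, hc⟩ := exists_affineFun_update_eq_zero hij.2.2 hS hj ⟨0, hd j⟩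
        obtain ⟨x, hx⟩ := hind j hj ⟨0, hd j⟩ c
        exact hx (hc x)
      exact Or.inl ⟨i, j, hij, exists_independentAt hd' hi (hind i hi),
        hb.of_isVeroneseTimesLine hd' h₁ h₂ hij hi⟩
    obtain ⟨q, hq⟩ := exists_independentAt hd' hp (hind p hp)
    refine Or.inr ⟨p, q, hq, hij, Υ, h₁, fun i hi => ⟨(h₂ i hi).1, fun r => ?_⟩,
      existsUnique_fin_three ?_⟩
    · exact ⟨deriv (G.A ⟨i, r⟩), fun z hz => ⟨hasDerivAt_A hz,
        (hasDerivAt_deriv_A hz).congr_deriv ((h₂ i hi).2 r z hz)⟩⟩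
    -- (a) and (b) differ in the number of elements of the support, (b) and (c) in that of groups
    · rcases hb.leadingCoeff_relations hd' h₁ h₂ hp with ⟨hS, h⟩ | ⟨p', hne, hS, hs, h⟩ | h
      · refine Or.inl ⟨⟨hS, h⟩, ?_, ?_⟩
        · rintro ⟨p', hne, hS', -⟩
          have hmem : p' ∈ G.support := by simp [hS']
          rw [hS] at hmem
          exact hne (Finset.mem_singleton.1 hmem)
        · rintro ⟨hcard, -⟩
          simp [hS] at hcard
      · refine Or.inr (Or.inl ⟨⟨p', hne, hS, hs, h⟩, ?_, ?_⟩)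
        · rintro ⟨hS', -⟩
          have hmem : p' ∈ G.support := by simp [hS]
          rw [hS'] at hmem
          exact hne (Finset.mem_singleton.1 hmem)
        · rintro ⟨-, hk, -⟩
          exact (three_le_of_sum_ne hd' hne).2 hk hs
      · refine Or.inr (Or.inr ⟨h, ?_, ?_⟩)
        · rintro ⟨hS', -⟩
          have hcard := h.1
          simp [hS'] at hcard
        · rintro ⟨p', hne, -, hs, -⟩
          exact (three_le_of_sum_ne hd' hne).2 h.2.1 hs
  · rintro (⟨t, -, hβ, Υ, ν₀, ν₁, hΥ, hA⟩ | ⟨p, t, a, b, -, hb, hβ, Υ, h₁, h₂, h₃, h₄, h₅⟩ |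
      ⟨i, j, hij, ⟨q, hq⟩, Υ, P, hΥ, hP, hAi, hAj, h⟩ | ⟨p, q, -, -, Υ, h₁, h₂, n, hn, -⟩)
    · exact exists_extremalityEquation_of_const hd' hβ hΥ hA
    · exact exists_extremalityEquation_of_ins hd' hb hβ h₁ h₂ h₃ h₄ h₅
    · exact exists_extremalityEquation_of_isVeroneseTimesLine hd' hij
        (mem_support_of_independentAt hq) hΥ hP hAi hAj h
    · refine exists_extremalityEquation_of_polynomials hd' h₁ h₂ (p := p) ?_
      fin_cases n
      · exact Or.inl hn
      · exact Or.inr (Or.inl hn)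
      · exact Or.inr (Or.inr ⟨hn.2.2.1, hn.2.2.2⟩)
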